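/- **Definitions.** A finite set $P\subset\mathbb Z^2$ of $N$ points (read as unit squares, the *tiles*, centered at these points) is a *polyomino* if its induced grid graph is connected, and it is *simple* if the grid graph induced by $\mathbb Z^2\setminus P$ is connected too. A tile $t\in P$ is *locally reflex* if some $2\times 2$ square contains exactly three tiles of $P$: $t$ and its two neighbors in that square. A *cut* is an orthogonal curve that moves in unit steps along corners of grid squares and neither starts nor ends in the interior of $P$; it is *straight* if it makes no turn in the interior of $P$. It is a *2-cut* if deleting the adjacencies it crosses from the grid graph of $P$ leaves exactly two connected components (subpolyominoes), and a 2-cut is *valid* if these two can be translated apart arbitrarily far in opposite directions, left/right or up/down, without a tile of one ever coinciding with a tile of the other. **Theorem.** There is an algorithm that, given a simple polyomino $P$ as a list of its $N$ tiles in arbitrary order, outputs a valid straight 2-cut of $P$ (as the list of the corners on the curve) if there is one, and reports that there is none otherwise, in time $$O(N+r^2\log r),$$ where $r$ is the number of locally reflex tiles of $P$ (and $r^2\log r$ is read as $0$ for $r=0$). Here time is the number of elementary operations of a word RAM with unit-cost integer arithmetic $+,-,\cdot,\div$, indirect addressing, memory initially zero outside the input, and words of $O(\log(N+M))$ bits,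 where $M$ bounds the absolute values of the coordinates of the tiles. -/

import Mathlib

/-! ## Polyominoes -/

/-- The square grid: two points of `ℤ × ℤ` are joined when they are at unit distance. -/
def gridGraph : SimpleGraph (ℤ × ℤ) where
  Adj p q := |p.1 - q.1| + |p.2 - q.2| = 1
  symm := ⟨fun p q h => by rw [abs_sub_comm q.1, abs_sub_comm q.2]; exact h⟩
  loopless := ⟨fun p h => by simp at h⟩

/-- A finite set of grid points is a polyomino if its grid graph is connected (in particular it is
nonempty).  The point `p` stands for the unit square centered at `p`, called a tile. -/
def IsPolyomino (P : Finset (ℤ × ℤ)) : Prop :=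
  (gridGraph.induce (P : Set (ℤ × ℤ))).Connected

/-- A polyomino is simple (hole-free) if the grid graph of its complement is connected. -/
def IsHoleFree (P : Finset (ℤ × ℤ)) : Prop :=
  (gridGraph.induce ((P : Set (ℤ × ℤ))ᶜ)).Connected

/-- `t` is locally reflex in `P`: some `2 × 2` square contains exactly three tiles of `P`, namely
`t` and its two neighbors in the square. -/
def IsLocallyReflex (P : Finset (ℤ × ℤ)) (t : ℤ × ℤ) : Prop :=
  t ∈ P ∧ ∃ a b : ℤ, (a = 1 ∨ a = -1) ∧ (b = 1 ∨ b = -1) ∧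
    (t.1 + a, t.2) ∈ P ∧ (t.1, t.2 + b) ∈ P ∧ (t.1 + a, t.2 + b) ∉ P

open Classical in
/-- The number of locally reflex tiles of `P`. -/
noncomputable def reflexCount (P : Finset (ℤ × ℤ)) : ℕ :=
  (P.filter (IsLocallyReflex P)).card

/-! ## Cuts

The corners of the tiles form a second copy of `ℤ × ℤ`: the pair `(i, j)`, read as a corner, is
the point `(i - 1/2, j - 1/2)` of the plane, the lower left corner of the tile `(i, j)`. -/

/-- `u` is one of the four corners of the tile `t`. -/
def IsTileCorner (u t : ℤ × ℤ) : Prop :=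
  (u.1 = t.1 ∨ u.1 = t.1 + 1) ∧ (u.2 = t.2 ∨ u.2 = t.2 + 1)

/-- The corner `u` lies in the interior of the polyomino: all four tiles around it are in `P`. -/
def IsInteriorCorner (P : Finset (ℤ × ℤ)) (u : ℤ × ℤ) : Prop :=
  ∀ t, IsTileCorner u t → t ∈ P

/-- A cut: an orthogonal curve of unit steps between corners, given by the list of corners it
visits.  It passes all the way through `P`, i.e. it does not end in the interior of `P`. -/
structure IsCut (P : Finset (ℤ × ℤ)) (γ : List (ℤ × ℤ)) : Prop where
  chain : γ.IsChain gridGraph.Adj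
  head_not_interior : ∀ u ∈ γ.head?, ¬ IsInteriorCorner P u
  last_not_interior : ∀ u ∈ γ.getLast?, ¬ IsInteriorCorner P u

/-- A cut is straight if it makes no turn inside `P`. -/
def IsStraight (P : Finset (ℤ × ℤ)) (γ : List (ℤ × ℤ)) : Prop :=
  ∀ u v w, [u, v, w] <:+: γ → IsInteriorCorner P v → w - v = v - u

/-- A step of the curve runs along the common side of the tiles `p` and `q`. -/
def Separates (γ : List (ℤ × ℤ)) (p q : ℤ × ℤ) : Prop :=
  ∃ u v, [u, v] <:+: γ ∧ IsTileCorner u p ∧ IsTileCorner v p ∧ IsTileCorner u q ∧ IsTileCorner v q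

/-- The grid graph of `P` without the adjacencies that the curve cuts. -/
def cutGraph (P : Finset (ℤ × ℤ)) (γ : List (ℤ × ℤ)) : SimpleGraph (P : Set (ℤ × ℤ)) where
  Adj p q := gridGraph.Adj (p : ℤ × ℤ) q ∧ ¬ Separates γ p q
  symm := ⟨fun _ _ h => ⟨h.1.symm, fun ⟨u, v, h0, h1, h2, h3, h4⟩ =>
    h.2 ⟨u, v, h0, h3, h4, h1, h2⟩⟩⟩
  loopless := ⟨fun _ h => gridGraph.loopless.irrefl _ h.1⟩

/-- The subpolyominoes into which the curve splits `P`. -/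
def pieces (P : Finset (ℤ × ℤ)) (γ : List (ℤ × ℤ)) : Set (Set (ℤ × ℤ)) :=
  Set.range fun c : (cutGraph P γ).ConnectedComponent => (Subtype.val '' c.supp : Set (ℤ × ℤ))

/-- A `k`-cut splits `P` into exactly `k` subpolyominoes. -/
def IsKCut (k : ℕ) (P : Finset (ℤ × ℤ)) (γ : List (ℤ × ℤ)) : Prop :=
  IsCut P γ ∧ (pieces P γ).ncard = k

/-- `A` can be moved in direction `d` and `B` in the opposite direction, arbitrarily far,
without a tile of `A` ever running into a tile of `B`. -/
def CanPullApart (d : ℤ × ℤ) (A B : Set (ℤ × ℤ)) : Prop :=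
  ∀ m n : ℕ, ∀ p ∈ A, ∀ q ∈ B, p + m • d ≠ q - n • d

/-- A cut into two pieces is valid if the pieces can be pulled apart into opposite horizontal or
opposite vertical directions. -/
def IsValid (P : Finset (ℤ × ℤ)) (γ : List (ℤ × ℤ)) : Prop :=
  ∃ A B, pieces P γ = {A, B} ∧
    ∃ d ∈ ({(1, 0), (-1, 0), (0, 1), (0, -1)} : Set (ℤ × ℤ)), CanPullApart d A B

def IsValidStraightTwoCut (P : Finset (ℤ × ℤ)) (γ : List (ℤ × ℤ)) : Prop :=
  IsKCut 2 P γ ∧ IsStraight P γ ∧ IsValid P γ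

/-! ## Random access machines

A word RAM, programmed in a structured language.  A program is one finite object, fixed for all
inputs.  Every elementary operation (reading a constant, a register or a memory cell; arithmetic;
writing) takes one unit of time, and every integer that occurs must fit into a machine word, whose
range `[-W, W]` is a parameter of the semantics: a program that exceeds it gets stuck. -/

namespace RAM

inductive Op
  | add | sub | mul | div

/-- Integer arithmetic; `div` is division with remainder (and division by zero gives zero). -/
def Op.apply : Op → ℤ → ℤ → ℤ
  | .add, a, b => a + b
  | .sub, a, b => a - b
  | .mul, a, b => a * b
  | .div, a, b => a / b

inductive Expr
  /-- a constant -/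
  | lit (z : ℤ)
  /-- the content of a register -/
  | reg (i : ℕ)
  /-- the content of the memory cell whose address is the value of `e` -/
  | mem (e : Expr)
  /-- an arithmetic operation -/
  | op (o : Op) (e f : Expr)

structure State where
  reg : ℕ → ℤ
  mem : ℤ → ℤ

/-- The value of an expression. -/
def Expr.eval (s : State) : Expr → ℤ
  | .lit z => z
  | .reg i => s.reg i
  | .mem e => s.mem (e.eval s)
  | .op o e f => o.apply (e.eval s) (f.eval s)

/-- The number of elementary operations that the evaluation of an expression takes. -/
def Expr.cost : Expr → ℕ
  | .lit _ => 1
  | .reg _ => 1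
  | .mem e => e.cost + 1
  | .op _ e f => e.cost + f.cost + 1

/-- All values that occur in the evaluation of an expression fit into a word. -/
def Expr.Fits (W : ℕ) (s : State) : Expr → Prop
  | .lit z => |z| ≤ W
  | .reg i => |s.reg i| ≤ W
  | .mem e => e.Fits W s ∧ |s.mem (e.eval s)| ≤ W
  | .op o e f => e.Fits W s ∧ f.Fits W s ∧ |o.apply (e.eval s) (f.eval s)| ≤ W

inductive Cmd
  | skip
  /-- write the value of `e` into register `i` -/
  | setReg (i : ℕ) (e : Expr)
  /-- write the value of `e` into the memory cell whose address is the value of `a` -/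
  | setMem (a e : Expr)
  | seq (c d : Cmd)
  /-- execute `c` if the value of `e` is positive, and `d` otherwise -/
  | ite (e : Expr) (c d : Cmd)
  /-- repeat `c` as long as the value of `e` is positive -/
  | loop (e : Expr) (c : Cmd)

/-- `Exec W c s s' t`: with words of range `[-W, W]`, the program `c` started in state `s` halts in
state `s'` after `t` elementary operations, and no value ever overflows. -/
inductive Exec (W : ℕ) : Cmd → State → State → ℕ → Prop
  | skip (s : State) : Exec W .skip s s 1
  | setReg (s : State) (i : ℕ) (e : Expr) (h : e.Fits W s) :
      Exec W (.setReg i e) s { s with reg := Function.update s.reg i (e.eval s) } (e.cost + 1)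
  | setMem (s : State) (a e : Expr) (ha : a.Fits W s) (he : e.Fits W s) :
      Exec W (.setMem a e) s { s with mem := Function.update s.mem (a.eval s) (e.eval s) }
        (a.cost + e.cost + 1)
  | seq {c d : Cmd} {s₁ s₂ s₃ : State} {t₁ t₂ : ℕ}
      (hc : Exec W c s₁ s₂ t₁) (hd : Exec W d s₂ s₃ t₂) : Exec W (.seq c d) s₁ s₃ (t₁ + t₂)
  | ite_pos {e : Expr} {c d : Cmd} {s s' : State} {t : ℕ} (he : e.Fits W s) (hpos : 0 < e.eval s)
      (hc : Exec W c s s' t) : Exec W (.ite e c d) s s' (e.cost + 1 + t)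
  | ite_neg {e : Expr} {c d : Cmd} {s s' : State} {t : ℕ} (he : e.Fits W s) (hneg : e.eval s ≤ 0)
      (hd : Exec W d s s' t) : Exec W (.ite e c d) s s' (e.cost + 1 + t)
  | loop_pos {e : Expr} {c : Cmd} {s₁ s₂ s₃ : State} {t₁ t₂ : ℕ} (he : e.Fits W s₁)
      (hpos : 0 < e.eval s₁) (hc : Exec W c s₁ s₂ t₁) (hl : Exec W (.loop e c) s₂ s₃ t₂) :
      Exec W (.loop e c) s₁ s₃ (e.cost + 1 + t₁ + t₂)
  | loop_neg {e : Expr} {c : Cmd} {s : State} (he : e.Fits W s) (hneg : e.eval s ≤ 0) :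
      Exec W (.loop e c) s s (e.cost + 1)

/-- The initial state for a list of `N` points: register `0` holds `N`, the memory cells `2 k` and
`2 k + 1` hold the coordinates of the `k`-th point for `0 ≤ k < N`, and everything else is `0`. -/
def input (L : List (ℤ × ℤ)) : State where
  reg i := if i = 0 then (L.length : ℤ) else 0
  mem a :=
    if a < 0 then 0
    else if a % 2 = 0 then (L.getD (a / 2).toNat (0, 0)).1
    else (L.getD (a / 2).toNat (0, 0)).2

/-- The list of points found in a final state: register `0` holds its length (a negative number
is read as `0`), and the coordinates stand in consecutive memory cells, from the address in
register `1` on. -/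
def output (s : State) : List (ℤ × ℤ) :=
  (List.range (s.reg 0).toNat).map fun k =>
    (s.mem (s.reg 1 + 2 * (k : ℤ)), s.mem (s.reg 1 + 2 * (k : ℤ) + 1))

end RAM

/-! The program below runs in time O(N); the summand r² log r is nonnegative and only dropped at the
very end. The argument has a geometric and an algorithmic half.

Geometry. A chord is a maximal horizontal segment all of whose unit steps run between two tiles of
P. A straight cut that uses one step of a chord runs along all of it, because at an interior corner
it can neither stop nor turn (`IsChord.hasStep`). In a simple polyomino a chord separates the tiles
on its two sides, by a winding number argument (`IsChord.notMem_pieceOf`), and it leaves exactly two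
pieces (`IsChord.pieces_eq_pair`). So a straight 2-cut containing a chord has the same pieces as the
chord, and only chords of P and of its transpose need to be examined
(`IsValidStraightTwoCut.exists_isChord`). Two pieces can be pulled apart exactly if one of them is
closed in some direction d: it contains every tile of P that lies in direction d from one of its
tiles. The other piece is then closed in direction -d, so with four directions at hand it does not
matter which piece is tested. Closedness only has to be checked for the next tile of P in that
direction (`closed_next_iff`).

Algorithm. There may be linearly many chords, so the tests must share work. P is searched with two
stacks: neighbors inside a row have priority, and when none is left the most recent pending neighbor
across rows is entered. Then, for every horizontal chord, the side without the root is the set of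
descendants of one tile c, entered across the chord (`SearchTree.mem_of_desc`,
`SearchTree.desc_of_mem`), and its search numbers form an interval that starts with the number of c
(`SearchTree.mem_of_between`). Closedness under a next-tile map thus compares the least and the
largest search number of images with the ends of this interval (`SearchTree.closed_iff`). The
subtree maxima required are accumulated in one sweep against the search order (`AggInv`). A second
stage with rows and columns exchanged treats vertical chords.

Resources. Tables are indexed by tile codes of size quadratic in N, in memory that is zero
beforehand, so only linearly many cells are ever used. Next tiles come from a bucket sort. Every
loop has a loop-free body and a potential bounded by a multiple of N (`Runs.loop`), and all stored
values stay below a bound D that is quadratic in N + M. -/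

namespace RAM

/-! ### Memory as an array of fields -/

/-- The memory seen as 32 arrays: entry `a` of array `f`.  Nonnegative indices occupy the negative
addresses. -/
def arr (s : State) (f : Fin 32) (a : ℤ) : ℤ := s.mem (-((f : ℕ) : ℤ) - 1 - 32 * a)

/-- The address of entry `e` of array `f`. -/
def adr (f : Fin 32) (e : Expr) : Expr :=
  .op .sub (.lit (-((f : ℕ) : ℤ) - 1)) (.op .mul (.lit 32) e)

def rd (f : Fin 32) (e : Expr) : Expr := .mem (adr f e)

def wr (f : Fin 32) (a e : Expr) : Cmd := .setMem (adr f a) e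

def setR (s : State) (i : ℕ) (v : ℤ) : State := { s with reg := Function.update s.reg i v }

def setM (s : State) (z v : ℤ) : State := { s with mem := Function.update s.mem z v }

def setArr (s : State) (f : Fin 32) (a v : ℤ) : State := setM s (-((f : ℕ) : ℤ) - 1 - 32 * a) v

@[simp] theorem reg_setR (s : State) (i j : ℕ) (v : ℤ) :
    (setR s i v).reg j = if j = i then v else s.reg j := by
  simp [setR, Function.update_apply]

@[simp] theorem reg_setM (s : State) (z v : ℤ) : (setM s z v).reg = s.reg := rfl

@[simp] theorem reg_setArr (s : State) (f : Fin 32) (a v : ℤ) : (setArr s f a v).reg = s.reg := rfl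

@[simp] theorem mem_setR (s : State) (i : ℕ) (v : ℤ) : (setR s i v).mem = s.mem := rfl

@[simp] theorem arr_setR (s : State) (i : ℕ) (v : ℤ) (f : Fin 32) :
    arr (setR s i v) f = arr s f := rfl

theorem mem_setM (s : State) (z v y : ℤ) :
    (setM s z v).mem y = if y = z then v else s.mem y := by
  simp [setM, Function.update_apply]

theorem mem_setArr_of_nonneg (s : State) (f : Fin 32) {a : ℤ} (v : ℤ) {y : ℤ} (ha : 0 ≤ a)
    (hy : 0 ≤ y) : (setArr s f a v).mem y = s.mem y := by
  rw [setArr, mem_setM, if_neg (by omega)]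

-- Different arrays occupy different residue classes of addresses modulo 32, so they never
-- interfere.
@[simp] theorem arr_setArr (s : State) (f g : Fin 32) (a v : ℤ) :
    arr (setArr s f a v) g = if g = f then Function.update (arr s f) a v else arr s g := by
  funext b
  have hf := f.isLt
  have hg := g.isLt
  split_ifs with h
  · subst h
    by_cases hb : b = a
    · subst hb; simp [arr, setArr, mem_setM]
    · rw [Function.update_of_ne hb, arr, setArr, mem_setM, if_neg (by omega), arr]
  · rw [arr, setArr, mem_setM, if_neg, arr]
    intro h'
    apply h
    apply Fin.ext
    omega

/-- Input and output live at nonnegative addresses, the used part of the tables at negative ones;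
hence output can be written while the tables are still being read. -/
theorem arr_setM_of_nonneg (s : State) {z : ℤ} (v : ℤ) (hz : 0 ≤ z) (f : Fin 32) {a : ℤ}
    (ha : 0 ≤ a) : arr (setM s z v) f a = arr s f a := by
  rw [arr, mem_setM, if_neg (by omega), arr]

@[simp] theorem eval_rd (s : State) (f : Fin 32) (e : Expr) :
    (rd f e).eval s = arr s f (e.eval s) := rfl

/-! ### Static bounds on expressions -/

/-- All registers and memory cells are bounded by `D`. -/
def Bounded (D : ℕ) (s : State) : Prop := (∀ i, |s.reg i| ≤ (D : ℤ)) ∧ ∀ z, |s.mem z| ≤ (D : ℤ)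

theorem Bounded.arr {D : ℕ} {s : State} (h : Bounded D s) (f : Fin 32) (a : ℤ) :
    |arr s f a| ≤ (D : ℤ) := h.2 _

theorem Bounded.setR {D : ℕ} {s : State} (h : Bounded D s) (i : ℕ) {v : ℤ} (hv : |v| ≤ (D : ℤ)) :
    Bounded D (setR s i v) := by
  refine ⟨fun j => ?_, h.2⟩
  rw [reg_setR]; split_ifs
  exacts [hv, h.1 j]

theorem Bounded.setM {D : ℕ} {s : State} (h : Bounded D s) (z : ℤ) {v : ℤ} (hv : |v| ≤ (D : ℤ)) :
    Bounded D (setM s z v) := by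
  refine ⟨h.1, fun y => ?_⟩
  rw [mem_setM]; split_ifs
  exacts [hv, h.2 y]

/-- Together with `Expr.deg` this gives the monomial bound of `Expr.abs_eval_le`. A quotient is at
most as large as its dividend, so divisors do not enter. -/
def Expr.coef : Expr → ℕ
  | .lit z => z.natAbs
  | .reg _ => 1
  | .mem _ => 1
  | .op .add e f => e.coef + f.coef
  | .op .sub e f => e.coef + f.coef
  | .op .mul e f => e.coef * f.coef
  | .op .div e _ => e.coef

def Expr.deg : Expr → ℕ
  | .lit _ => 0
  | .reg _ => 1
  | .mem _ => 1
  | .op .add e f => max e.deg f.deg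
  | .op .sub e f => max e.deg f.deg
  | .op .mul e f => e.deg + f.deg
  | .op .div e _ => e.deg

/-- The value of `e` is polynomially small whenever registers and memory cells are small. -/
def Expr.static : Expr → Bool
  | .lit z => z.natAbs ≤ 1000
  | .reg _ => true
  | .mem e => e.static
  -- The thresholds correspond to the word size `1000 * D ^ 2` in `Expr.fits_of_static`.
  | .op o e f => e.static && f.static && ((Expr.op o e f).coef ≤ 1000 && (Expr.op o e f).deg ≤ 2)

theorem Expr.abs_eval_le {D : ℕ} (hD : 1 ≤ D) {s : State} (hs : Bounded D s) (e : Expr) :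
    |e.eval s| ≤ ((e.coef * D ^ e.deg : ℕ) : ℤ) := by
  induction e with
  | lit z => simp [eval, coef, deg]
  | reg i => simpa [eval, coef, deg] using hs.1 i
  | mem e _ => simpa [eval, coef, deg] using hs.2 _
  | op o e f he hf =>
    have key : e.coef * D ^ e.deg + f.coef * D ^ f.deg ≤
        (e.coef + f.coef) * D ^ (max e.deg f.deg) := by
      rw [add_mul]
      gcongr <;> simp
    cases o with
    | add =>
      simp only [eval, Op.apply, coef, deg]
      refine (abs_add_le _ _).trans (le_trans (add_le_add he hf) ?_)
      exact_mod_cast key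
    | sub =>
      simp only [eval, Op.apply, coef, deg]
      refine (abs_sub _ _).trans (le_trans (add_le_add he hf) ?_)
      exact_mod_cast key
    | mul =>
      simp only [eval, Op.apply, coef, deg]
      rw [abs_mul]
      refine (mul_le_mul he hf (abs_nonneg _) (by positivity)).trans (le_of_eq ?_)
      push_cast
      ring
    | div =>
      simp only [eval, Op.apply, coef, deg]
      refine le_trans ?_ he
      exact Int.abs_ediv_le_abs _ _

theorem Expr.fits_of_static {D W : ℕ} (hD : 1 ≤ D) (hW : 1000 * D ^ 2 ≤ W) {s : State}
    (hs : Bounded D s) (e : Expr) (he : e.static = true) : e.Fits W s := by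
  have hDW : D ≤ W := by nlinarith
  induction e with
  | lit z =>
    simp only [static, decide_eq_true_eq] at he
    simp only [Fits]
    have : 1000 ≤ W := by nlinarith
    rw [Int.abs_eq_natAbs]
    omega
  | reg i => exact (hs.1 i).trans (by exact_mod_cast hDW)
  | mem e ih => exact ⟨ih he, (hs.2 _).trans (by exact_mod_cast hDW)⟩
  | op o e f ihe ihf =>
    simp only [static, Bool.and_eq_true, decide_eq_true_eq] at he
    refine ⟨ihe he.1.1, ihf he.1.2, ?_⟩
    refine (Expr.abs_eval_le hD hs (.op o e f)).trans ?_
    have := Nat.mul_le_mul he.2.1 (Nat.pow_le_pow_right hD he.2.2)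
    exact_mod_cast this.trans hW

/-! ### Loop-free commands -/

def Cmd.static : Cmd → Bool
  | .skip => true
  | .setReg _ e => e.static
  | .setMem a e => a.static && e.static
  | .seq c d => c.static && d.static
  | .ite e c d => e.static && c.static && d.static
  | .loop e c => e.static && c.static

/-- The state after executing a loop-free command. -/
def Cmd.run : Cmd → State → State
  | .skip, s => s
  | .setReg i e, s => setR s i (e.eval s)
  | .setMem a e, s => setM s (a.eval s) (e.eval s)
  | .seq c d, s => d.run (c.run s)
  | .ite e c d, s => if 0 < e.eval s then c.run s else d.run s
  -- A default value, never used: `Cmd.Safe` is false on loops.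
  | .loop _ _, s => s

/-- Loop-free, and all written values are at most `D`. -/
def Cmd.Safe (D : ℕ) : Cmd → State → Prop
  | .skip, _ => True
  | .setReg _ e, s => |e.eval s| ≤ (D : ℤ)
  | .setMem _ e, s => |e.eval s| ≤ (D : ℤ)
  | .seq c d, s => c.Safe D s ∧ d.Safe D (c.run s)
  | .ite e c d, s => if 0 < e.eval s then c.Safe D s else d.Safe D s
  | .loop _ _, _ => False

/-- A loop is charged for one iteration only; the number of iterations enters through the factor `7
* N` in `Runs`. -/
def Cmd.bound : Cmd → ℕ
  | .skip => 1
  | .setReg _ e => e.cost + 1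
  | .setMem a e => a.cost + e.cost + 1
  | .seq c d => c.bound + d.bound
  | .ite e c d => e.cost + 1 + max c.bound d.bound
  | .loop e c => c.bound + e.cost + 1

@[simp] theorem run_wr (s : State) (f : Fin 32) (a e : Expr) :
    (wr f a e).run s = setArr s f (a.eval s) (e.eval s) := rfl

@[simp] theorem safe_wr (D : ℕ) (s : State) (f : Fin 32) (a e : Expr) :
    (wr f a e).Safe D s ↔ |e.eval s| ≤ (D : ℤ) := Iff.rfl

theorem Cmd.exec_run {D W : ℕ} (hD : 1 ≤ D) (hW : 1000 * D ^ 2 ≤ W) (c : Cmd) :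
    ∀ s, Bounded D s → c.static = true → c.Safe D s →
      Bounded D (c.run s) ∧ ∃ t, Exec W c s (c.run s) t ∧ t ≤ c.bound := by
  induction c with
  | skip => exact fun s hs _ _ => ⟨hs, 1, .skip s, le_rfl⟩
  | setReg i e =>
    exact fun s hs hst hsafe => ⟨hs.setR i hsafe, _,
      .setReg s i e (e.fits_of_static hD hW hs hst), le_rfl⟩
  | setMem a e =>
    intro s hs hst hsafe
    simp only [static, Bool.and_eq_true] at hst
    exact ⟨hs.setM _ hsafe, _, .setMem s a e (a.fits_of_static hD hW hs hst.1)
      (e.fits_of_static hD hW hs hst.2), le_rfl⟩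
  | seq c d ihc ihd =>
    intro s hs hst hsafe
    simp only [static, Bool.and_eq_true] at hst
    obtain ⟨hb, t, ht, htb⟩ := ihc s hs hst.1 hsafe.1
    obtain ⟨hb', t', ht', htb'⟩ := ihd _ hb hst.2 hsafe.2
    exact ⟨hb', _, .seq ht ht', add_le_add htb htb'⟩
  | ite e c d ihc ihd =>
    intro s hs hst hsafe
    simp only [static, Bool.and_eq_true] at hst
    have hf := e.fits_of_static hD hW hs hst.1.1
    simp only [Safe] at hsafe
    by_cases h : 0 < e.eval s
    · rw [if_pos h] at hsafe
      obtain ⟨hb, t, ht, htb⟩ := ihc s hs hst.1.2 hsafe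
      simp only [run, if_pos h, bound]
      exact ⟨hb, _, .ite_pos hf h ht, by omega⟩
    · rw [if_neg h] at hsafe
      obtain ⟨hb, t, ht, htb⟩ := ihd s hs hst.2 hsafe
      simp only [run, if_neg h, bound]
      exact ⟨hb, _, .ite_neg hf (not_lt.1 h) ht, by omega⟩
  | loop e c _ => exact fun s _ _ h => h.elim

/-! ### Frames -/

/-- May the address `e` belong to array `f`? -/
def Expr.mayHit : Expr → Fin 32 → Bool
  | .op .sub (.lit z) (.op .mul (.lit w) _), f =>
    -- An address `z - 32 * e` is congruent to `z` modulo 32, and array `f` is the residue class of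
    -- `-f - 1`.
    !(w == 32) || (z + ((f : ℕ) : ℤ) + 1) % 32 == 0
  | _, _ => true

/-- A syntactic overestimate of the arrays written. Being computable, it lets `rfl` and `decide`
prove that a command preserves a table. -/
def Cmd.touches (f : Fin 32) : Cmd → Bool
  | .skip => false
  | .setReg _ _ => false
  | .setMem a _ => a.mayHit f
  | .seq c d => c.touches f || d.touches f
  | .ite _ c d => c.touches f || d.touches f
  | .loop _ c => c.touches f

def Cmd.sets (i : ℕ) : Cmd → Bool
  | .skip => false
  | .setReg j _ => j == i
  | .setMem _ _ => false
  | .seq c d => c.sets i || d.sets i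
  | .ite _ c d => c.sets i || d.sets i
  | .loop _ c => c.sets i

/-- `s'` agrees with `s` on everything that `c` does not modify. -/
structure Frame (c : Cmd) (s s' : State) : Prop where
  arr : ∀ f, c.touches f = false → arr s' f = arr s f
  reg : ∀ i, c.sets i = false → s'.reg i = s.reg i

theorem Frame.refl (c : Cmd) (s : State) : Frame c s s := ⟨fun _ _ => rfl, fun _ _ => rfl⟩

theorem Frame.trans {c : Cmd} {s₁ s₂ s₃ : State} (h : Frame c s₁ s₂) (h' : Frame c s₂ s₃) :
    Frame c s₁ s₃ :=
  ⟨fun f hf => (h'.arr f hf).trans (h.arr f hf), fun i hi => (h'.reg i hi).trans (h.reg i hi)⟩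

theorem arr_setM_of_mayHit (s : State) (a : Expr) (v : ℤ) (f : Fin 32) (h : a.mayHit f = false) :
    arr (setM s (a.eval s) v) f = arr s f := by
  unfold Expr.mayHit at h
  split at h
  · rename_i z w e
    simp only [Bool.or_eq_false_iff, Bool.not_eq_false', beq_iff_eq, beq_eq_false_iff_ne] at h
    obtain ⟨rfl, h⟩ := h
    funext b
    rw [arr, mem_setM, if_neg, arr]
    simp only [Expr.eval, Op.apply]
    omega
  · simp at h

theorem Exec.frame {W : ℕ} {c : Cmd} {s s' : State} {t : ℕ} (h : Exec W c s s' t) :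
    Frame c s s' := by
  induction h with
  | skip s => exact Frame.refl _ s
  | setReg s i e _ =>
    refine ⟨fun _ _ => rfl, fun j hj => ?_⟩
    simp only [Cmd.sets, beq_eq_false_iff_ne] at hj
    simp [Function.update_of_ne hj.symm]
  | setMem s a e _ _ => exact ⟨fun f hf => arr_setM_of_mayHit s a _ f hf, fun _ _ => rfl⟩
  | seq _ _ ihc ihd =>
    refine ⟨fun f hf => ?_, fun i hi => ?_⟩
    · simp only [Cmd.touches, Bool.or_eq_false_iff] at hf
      exact (ihd.arr f hf.2).trans (ihc.arr f hf.1)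
    · simp only [Cmd.sets, Bool.or_eq_false_iff] at hi
      exact (ihd.reg i hi.2).trans (ihc.reg i hi.1)
  | ite_pos _ _ _ ih =>
    refine ⟨fun f hf => ?_, fun i hi => ?_⟩
    · simp only [Cmd.touches, Bool.or_eq_false_iff] at hf
      exact ih.arr f hf.1
    · simp only [Cmd.sets, Bool.or_eq_false_iff] at hi
      exact ih.reg i hi.1
  | ite_neg _ _ _ ih =>
    refine ⟨fun f hf => ?_, fun i hi => ?_⟩
    · simp only [Cmd.touches, Bool.or_eq_false_iff] at hf
      exact ih.arr f hf.2
    · simp only [Cmd.sets, Bool.or_eq_false_iff] at hi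
      exact ih.reg i hi.2
  | loop_pos _ _ _ _ ihc ihl =>
    exact ⟨fun f hf => (ihl.arr f hf).trans (ihc.arr f hf),
      fun i hi => (ihl.reg i hi).trans (ihc.reg i hi)⟩
  | loop_neg _ _ => exact Frame.refl _ _

/-! ### Timed total correctness -/

/-- The parameters of an execution: word size `W`, bound `D` on the values, number `N` of tiles. -/
structure Params (W D N : ℕ) : Prop where
  one_le : 1 ≤ D
  word : 1000 * D ^ 2 ≤ W
  pos : 1 ≤ N
  card_le : 10 * N + 10 ≤ D

/-- From `s`, the command `c` halts in time linear in `N`, keeps all values below `D` and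
establishes `Q`. -/
def Runs (W D N : ℕ) (c : Cmd) (s : State) (Q : State → Prop) : Prop :=
  -- The factor 7 leaves room for the most expensive loop, the search, whose potential starts at 5 N
  -- + 1. As `Cmd.bound` is additive and loops are not nested, the same factor serves whole
  -- programs.
  ∃ s' t, Exec W c s s' t ∧ t ≤ 7 * N * c.bound ∧ Bounded D s' ∧ Frame c s s' ∧ Q s'

namespace Runs

variable {W D N : ℕ} {c d : Cmd} {s : State} {Q R : State → Prop}

theorem mono (h : Runs W D N c s Q) (hQ : ∀ s', Bounded D s' → Frame c s s' → Q s' → R s') :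
    Runs W D N c s R := by
  obtain ⟨s', t, he, ht, hb, hf, hq⟩ := h
  exact ⟨s', t, he, ht, hb, hf, hQ s' hb hf hq⟩

theorem seq (h : Runs W D N c s Q)
    (h' : ∀ s', Bounded D s' → Frame c s s' → Q s' → Runs W D N d s' R) :
    Runs W D N (.seq c d) s R := by
  obtain ⟨s', t, he, ht, hb, hf, hq⟩ := h
  obtain ⟨s'', t', he', ht', hb', hf', hq'⟩ := h' s' hb hf hq
  refine ⟨s'', _, .seq he he', ?_, hb', (Exec.seq he he').frame, hq'⟩
  rw [Cmd.bound, mul_add]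
  exact add_le_add ht ht'

theorem of_run (p : Params W D N) (hs : Bounded D s) (hst : c.static = true) (hsafe : c.Safe D s)
    (hQ : Q (c.run s)) : Runs W D N c s Q := by
  obtain ⟨hb, t, he, ht⟩ := c.exec_run p.one_le p.word s hs hst hsafe
  refine ⟨_, t, he, ht.trans (Nat.le_mul_of_pos_left _ ?_), hb, he.frame, hQ⟩
  have := p.pos
  omega

theorem ite (p : Params W D N) {e : Expr} (hs : Bounded D s) (hst : e.static = true)
    (hc : 0 < e.eval s → Runs W D N c s Q) (hd : e.eval s ≤ 0 → Runs W D N d s Q) :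
    Runs W D N (.ite e c d) s Q := by
  have hf := e.fits_of_static p.one_le p.word hs hst
  have hN := p.pos
  have key : ∀ t b, t ≤ 7 * N * b → b ≤ max c.bound d.bound →
      e.cost + 1 + t ≤ 7 * N * (e.cost + 1 + max c.bound d.bound) := by
    intro t b ht hb
    rw [mul_add]
    exact add_le_add (Nat.le_mul_of_pos_left _ (by omega))
      (ht.trans (Nat.mul_le_mul_left _ hb))
  rcases lt_or_ge 0 (e.eval s) with h | h
  · obtain ⟨s', t, he, ht, hb, -, hq⟩ := hc h
    have := Exec.ite_pos (d := d) hf h he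
    exact ⟨s', _, this, key _ _ ht (le_max_left _ _), hb, this.frame, hq⟩
  · obtain ⟨s', t, he, ht, hb, -, hq⟩ := hd h
    have := Exec.ite_neg (c := c) hf h he
    exact ⟨s', _, this, key _ _ ht (le_max_right _ _), hb, this.frame, hq⟩

/-- Iteration with a decreasing measure `n` that the invariant keeps track of. -/
theorem loop_measure (p : Params W D N) {e : Expr} (hst : (Cmd.loop e c).static = true)
    (I : ℕ → State → Prop) (hs : Bounded D s) {n : ℕ} (hI : I n s) (hn : n < 7 * N)
    (hstep : ∀ n s', Bounded D s' → Frame c s s' → I n s' → 0 < e.eval s' →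
      c.Safe D s' ∧ ∃ m < n, I m (c.run s')) :
    Runs W D N (.loop e c) s fun s' => (∃ n, I n s') ∧ e.eval s' ≤ 0 := by
  simp only [Cmd.static, Bool.and_eq_true] at hst
  have key : ∀ (n : ℕ) (s₁ : State), Bounded D s₁ → Frame c s s₁ → (∃ m ≤ n, I m s₁) →
      ∃ s' t, Exec W (.loop e c) s₁ s' t ∧ t ≤ (n + 1) * (c.bound + e.cost + 1) ∧ Bounded D s' ∧
        (∃ n, I n s') ∧ e.eval s' ≤ 0 := by
    intro n
    induction n with
    | zero =>
      rintro s₁ hb hfr ⟨m, hm, hI⟩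
      have hf := e.fits_of_static p.one_le p.word hb hst.1
      rcases lt_or_ge 0 (e.eval s₁) with h | h
      · obtain ⟨-, m', hm', -⟩ := hstep m s₁ hb hfr hI h
        omega
      · exact ⟨s₁, _, .loop_neg hf h, by omega, hb, ⟨m, hI⟩, h⟩
    | succ n ih =>
      rintro s₁ hb hfr ⟨m, hm, hI⟩
      have hf := e.fits_of_static p.one_le p.word hb hst.1
      rcases lt_or_ge 0 (e.eval s₁) with h | h
      · obtain ⟨hsafe, m', hlt, hI'⟩ := hstep m s₁ hb hfr hI h
        obtain ⟨hb', t, he, ht⟩ := c.exec_run p.one_le p.word s₁ hb hst.2 hsafe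
        obtain ⟨s', t', he', ht', hb'', hI'', hneg⟩ :=
          ih _ hb' (hfr.trans he.frame) ⟨m', by omega, hI'⟩
        refine ⟨s', _, .loop_pos hf h he he', ?_, hb'', hI'', hneg⟩
        have : (n + 1 + 1) * (c.bound + e.cost + 1) =
          (n + 1) * (c.bound + e.cost + 1) + (c.bound + e.cost + 1) := by ring
        omega
      · exact ⟨s₁, _, .loop_neg hf h, by nlinarith, hb, ⟨m, hI⟩, h⟩
  have hN := p.pos
  -- There are at most 7 N - 1 iterations; the last, failing test of the guard is the remaining
  -- charge.
  obtain ⟨s', t, he, ht, hb, hI', hneg⟩ :=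
    key (7 * N - 1) s hs (Frame.refl c s) ⟨n, by omega, hI⟩
  rw [show 7 * N - 1 + 1 = 7 * N by omega] at ht
  exact ⟨s', t, he, ht, hb, he.frame, hI', hneg⟩

theorem loop (p : Params W D N) {e : Expr} (hst : (Cmd.loop e c).static = true)
    (I : State → Prop) (Φ : State → ℤ) (hs : Bounded D s) (hI : I s) (hn : Φ s ≤ 7 * N - 1)
    (hstep : ∀ s', Bounded D s' → Frame c s s' → I s' → 0 < e.eval s' →
      c.Safe D s' ∧ I (c.run s') ∧ 0 < Φ s' ∧ Φ (c.run s') < Φ s') :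
    Runs W D N (.loop e c) s fun s' => I s' ∧ e.eval s' ≤ 0 := by
  have hN := p.pos
  refine mono (loop_measure p hst (fun n s' => I s' ∧ n = (Φ s').toNat) hs ⟨hI, rfl⟩ (by omega) ?_)
    fun s' _ _ ⟨⟨_, h1, _⟩, h2⟩ => ⟨h1, h2⟩
  rintro n s' hb hf ⟨hI', rfl⟩ hg
  obtain ⟨h1, h2, h3, h4⟩ := hstep s' hb hf hI' hg
  exact ⟨h1, _, by omega, h2, rfl⟩

end Runs

theorem Cmd.run_ite_pos {e : Expr} {c d : Cmd} {s : State} (h : 0 < e.eval s) :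
    (Cmd.ite e c d).run s = c.run s := if_pos h

theorem Cmd.run_ite_neg {e : Expr} {c d : Cmd} {s : State} (h : ¬ 0 < e.eval s) :
    (Cmd.ite e c d).run s = d.run s := if_neg h

theorem Cmd.safe_ite_pos {D : ℕ} {e : Expr} {c d : Cmd} {s : State} (h : 0 < e.eval s) :
    (Cmd.ite e c d).Safe D s = c.Safe D s := if_pos h

theorem Cmd.safe_ite_neg {D : ℕ} {e : Expr} {c d : Cmd} {s : State} (h : ¬ 0 < e.eval s) :
    (Cmd.ite e c d).Safe D s = d.Safe D s := if_neg h

/-! ### Evaluation of expressions -/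

@[simp] theorem eval_lit (s : State) (z : ℤ) : (Expr.lit z).eval s = z := rfl
@[simp] theorem eval_reg (s : State) (i : ℕ) : (Expr.reg i).eval s = s.reg i := rfl
@[simp] theorem eval_mem (s : State) (e : Expr) : (Expr.mem e).eval s = s.mem (e.eval s) := rfl
@[simp] theorem eval_add (s : State) (e f : Expr) :
    (Expr.op .add e f).eval s = e.eval s + f.eval s := rfl
@[simp] theorem eval_sub (s : State) (e f : Expr) :
    (Expr.op .sub e f).eval s = e.eval s - f.eval s := rfl
@[simp] theorem eval_mul (s : State) (e f : Expr) :
    (Expr.op .mul e f).eval s = e.eval s * f.eval s := rfl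

instance : Add Expr := ⟨.op .add⟩
instance : Sub Expr := ⟨.op .sub⟩
instance : Mul Expr := ⟨.op .mul⟩

@[simp] theorem eval_hadd (s : State) (e f : Expr) : (e + f).eval s = e.eval s + f.eval s := rfl
@[simp] theorem eval_hsub (s : State) (e f : Expr) : (e - f).eval s = e.eval s - f.eval s := rfl
@[simp] theorem eval_hmul (s : State) (e f : Expr) : (e * f).eval s = e.eval s * f.eval s := rfl

/-- Execute the commands of a list one after the other. -/
def block : List Cmd → Cmd
  | [] => .skip
  | c :: l => .seq c (block l)

attribute [simp] Cmd.run Cmd.Safe block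

end RAM

namespace RAM

/-! ### The program

Registers: `0` number of tiles, `1` loop counter, `2`, `3` least coordinates, `4`, `5` current
coordinates, `6` number of codes per column, `7` code of the last tile read, `8` result tile, `9`
its neighbor across the cut, `10`, ... scratch.

Arrays: `0` membership, `1`, `2` normalized coordinates, `3`, `4` bucket links and heads for the
second coordinate, `5`, `6` for the first one, `7`, `8` last tile seen in a column / row,
`9`, ..., `12` next tile in the four directions, `13`, ..., `16` the two search stacks,
`17` search order, `18`, `19`, `20` subtree aggregates, `21`, `22` search numbers, `23` parents,
`24` flags of the tiles entered across a run boundary. -/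

section Program

open _root_.RAM.Cmd _root_.RAM.Expr

/-- Find the least coordinates. -/
def scanBody : Cmd := block
  [setReg 4 (mem (lit 2 * reg 1)), setReg 5 (mem (lit 2 * reg 1 + lit 1)),
   ite (reg 2 - reg 4) (setReg 2 (reg 4)) skip,
   ite (reg 3 - reg 5) (setReg 3 (reg 5)) skip,
   setReg 1 (reg 1 + lit 1)]

def scan : Cmd := seq
  (block [setReg 2 (mem (lit 0)), setReg 3 (mem (lit 1)), setReg 1 (lit 0)])
  (loop (reg 0 - reg 1) scanBody)

/-- Enter the tiles into the tables. -/
def fillBody : Cmd := block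
  [setReg 4 (mem (lit 2 * reg 1) - reg 2 + lit 1),
   setReg 5 (mem (lit 2 * reg 1 + lit 1) - reg 3 + lit 1),
   setReg 7 (reg 4 * reg 6 + reg 5),
   wr 0 (reg 7) (lit 1), wr 1 (reg 7) (reg 4), wr 2 (reg 7) (reg 5),
   wr 3 (reg 7) (rd 4 (reg 5)), wr 4 (reg 5) (reg 7),
   wr 5 (reg 7) (rd 6 (reg 4)), wr 6 (reg 4) (reg 7),
   wr 9 (reg 7) (reg 7), wr 10 (reg 7) (reg 7), wr 11 (reg 7) (reg 7), wr 12 (reg 7) (reg 7),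
   setReg 1 (reg 1 + lit 1)]

def fill : Cmd := seq
  (block [setReg 6 (reg 0 + lit 2), setReg 1 (lit 0)])
  (loop (reg 0 - reg 1) fillBody)

/-- Go through the tiles bucket by bucket, linking consecutive tiles of equal cross coordinate. -/
def linkBody (cross nxt head last dn up : Fin 32) : Cmd :=
  ite (reg 10)
    (block [setReg 11 (rd cross (reg 10)), setReg 12 (rd last (reg 11)),
      ite (reg 12) (block [wr dn (reg 10) (reg 12), wr up (reg 12) (reg 10)]) skip,
      wr last (reg 11) (reg 10), setReg 10 (rd nxt (reg 10))])
    (block [setReg 1 (reg 1 + lit 1), setReg 10 (rd head (reg 1))])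

def link (cross nxt head last dn up : Fin 32) : Cmd := seq
  (block [setReg 1 (lit 0), setReg 10 (lit 0)])
  -- Codes are positive and 0 ends a list, so the guard is positive as long as a bucket or a rest of
  -- the current list is left.
  (loop (reg 0 - reg 1 + reg 10) (linkBody cross nxt head last dn up))

/-- One step of the search: `h` and `v` are the code differences inside and across runs. -/
def popBody : Cmd :=
  ite (reg 10)
    (block [setReg 10 (reg 10 - lit 1), setReg 12 (rd 13 (reg 10)), setReg 13 (rd 14 (reg 10)),
      setReg 14 (lit 0)])
    (block [setReg 11 (reg 11 - lit 1), setReg 12 (rd 15 (reg 11)), setReg 13 (rd 16 (reg 11)),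
      setReg 14 (lit 1)])

def visitBody (vis : Fin 32) (h v : Expr) : Cmd := block
  -- The counter is raised before it is stored: search numbers start with 1, and the initial 0 of
  -- the memory means unvisited.
  [wr 17 (reg 1) (reg 12), setReg 1 (reg 1 + lit 1), wr vis (reg 12) (reg 1),
   wr 23 (reg 12) (reg 13), wr 24 (reg 12) (reg 14),
   wr 13 (reg 10) (reg 12 + h), wr 14 (reg 10) (reg 12), setReg 10 (reg 10 + lit 1),
   wr 13 (reg 10) (reg 12 - h), wr 14 (reg 10) (reg 12), setReg 10 (reg 10 + lit 1),
   wr 15 (reg 11) (reg 12 + v), wr 16 (reg 11) (reg 12), setReg 11 (reg 11 + lit 1),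
   wr 15 (reg 11) (reg 12 - v), wr 16 (reg 11) (reg 12), setReg 11 (reg 11 + lit 1)]

def searchBody (vis : Fin 32) (h v : Expr) : Cmd :=
  -- The difference is positive only for a tile (entry 1) without a search number (entry 0).
  seq popBody (ite (rd 0 (reg 12) - rd vis (reg 12)) (visitBody vis h v) skip)

def search (vis : Fin 32) (h v : Expr) : Cmd := seq
  (block [setReg 1 (lit 0), setReg 10 (lit 1), setReg 11 (lit 0),
   wr 13 (lit 0) (reg 7), wr 14 (lit 0) (lit 0)])
  (loop (reg 10 + reg 11) (searchBody vis h v))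

/-- Arrays `18`, `19`, `20` will hold subtree maxima of the search number of the next tile, of its
negative, and of the tile's own search number. The negation turns a minimum into a maximum, so
`raise` suffices. -/
def initBody (vis nx : Fin 32) : Cmd := block
  [setReg 10 (rd 17 (reg 1)), setReg 11 (rd vis (rd nx (reg 10))),
   wr 18 (reg 10) (reg 11), wr 19 (reg 10) (lit 0 - reg 11), wr 20 (reg 10) (rd vis (reg 10)),
   setReg 1 (reg 1 + lit 1)]

/-- `f[p] := max f[p] f[a]` -/
def raise (f : Fin 32) : Cmd :=
  ite (rd f (reg 10) - rd f (reg 11)) (wr f (reg 11) (rd f (reg 10))) skip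

/-- Record the tile in register `10` if it starts a valid cut. -/
def record (vis : Fin 32) : Cmd :=
  ite (rd 24 (reg 10))
    (ite (rd 18 (reg 10) - rd 20 (reg 10)) skip
      (ite (rd 19 (reg 10) + rd vis (reg 10)) skip
        (block [setReg 8 (reg 10), setReg 9 (reg 11)])))
    skip

def checkBody (vis : Fin 32) : Cmd := block
  [setReg 1 (reg 1 - lit 1), setReg 10 (rd 17 (reg 1)), setReg 11 (rd 23 (reg 10)),
   record vis, raise 18, raise 19, raise 20]

/-- Look for a cut whose pieces can be pulled apart in the direction of `nx`. -/
def check (vis nx : Fin 32) : Cmd := seq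
  (setReg 1 (lit 0)) (seq (loop (reg 0 - reg 1) (initBody vis nx)) (loop (reg 1) (checkBody vis)))

def stage (vis : Fin 32) (h v : Expr) : Cmd :=
  seq (search vis h v) (seq (check vis 9) (seq (check vis 10) (seq (check vis 11) (check vis 12))))

/-- Write the current corner as the next point of the output. -/
def putCorner (da dc : ℤ) : Cmd :=
  seq (setMem (lit 2 * reg 1 + lit da) (reg 10)) (setMem (lit 2 * reg 1 + lit dc) (reg 11))

def backBody (h : Expr) : Cmd :=
  seq (setReg 8 (reg 8 - h)) (setReg 9 (reg 9 - h))

def emitBody (da dc : ℤ) (h : Expr) : Cmd := block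
  [setReg 8 (reg 8 + h), setReg 9 (reg 9 + h), setReg 10 (reg 10 + lit 1),
   setReg 1 (reg 1 + lit 1), putCorner da dc]

/-- The corner `(i, j)` is the lower left one of the tile `(i, j)`, so the cut between two tiles
runs at the larger of their cross coordinates. The subtracted 1 undoes the shift of the normalized
coordinates. -/
def startBody (fa fc : Fin 32) (ra rc : ℕ) (da dc : ℤ) : Cmd := block
  [setReg 10 (rd fa (reg 8) + reg ra - lit 1),
   setReg 11 (rd fc (reg 8) + reg rc - lit 1),
   ite (rd fc (reg 9) - rd fc (reg 8)) (setReg 11 (rd fc (reg 9) + reg rc - lit 1)) skip,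
   setReg 1 (lit 0), putCorner da dc]

/-- Write the maximal cut that runs between the tiles in registers `8` and `9`; `fa` and `fc` hold
the coordinates along and across the cut. -/
def emit (fa fc : Fin 32) (ra rc : ℕ) (da dc : ℤ) (h : Expr) : Cmd :=
  -- Membership entries are 0 or 1: the guard is positive exactly if both tiles belong to the
  -- polyomino.
  seq (loop (rd 0 (reg 8 - h) + rd 0 (reg 9 - h) - lit 1) (backBody h))
  (seq (startBody fa fc ra rc da dc)
  (seq (loop (rd 0 (reg 8) + rd 0 (reg 9) - lit 1) (emitBody da dc h))
  (seq (setReg 0 (reg 1 + lit 1)) (setReg 1 (lit 0)))))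

def prepare : Cmd :=
  seq scan (seq fill (seq (link 1 3 4 7 9 10) (seq (link 2 5 6 8 11 12) (setReg 8 (lit 0)))))

/-- The second stage exchanges the strides. It has its own array of search numbers, since that array
must be zero at the start of a search. -/
def cutFinder : Cmd :=
  seq prepare (seq (stage 21 (reg 6) (lit 1))
    (ite (reg 8) (emit 1 2 2 3 0 1 (reg 6))
      (seq (stage 22 (lit 1) (reg 6))
        (ite (reg 8) (emit 2 1 3 2 1 0 (lit 1)) (setReg 0 (lit 0))))))

end Program

end RAM

/-! ### The two-stack search -/

/-- The codes `a` and `b` differ by the stride `h`. -/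
def StrideAdj (h a b : ℤ) : Prop := b = a + h ∨ b = a - h

theorem StrideAdj.symm {h a b : ℤ} (H : StrideAdj h a b) : StrideAdj h b a := by
  unfold StrideAdj at *; omega

/-- The state of the search on the set `Q` of codes, with root `ρ` and strides `h` inside runs and
`v` across runs. -/
structure SearchInv (Q : Finset ℤ) (h v ρ : ℤ) (hs hp vs vp ord vis par vt : ℤ → ℤ)
    (nh nv cnt : ℤ) : Prop where
  nh_nonneg : 0 ≤ nh
  nv_nonneg : 0 ≤ nv
  cnt_nonneg : 0 ≤ cnt
  nh_le : nh ≤ 2 * cnt + 1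
  nv_le : nv ≤ 2 * cnt
  hent : ∀ i, 0 ≤ i → i < nh → (hs i = ρ ∧ hp i = 0 ∧ cnt = 0) ∨
    (hp i ∈ Q ∧ 0 < vis (hp i) ∧ StrideAdj h (hp i) (hs i))
  vent : ∀ i, 0 ≤ i → i < nv → vp i ∈ Q ∧ 0 < vis (vp i) ∧ StrideAdj v (vp i) (vs i)
  -- The second stack is ordered by the age of the parents, so its top comes from the most recently
  -- visited one.
  vmono : ∀ i j, 0 ≤ i → i ≤ j → j < nv → vis (vp i) ≤ vis (vp j)
  hcov : ∀ a ∈ Q, ∀ b ∈ Q, 0 < vis a → vis b = 0 → StrideAdj h a b → ∃ i, 0 ≤ i ∧ i < nh ∧ hs i = b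
  vcov : ∀ a ∈ Q, ∀ b ∈ Q, 0 < vis a → vis b = 0 → StrideAdj v a b →
    ∃ i, 0 ≤ i ∧ i < nv ∧ vs i = b ∧ vp i = a
  rootcov : 0 < vis ρ ∨ ∃ i, 0 ≤ i ∧ i < nh ∧ hs i = ρ
  vis_range : ∀ a ∈ Q, 0 ≤ vis a ∧ vis a ≤ cnt
  vis_out : ∀ a, 0 ≤ a → a ∉ Q → vis a = 0
  ord_vis : ∀ i, 0 ≤ i → i < cnt → ord i ∈ Q ∧ vis (ord i) = i + 1
  vis_ord : ∀ a ∈ Q, 0 < vis a → ord (vis a - 1) = a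
  parent : ∀ a ∈ Q, 0 < vis a → (a = ρ ∧ par a = 0 ∧ vt a = 0 ∧ vis a = 1) ∨
    (par a ∈ Q ∧ 0 < vis (par a) ∧ vis (par a) < vis a ∧
      ((vt a = 0 ∧ StrideAdj h (par a) a) ∨ (vt a = 1 ∧ StrideAdj v (par a) a)))
  -- The second stack is used only when the first is empty, and then every run that has been touched
  -- is completely visited.
  runs : ∀ c ∈ Q, 0 < vis c → vt c = 1 → ∀ a ∈ Q, ∀ b ∈ Q, StrideAdj h a b → 0 < vis a →
    vis a < vis c → 0 < vis b ∧ vis b < vis c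
  -- The last-in-first-out order: a tile entered across runs has as parent the latest visited tile
  -- with a pending neighbor across.
  latest : ∀ c ∈ Q, 0 < vis c → vt c = 1 → ∀ a ∈ Q, ∀ b ∈ Q, StrideAdj v a b → 0 < vis a →
    vis a < vis c → (vis b = 0 ∨ vis c ≤ vis b) → vis a ≤ vis (par c)

namespace SearchInv

variable {Q : Finset ℤ} {h v ρ : ℤ} {hs hp vs vp ord vis par vt : ℤ → ℤ} {nh nv cnt : ℤ}

/-- `vis` inverts `ord` on the indices used so far, so `ord` is injective there. -/
theorem cnt_le (I : SearchInv Q h v ρ hs hp vs vp ord vis par vt nh nv cnt) : cnt ≤ Q.card := by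
  have := Finset.card_le_card_of_injOn (s := Finset.Ico 0 cnt) (t := Q) ord
    (fun i hi => by
      simp only [Finset.coe_Ico, Set.mem_Ico] at hi
      exact (I.ord_vis i hi.1 hi.2).1)
    (fun i hi j hj hij => by
      simp only [Finset.coe_Ico, Set.mem_Ico] at hi hj
      have h1 := (I.ord_vis i hi.1 hi.2).2
      have h2 := (I.ord_vis j hj.1 hj.2).2
      rw [hij] at h1
      omega)
  rw [Int.card_Ico] at this
  omega

theorem cnt_lt (I : SearchInv Q h v ρ hs hp vs vp ord vis par vt nh nv cnt) {a : ℤ} (ha : a ∈ Q)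
    (hva : vis a = 0) : cnt < Q.card := by
  have := Finset.card_le_card_of_injOn (s := Finset.Ico 0 cnt) (t := Q.erase a) ord
    (fun i hi => by
      simp only [Finset.coe_Ico, Set.mem_Ico] at hi
      have := I.ord_vis i hi.1 hi.2
      simp only [Finset.coe_erase, Set.mem_sdiff, Finset.mem_coe, Set.mem_singleton_iff]
      refine ⟨this.1, fun h => ?_⟩
      rw [h] at this
      omega)
    (fun i hi j hj hij => by
      simp only [Finset.coe_Ico, Set.mem_Ico] at hi hj
      have h1 := (I.ord_vis i hi.1 hi.2).2
      have h2 := (I.ord_vis j hj.1 hj.2).2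
      rw [hij] at h1
      omega)
  rw [Int.card_Ico, Finset.card_erase_of_mem ha] at this
  have := Finset.card_pos.2 ⟨a, ha⟩
  omega

theorem start {hs hp vs vp ord vis par vt : ℤ → ℤ} (hvis : ∀ a, 0 ≤ a → vis a = 0)
    (hQ : ∀ a ∈ Q, 0 ≤ a) (h0 : hs 0 = ρ) (h1 : hp 0 = 0) :
    SearchInv Q h v ρ hs hp vs vp ord vis par vt 1 0 0 := by
  have hv : ∀ a ∈ Q, vis a = 0 := fun a ha => hvis a (hQ a ha)
  constructor <;> try omega
  case hent => intro i h0' h1'; obtain rfl : i = 0 := by omega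
               exact Or.inl ⟨h0, h1, rfl⟩
  case hcov => intro a ha b hb h; rw [hv a ha] at h; omega
  case vcov => intro a ha b hb h; rw [hv a ha] at h; omega
  case rootcov => exact Or.inr ⟨0, le_rfl, by omega, h0⟩
  case vis_range => intro a ha; rw [hv a ha]; omega
  case vis_out => exact fun a h _ => hvis a h
  case vis_ord => intro a ha h; rw [hv a ha] at h; omega
  case parent => intro a ha h; rw [hv a ha] at h; omega
  case runs => intro a ha h; rw [hv a ha] at h; omega
  case latest => intro a ha h; rw [hv a ha] at h; omega

/-- Popping an entry that needs no visit from the first stack. -/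
theorem pop_left (I : SearchInv Q h v ρ hs hp vs vp ord vis par vt nh nv cnt) (hn : 0 < nh)
    (hx : hs (nh - 1) ∉ Q ∨ 0 < vis (hs (nh - 1))) (hρ : ρ ∈ Q) :
    SearchInv Q h v ρ hs hp vs vp ord vis par vt (nh - 1) nv cnt := by
  refine { I with nh_nonneg := by omega, nh_le := by have := I.nh_le; omega,
                  hent := fun i h0 h1 => I.hent i h0 (by omega), hcov := ?_, rootcov := ?_ }
  · intro a ha b hb hva hvb hab
    obtain ⟨i, h0, h1, h2⟩ := I.hcov a ha b hb hva hvb hab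
    refine ⟨i, h0, ?_, h2⟩
    by_contra hc
    obtain rfl : i = nh - 1 := by omega
    rw [h2] at hx
    rcases hx with hx | hx
    · exact hx hb
    · omega
  · rcases I.rootcov with hr | ⟨i, h0, h1, h2⟩
    · exact Or.inl hr
    · by_cases hc : i < nh - 1
      · exact Or.inr ⟨i, h0, hc, h2⟩
      · obtain rfl : i = nh - 1 := by omega
        rw [h2] at hx
        exact Or.inl (hx.resolve_left (fun h => h hρ))

/-- Popping an entry that needs no visit from the second stack. -/
theorem pop_right (I : SearchInv Q h v ρ hs hp vs vp ord vis par vt nh nv cnt) (hn : 0 < nv)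
    (hx : vs (nv - 1) ∉ Q ∨ 0 < vis (vs (nv - 1))) :
    SearchInv Q h v ρ hs hp vs vp ord vis par vt nh (nv - 1) cnt := by
  refine { I with nv_nonneg := by omega, nv_le := by have := I.nv_le; omega,
                  vent := fun i h0 h1 => I.vent i h0 (by omega),
                  vmono := fun i j h0 h1 h2 => I.vmono i j h0 h1 (by omega), vcov := ?_ }
  intro a ha b hb hva hvb hab
  obtain ⟨i, h0, h1, h2⟩ := I.vcov a ha b hb hva hvb hab
  refine ⟨i, h0, ?_, h2⟩
  by_contra hc
  obtain rfl : i = nv - 1 := by omega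
  rw [h2.1] at hx
  rcases hx with hx | hx
  · exact hx hb
  · omega

/-- Visiting the new code `a`, after it has been popped. -/
theorem visit (I : SearchInv Q h v ρ hs hp vs vp ord vis par vt nh nv cnt) {a p t mh mv : ℤ}
    (ha : a ∈ Q) (hva : vis a = 0)
    -- Either `a` was the top of the first stack, or the first stack is empty and `a` was the top of
    -- the second.
    (hp0 : (t = 0 ∧ ((a = ρ ∧ p = 0 ∧ cnt = 0) ∨ (p ∈ Q ∧ 0 < vis p ∧ StrideAdj h p a)) ∧
        mh = nh - 1 ∧ mv = nv ∧ 0 < nh ∧ hs (nh - 1) = a) ∨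
      (t = 1 ∧ nh = 0 ∧ mh = nh ∧ mv = nv - 1 ∧ 0 < nv ∧ vs (nv - 1) = a ∧ vp (nv - 1) = p)) :
    SearchInv Q h v ρ
      (Function.update (Function.update hs mh (a + h)) (mh + 1) (a - h))
      (Function.update (Function.update hp mh a) (mh + 1) a)
      (Function.update (Function.update vs mv (a + v)) (mv + 1) (a - v))
      (Function.update (Function.update vp mv a) (mv + 1) a)
      (Function.update ord cnt a) (Function.update vis a (cnt + 1)) (Function.update par a p)
      (Function.update vt a t) (mh + 2) (mv + 2) (cnt + 1) := by
  have hnh := I.nh_nonneg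
  have hnv := I.nv_nonneg
  have hcn := I.cnt_nonneg
  have hnl := I.nh_le
  have hvl := I.nv_le
  have vne : ∀ b, 0 < vis b → Function.update vis a (cnt + 1) b = vis b := by
    intro b hb
    rw [Function.update_of_ne]
    rintro rfl; omega
  have vpos : ∀ b ∈ Q, 0 < Function.update vis a (cnt + 1) b → b = a ∨ (b ≠ a ∧ 0 < vis b) := by
    intro b hb
    by_cases hba : b = a
    · exact fun _ => Or.inl hba
    · rw [Function.update_of_ne hba]; exact fun h => Or.inr ⟨hba, h⟩
  have vzero : ∀ b, Function.update vis a (cnt + 1) b = 0 → b ≠ a ∧ vis b = 0 := by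
    intro b
    by_cases hba : b = a
    · subst hba; rw [Function.update_self]; omega
    · rw [Function.update_of_ne hba]; exact fun h => ⟨hba, h⟩
  have vself : Function.update vis a (cnt + 1) a = cnt + 1 := Function.update_self ..
  have vlt : ∀ b ∈ Q, vis b < cnt + 1 := fun b hb => by have := (I.vis_range b hb).2; omega
  have hρpos : a ≠ ρ → 0 < cnt := by
    intro hne
    rcases hp0 with ⟨-, h | ⟨h1, h2, -⟩, -⟩ | ⟨-, -, -, -, h1, -, -⟩
    · exact absurd h.1 hne
    · have := vlt p h1; omega
    · have h3 := (I.vent _ (by omega) (by omega : nv - 1 < nv))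
      have := vlt _ h3.1; omega
  have hpQ : (t = 0 ∧ ((a = ρ ∧ p = 0 ∧ cnt = 0) ∨ (p ∈ Q ∧ 0 < vis p ∧ StrideAdj h p a))) ∨
      (t = 1 ∧ p ∈ Q ∧ 0 < vis p ∧ StrideAdj v p a) := by
    rcases hp0 with ⟨h1, h2, -⟩ | ⟨h1, -, -, -, h4, h5, h6⟩
    · exact Or.inl ⟨h1, h2⟩
    · refine Or.inr ⟨h1, ?_⟩
      have := I.vent _ (by omega) (by omega : nv - 1 < nv)
      rwa [h5, h6] at this
  have hmh : mh ≤ nh ∧ 0 ≤ mh ∧ mh ≤ 2 * cnt := by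
    rcases hp0 with h | h
    · omega
    · omega
  have hmv : mv ≤ nv ∧ 0 ≤ mv := by omega
  have hrng : ∀ b, 0 < vis b → b ∈ Q → b ≠ a := by rintro b hb - rfl; omega
  -- old unvisited codes different from `a` stay on the stacks
  have hkeep : ∀ i, 0 ≤ i → i < nh → hs i ≠ a → i < mh := by
    intro i h0 h1 h2
    rcases hp0 with ⟨-, -, h3, -, -, h4⟩ | ⟨-, h3, h4, -⟩
    · by_contra hc
      exact h2 (by rw [← h4]; congr 1; omega)
    · omega
  have vkeep : ∀ i, 0 ≤ i → i < nv → vs i ≠ a → i < mv := by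
    intro i h0 h1 h2
    rcases hp0 with ⟨-, -, -, h3, -⟩ | ⟨-, -, -, h3, h4, h5, -⟩
    · omega
    · by_contra hc
      exact h2 (by rw [← h5]; congr 1; omega)
  have upd : ∀ (f : ℤ → ℤ) (m x y i : ℤ), i < m →
      Function.update (Function.update f m x) (m + 1) y i = f i := by
    intro f m x y i hi
    rw [Function.update_of_ne (by omega), Function.update_of_ne (by omega)]
  have upd0 : ∀ (f : ℤ → ℤ) (m x y : ℤ),
      Function.update (Function.update f m x) (m + 1) y m = x := by
    intro f m x y
    rw [Function.update_of_ne (by omega), Function.update_self]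
  have upd1 : ∀ (f : ℤ → ℤ) (m x y : ℤ),
      Function.update (Function.update f m x) (m + 1) y (m + 1) = y := by
    intro f m x y
    rw [Function.update_self]
  have split3 : ∀ i m : ℤ, i < m + 2 → i < m ∨ i = m ∨ i = m + 1 := by intros; omega
  constructor
  case nh_nonneg => omega
  case nv_nonneg => omega
  case cnt_nonneg => omega
  case nh_le => omega
  case nv_le => omega
  case hent =>
    intro i h0 h1
    right
    rcases split3 i mh h1 with hi | rfl | rfl
    · rw [upd _ _ _ _ _ hi, upd _ _ _ _ _ hi]
      rcases I.hent i h0 (by omega) with ⟨-, -, hc⟩ | ⟨h3, h4, h5⟩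
      · omega
      · rw [vne _ h4]; exact ⟨h3, h4, h5⟩
    · rw [upd0, upd0, vself]; exact ⟨ha, by omega, Or.inl rfl⟩
    · rw [upd1, upd1, vself]; exact ⟨ha, by omega, Or.inr rfl⟩
  case vent =>
    intro i h0 h1
    rcases split3 i mv h1 with hi | rfl | rfl
    · rw [upd _ _ _ _ _ hi, upd _ _ _ _ _ hi]
      obtain ⟨h3, h4, h5⟩ := I.vent i h0 (by omega)
      rw [vne _ h4]; exact ⟨h3, h4, h5⟩
    · rw [upd0, upd0, vself]; exact ⟨ha, by omega, Or.inl rfl⟩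
    · rw [upd1, upd1, vself]; exact ⟨ha, by omega, Or.inr rfl⟩
  case vmono =>
    intro i j h0 hij h1
    have hj : mv ≤ j → Function.update vis a (cnt + 1)
        (Function.update (Function.update vp mv a) (mv + 1) a j) = cnt + 1 := by
      intro hmj
      rcases split3 j mv h1 with hi | rfl | rfl
      · omega
      · rw [upd0, vself]
      · rw [upd1, vself]
    rcases split3 i mv (by omega) with hi | hi
    · rw [upd _ _ _ _ _ hi]
      obtain ⟨h3, h4, h5⟩ := I.vent i h0 (by omega)
      rw [vne _ h4]
      rcases lt_or_ge j mv with hjm | hjm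
      · rw [upd _ _ _ _ _ hjm]
        obtain ⟨h3', h4', h5'⟩ := I.vent j (by omega) (by omega)
        rw [vne _ h4']
        exact I.vmono i j h0 hij (by omega)
      · rw [hj hjm]; have := vlt _ h3; omega
    · rw [hj (by omega)]
      rcases hi with rfl | rfl
      · rw [upd0, vself]
      · rw [upd1, vself]
  case hcov =>
    intro x hx y hy hvx hvy hxy
    obtain ⟨hya, hvy⟩ := vzero y hvy
    rcases vpos x hx hvx with rfl | ⟨-, hvx⟩
    · rcases hxy with rfl | rfl
      · exact ⟨mh, by omega, by omega, upd0 ..⟩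
      · exact ⟨mh + 1, by omega, by omega, upd1 ..⟩
    · obtain ⟨i, h0, h1, rfl⟩ := I.hcov x hx y hy hvx hvy hxy
      have := hkeep i h0 h1 hya
      exact ⟨i, h0, by omega, upd _ _ _ _ _ this⟩
  case vcov =>
    intro x hx y hy hvx hvy hxy
    obtain ⟨hya, hvy⟩ := vzero y hvy
    rcases vpos x hx hvx with rfl | ⟨-, hvx⟩
    · rcases hxy with rfl | rfl
      · exact ⟨mv, by omega, by omega, upd0 .., upd0 ..⟩
      · exact ⟨mv + 1, by omega, by omega, upd1 .., upd1 ..⟩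
    · obtain ⟨i, h0, h1, rfl, h2⟩ := I.vcov x hx y hy hvx hvy hxy
      have := vkeep i h0 h1 hya
      exact ⟨i, h0, by omega, upd _ _ _ _ _ this, (upd _ _ _ _ _ this).trans h2⟩
  case rootcov =>
    by_cases har : a = ρ
    · left; subst har; rw [vself]; omega
    · have h1 := hρpos har
      left
      have h2 := I.ord_vis 0 le_rfl h1
      have : vis ρ ≠ 0 := by
        rcases I.parent _ h2.1 (by omega) with ⟨h3, -⟩ | ⟨h3, h4, h5, -⟩
        · rw [← h3]; omega
        · omega
      rcases I.rootcov with h3 | ⟨i, h3, h4, h5⟩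
      · rw [vne _ h3]; exact h3
      · by_contra hc
        rw [Function.update_of_ne (Ne.symm har)] at hc
        have h6 : 0 ≤ vis ρ := by
          rcases I.parent _ h2.1 (by omega) with ⟨h3, -⟩ | ⟨h3, h4, h5, -⟩
          · rw [← h3]; omega
          · omega
        omega
  case vis_range =>
    intro b hb
    by_cases hba : b = a
    · subst hba; rw [vself]; omega
    · rw [Function.update_of_ne hba]; have := I.vis_range b hb; omega
  case vis_out =>
    intro b h0 hb
    rw [Function.update_of_ne (by rintro rfl; exact hb ha)]
    exact I.vis_out b h0 hb
  case ord_vis =>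
    intro i h0 h1
    by_cases hi : i = cnt
    · subst hi; rw [Function.update_self, vself]; exact ⟨ha, rfl⟩
    · rw [Function.update_of_ne hi]
      obtain ⟨h2, h3⟩ := I.ord_vis i h0 (by omega)
      rw [vne _ (by omega)]
      exact ⟨h2, h3⟩
  case vis_ord =>
    intro b hb hvb
    rcases vpos b hb hvb with rfl | ⟨hba, hvb⟩
    · rw [vself, add_sub_cancel_right, Function.update_self]
    · rw [vne _ hvb, Function.update_of_ne (by have := vlt b hb; omega)]
      exact I.vis_ord b hb hvb
  case parent =>
    intro b hb hvb
    rcases vpos b hb hvb with rfl | ⟨hba, hvb⟩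
    · rw [Function.update_self, Function.update_self, vself]
      rcases hpQ with ⟨rfl, ⟨h1, h2, h3⟩ | ⟨h1, h2, h3⟩⟩ | ⟨rfl, h1, h2, h3⟩
      · exact Or.inl ⟨h1, h2, rfl, by omega⟩
      · right; rw [vne _ h2]; exact ⟨h1, h2, vlt _ h1, Or.inl ⟨rfl, h3⟩⟩
      · right; rw [vne _ h2]; exact ⟨h1, h2, vlt _ h1, Or.inr ⟨rfl, h3⟩⟩
    · rw [Function.update_of_ne hba, Function.update_of_ne hba, vne _ hvb]
      rcases I.parent b hb hvb with h1 | ⟨h1, h2, h3, h4⟩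
      · exact Or.inl h1
      · right; rw [vne _ h2]; exact ⟨h1, h2, h3, h4⟩
  case runs =>
    intro c hc hvc htc x hx y hy hxy hvx hxc
    rcases vpos c hc hvc with rfl | ⟨hca, hvc⟩
    · rw [vself] at hxc ⊢
      rw [Function.update_self] at htc
      have hxc' : x ≠ c := by rintro rfl; rw [vself] at hxc; omega
      rw [Function.update_of_ne hxc'] at hvx hxc
      -- A flag 1 means that the first stack is empty, so by `hcov` no visited tile has an unvisited
      -- neighbor in its run.
      have hyvis : vis y ≠ 0 := by
        intro hy0
        obtain ⟨i, h0, h1, -⟩ := I.hcov x hx y hy hvx hy0 hxy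
        omega
      have := I.vis_range y hy
      rw [vne y (by omega)]
      omega
    · rw [vne _ hvc] at hxc ⊢
      rw [Function.update_of_ne hca] at htc
      have hxa : x ≠ a := by rintro rfl; rw [vself] at hxc; have := vlt c hc; omega
      rw [Function.update_of_ne hxa] at hvx hxc
      have := I.runs c hc hvc htc x hx y hy hxy hvx hxc
      rw [vne y this.1]
      exact this
  case latest =>
    intro c hc hvc htc x hx y hy hxy hvx hxc hyc
    rcases vpos c hc hvc with rfl | ⟨hca, hvc⟩
    · rw [vself] at hxc hyc
      rw [Function.update_self] at htc
      have hxc' : x ≠ c := by rintro rfl; rw [vself] at hxc; omega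
      rw [Function.update_of_ne hxc'] at hvx hxc ⊢
      rw [Function.update_self]
      rcases hp0 with ⟨h1, -⟩ | ⟨-, -, -, -, h4, h5, h6⟩
      · omega
      have hyvis : vis y = 0 := by
        by_contra hy0
        have := I.vis_range y hy
        rw [vne y (by omega)] at hyc
        omega
      -- The pending pair `(x, y)` lies at or below the popped top, whose parent is the latest by
      -- `vmono`.
      obtain ⟨i, h0, h1, h7, h8⟩ := I.vcov x hx y hy hvx hyvis hxy
      have h9 := I.vmono i (nv - 1) h0 (by omega) (by omega)
      have h10 := I.vent (nv - 1) (by omega) (by omega)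
      rw [h6] at h9 h10
      rw [h8] at h9
      rw [vne p h10.2.1]
      exact h9
    · rw [vne _ hvc] at hxc hyc
      rw [Function.update_of_ne hca] at htc ⊢
      have hxa : x ≠ a := by rintro rfl; rw [vself] at hxc; have := vlt c hc; omega
      rw [Function.update_of_ne hxa] at hvx hxc ⊢
      have h1 : vis y = 0 ∨ vis c ≤ vis y := by
        rcases hyc with h | h
        · exact Or.inl (vzero y h).2
        · by_cases hya : y = a
          · left; rw [hya]; exact hva
          · rw [Function.update_of_ne hya] at h; exact Or.inr h
      have h2 := I.latest c hc hvc htc x hx y hy hxy hvx hxc h1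
      have h3 : 0 < vis (par c) := by omega
      rw [vne _ h3]
      exact h2

end SearchInv

/-! ### Search trees -/

/-- The outcome of the search. -/
structure SearchTree (Q : Finset ℤ) (h v ρ : ℤ) (ord vis par vt : ℤ → ℤ) : Prop where
  pos : ∀ a ∈ Q, 0 < a
  vis_range : ∀ a ∈ Q, 1 ≤ vis a ∧ vis a ≤ Q.card
  ord_vis : ∀ i : ℤ, 0 ≤ i → i < Q.card → ord i ∈ Q ∧ vis (ord i) = i + 1
  vis_ord : ∀ a ∈ Q, ord (vis a - 1) = a
  parent : ∀ a ∈ Q, (a = ρ ∧ par a = 0 ∧ vt a = 0 ∧ vis a = 1) ∨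
    (par a ∈ Q ∧ vis (par a) < vis a ∧
      ((vt a = 0 ∧ StrideAdj h (par a) a) ∨ (vt a = 1 ∧ StrideAdj v (par a) a)))
  runs : ∀ c ∈ Q, vt c = 1 → ∀ a ∈ Q, ∀ b ∈ Q, StrideAdj h a b →
    vis a < vis c → vis b < vis c
  latest : ∀ c ∈ Q, vt c = 1 → ∀ a ∈ Q, ∀ b ∈ Q, StrideAdj v a b →
    vis a < vis c → vis c ≤ vis b → vis a ≤ vis (par c)

/-- With empty stacks the coverage conditions say that the visited set is closed under neighbors; it
contains the root, so by connectivity it is everything. -/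
theorem SearchInv.finish {Q : Finset ℤ} {h v ρ : ℤ} {hs hp vs vp ord vis par vt : ℤ → ℤ}
    {nh nv cnt : ℤ} (I : SearchInv Q h v ρ hs hp vs vp ord vis par vt nh nv cnt)
    (hend : nh + nv ≤ 0) (pos : ∀ a ∈ Q, 0 < a)
    (hconn : ∀ a ∈ Q, Relation.ReflTransGen
      (fun a b => a ∈ Q ∧ b ∈ Q ∧ (StrideAdj h a b ∨ StrideAdj v a b)) ρ a) :
    SearchTree Q h v ρ ord vis par vt := by
  have h1 := I.nh_nonneg
  have h2 := I.nv_nonneg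
  have hroot : 0 < vis ρ := by
    rcases I.rootcov with h | ⟨i, h3, h4, -⟩
    · exact h
    · omega
  have hall : ∀ a ∈ Q, 0 < vis a := by
    intro a ha
    induction hconn a ha with
    | refl => exact hroot
    | tail _ hstep ih =>
      obtain ⟨hb, hc, hadj⟩ := hstep
      have hvb := ih hb
      have := (I.vis_range _ hc).1
      by_contra hcon
      have hz : vis _ = 0 := le_antisymm (not_lt.1 hcon) this
      rcases hadj with hadj | hadj
      · obtain ⟨i, h3, h4, -⟩ := I.hcov _ hb _ hc hvb hz hadj
        omega
      · obtain ⟨i, h3, h4, -⟩ := I.vcov _ hb _ hc hvb hz hadj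
        omega
  have hcard : (Q.card : ℤ) ≤ cnt := by
    have := Finset.card_le_card_of_injOn (s := Q) (t := Finset.Icc 1 cnt) vis
      (fun a ha => by
        have := hall a ha
        have := I.vis_range a ha
        simp only [Finset.coe_Icc, Set.mem_Icc]
        omega)
      (fun a ha b hb hab => by
        have h3 := I.vis_ord a ha (hall a ha)
        have h4 := I.vis_ord b hb (hall b hb)
        rw [← h3, ← h4, hab])
    rw [Int.card_Icc] at this
    have := I.cnt_nonneg
    omega
  have hcnt : cnt = Q.card := le_antisymm I.cnt_le hcard
  refine ⟨pos, fun a ha => ?_, fun i h0 hi => I.ord_vis i h0 (by omega),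
    fun a ha => I.vis_ord a ha (hall a ha), fun a ha => ?_, ?_, ?_⟩
  · have := hall a ha
    have := I.vis_range a ha
    omega
  · rcases I.parent a ha (hall a ha) with h | ⟨h3, -, h4, h5⟩
    · exact Or.inl h
    · exact Or.inr ⟨h3, h4, h5⟩
  · intro c hc ht a ha b hb hab hlt
    exact (I.runs c hc (hall c hc) ht a ha b hb hab (hall a ha) hlt).2
  · intro c hc ht a ha b hb hab hlt hle
    exact I.latest c hc (hall c hc) ht a ha b hb hab (hall a ha) hlt (Or.inr hle)

/-- Connected inside a run. -/
def RunReach (Q : Finset ℤ) (h : ℤ) : ℤ → ℤ → Prop :=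
  Relation.ReflTransGen fun a b => a ∈ Q ∧ b ∈ Q ∧ StrideAdj h a b

/-- `x` is a descendant of `c`. -/
def Desc (Q : Finset ℤ) (par : ℤ → ℤ) : ℤ → ℤ → Prop :=
  Relation.ReflTransGen fun a b => a ∈ Q ∧ b ∈ Q ∧ par b = a

/-- `S` is one side of a cut of `Q` that runs between two runs. -/
structure IsSide (Q : Finset ℤ) (h v : ℤ) (S : Set ℤ) : Prop where
  subset : ∀ x ∈ S, x ∈ Q
  across : ∀ x ∈ S, ∀ y ∈ Q, y ∉ S → ¬ StrideAdj h x y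
  -- The tiles along the cut lie in a single run on each side. Apart from `across`, this is all the
  -- geometry that the search tree needs.
  inner : ∀ x ∈ S, ∀ y ∈ Q, y ∉ S → StrideAdj v x y →
    ∀ x' ∈ S, ∀ y' ∈ Q, y' ∉ S → StrideAdj v x' y' → RunReach Q h x x'
  outer : ∀ x ∈ S, ∀ y ∈ Q, y ∉ S → StrideAdj v x y →
    ∀ x' ∈ S, ∀ y' ∈ Q, y' ∉ S → StrideAdj v x' y' → RunReach Q h y y'

namespace SearchTree

variable {Q : Finset ℤ} {h v ρ : ℤ} {ord vis par vt : ℤ → ℤ}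

theorem runs_reach (T : SearchTree Q h v ρ ord vis par vt) {c a b : ℤ} (hc : c ∈ Q)
    (ht : vt c = 1) (hab : RunReach Q h a b) (hlt : vis a < vis c) : vis b < vis c := by
  induction hab with
  | refl => exact hlt
  | tail _ hs ih => exact T.runs c hc ht _ hs.1 _ hs.2.1 hs.2.2 ih

theorem vis_le_of_desc (T : SearchTree Q h v ρ ord vis par vt) {c x : ℤ}
    (hx : Desc Q par c x) : vis c ≤ vis x := by
  induction hx with
  | refl => exact le_rfl
  | tail _ hs ih =>
    rename_i y z _
    rcases T.parent _ hs.2.1 with ⟨-, h1, -⟩ | ⟨-, h1, -⟩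
    · have := T.pos _ hs.1
      rw [hs.2.2] at h1
      omega
    · rw [hs.2.2] at h1
      omega

/-- The first visited tile of a side without the root is entered across the cut. -/
theorem exists_entry (T : SearchTree Q h v ρ ord vis par vt) {S : Set ℤ} (hS : IsSide Q h v S)
    (hne : S.Nonempty) (hρ : ρ ∉ S) : ∃ c ∈ S, vt c = 1 ∧ par c ∈ Q ∧ par c ∉ S := by
  obtain ⟨x, hx⟩ := hne
  classical
  obtain ⟨c, hc, hmin⟩ := Finset.exists_min_image (Q.filter (· ∈ S)) vis
    ⟨x, by simp [hx, hS.subset x hx]⟩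
  simp only [Finset.mem_filter] at hc hmin
  rcases T.parent c hc.1 with ⟨h1, -⟩ | ⟨h1, h2, h3⟩
  · exact absurd (h1 ▸ hc.2) hρ
  have hp : par c ∉ S := by
    intro hp
    have := hmin _ ⟨h1, hp⟩
    omega
  refine ⟨c, hc.2, ?_, h1, hp⟩
  rcases h3 with ⟨-, h3⟩ | ⟨h3, -⟩
  · exact absurd h3.symm (hS.across c hc.2 _ h1 hp)
  · exact h3

/-- An edge of the tree that crosses the cut is entered across it. -/
theorem entry_of_cross (T : SearchTree Q h v ρ ord vis par vt) {S : Set ℤ} (hS : IsSide Q h v S)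
    {x : ℤ} (hx : x ∈ Q) (hp : par x ∈ Q) (hcross : ¬ (x ∈ S ↔ par x ∈ S)) :
    vt x = 1 ∧ StrideAdj v (par x) x ∧ vis (par x) < vis x := by
  rcases T.parent x hx with ⟨-, h1, -⟩ | ⟨-, h2, h3⟩
  · have := T.pos _ hp
    omega
  rcases h3 with ⟨-, h3⟩ | ⟨h3, h4⟩
  · exfalso
    by_cases hxs : x ∈ S
    · exact hS.across x hxs _ hp (by tauto) h3.symm
    · exact hS.across (par x) (by tauto) x hx hxs h3
  · exact ⟨h3, h4, h2⟩

section Entry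

variable (T : SearchTree Q h v ρ ord vis par vt) {S : Set ℤ} (hS : IsSide Q h v S) {c : ℤ}
  (hcS : c ∈ S) (hpQ : par c ∈ Q) (hpS : par c ∉ S)

include T hS hcS hpQ hpS

/-- Otherwise the tree path from the root to `par c` leaves `S`, at some `y` entered from `par y ∈
S` before `c` is visited. By `inner`, `par y` and `c` share a run, and that run was exhausted before
`y` was entered, so `c` would precede `y`. -/
theorem root_notMem : ρ ∉ S := by
  intro hρ
  have hc := hS.subset c hcS
  obtain ⟨hvt, hadj, hlt⟩ := T.entry_of_cross hS hc hpQ (by tauto)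
  have key : ∀ n : ℕ, ∀ y ∈ Q, y ∉ S → vis y < vis c → vis y ≤ n → False := by
    intro n
    induction n with
    | zero => intro y hy _ _ h0; have := T.vis_range y hy; omega
    | succ n ih =>
      intro y hy hyS hyc hyn
      rcases T.parent y hy with ⟨h1, -⟩ | ⟨h1, h2, h3⟩
      · exact hyS (h1 ▸ hρ)
      by_cases hp : par y ∈ S
      · obtain ⟨hvy, hady, -⟩ := T.entry_of_cross hS hy h1 (by tauto)
        have := hS.inner _ hp y hy hyS hady c hcS _ hpQ hpS hadj.symm
        have := T.runs_reach hy hvy this h2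
        omega
      · exact ih _ h1 hp (by omega) (by push_cast at hyn; omega)
  have := T.vis_range _ hpQ
  exact key (vis (par c)).toNat _ hpQ hpS hlt (by omega)

/-- A tree edge from a descendant out of `S` would end in the outer run of `par c`. That run was
exhausted before `c` was entered, whereas the end of the edge is visited after `c`. -/
theorem mem_of_desc {x : ℤ} (hx : Desc Q par c x) : x ∈ S := by
  have hc := hS.subset c hcS
  obtain ⟨hvt, hadj, hlt⟩ := T.entry_of_cross hS hc hpQ (by tauto)
  induction hx with
  | refl => exact hcS
  | tail hd hs ih =>
    rename_i y z
    by_contra hz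
    obtain ⟨hy, hzQ, rfl⟩ := hs
    obtain ⟨hvz, hadz, hltz⟩ := T.entry_of_cross hS hzQ hy (by tauto)
    have h1 := hS.outer c hcS _ hpQ hpS hadj.symm _ ih z hzQ hz hadz
    have h2 := T.runs_reach hc hvt h1 hlt
    have := T.vis_le_of_desc hd
    omega

/-- Following parents from a tile of `S` leads out of `S`, since the root is outside; the last tile
in `S` is an entry. Two entries share a run by `inner`, and if one preceded the other, the later one
would have been visited with the run before its own entry. So `c` is the only entry. -/
theorem desc_of_mem {x : ℤ} (hx : x ∈ S) : Desc Q par c x := by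
  have hc := hS.subset c hcS
  have hρ := T.root_notMem hS hcS hpQ hpS
  obtain ⟨hvt, hadj, hlt⟩ := T.entry_of_cross hS hc hpQ (by tauto)
  have key : ∀ n : ℕ, ∀ y ∈ S, vis y ≤ n → Desc Q par c y := by
    intro n
    induction n with
    | zero => intro y hy h0; have := T.vis_range y (hS.subset y hy); omega
    | succ n ih =>
      intro y hyS hyn
      have hy := hS.subset y hyS
      rcases T.parent y hy with ⟨h1, -⟩ | ⟨h1, h2, h3⟩
      · exact absurd (h1 ▸ hyS) hρ
      by_cases hp : par y ∈ S
      · exact (ih _ hp (by push_cast at hyn; omega)).tail ⟨h1, hy, rfl⟩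
      · obtain ⟨hvy, hady, -⟩ := T.entry_of_cross hS hy h1 (by tauto)
        have h4 := hS.inner c hcS _ hpQ hpS hadj.symm y hyS _ h1 hp hady.symm
        have h5 := hS.inner y hyS _ h1 hp hady.symm c hcS _ hpQ hpS hadj.symm
        rcases lt_trichotomy (vis y) (vis c) with h | h | h
        · exact absurd (T.runs_reach hc hvt h5 h) (lt_irrefl _)
        · have : y = c := by rw [← T.vis_ord y hy, ← T.vis_ord c hc, h]
          rw [this]; exact .refl
        · exact absurd (T.runs_reach hy hvy h4 h) (lt_irrefl _)
  have := T.vis_range x (hS.subset x hx)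
  exact key (vis x).toNat x hx (by omega)

/-- Take an `x` outside `S` whose number lies in the range, by induction the first one. Its parent
is then outside `S` and older than `c`. If `x` lies in the run of its parent, that run was finished
before `c`. Otherwise `x` was entered across runs from a tile older than `c`, although descendants
of `c` still to be reached had more recent pending parents, against `latest`. -/
theorem mem_of_between {x y : ℤ} (hx : x ∈ Q) (hcx : vis c ≤ vis x) (hxy : vis x ≤ vis y)
    (hy : y ∈ S) : x ∈ S := by
  have hc := hS.subset c hcS
  obtain ⟨hvt, hadj, hlt⟩ := T.entry_of_cross hS hc hpQ (by tauto)
  have hcross : ∀ (z : ℤ), z ∈ Q → z ∉ S → par z ∈ S → vis z < vis c := by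
    intro z hz hzS hpz
    obtain ⟨-, hadz, -⟩ := T.entry_of_cross hS hz (hS.subset _ hpz) (by tauto)
    exact T.runs_reach hc hvt (hS.outer c hcS _ hpQ hpS hadj.symm _ hpz z hz hzS hadz) hlt
  have key : ∀ n : ℕ, ∀ x ∈ Q, vis c ≤ vis x → vis x ≤ vis y → vis x ≤ n → x ∈ S := by
    intro n
    induction n with
    | zero => intro x hx _ _ h0; have := T.vis_range x hx; omega
    | succ n ih =>
      intro x hx hcx hxy hxn
      by_contra hxS
      rcases T.parent x hx with ⟨-, -, -, h1⟩ | ⟨h1, h2, h3⟩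
      · have h4 := T.vis_range c hc
        have : x = c := by rw [← T.vis_ord x hx, ← T.vis_ord c hc]; congr 1; omega
        exact hxS (this ▸ hcS)
      have hpx : par x ∉ S := fun hp => by have := hcross x hx hxS hp; omega
      have hpc : vis (par x) < vis c := by
        by_contra hcon
        exact hpx (ih _ h1 (by omega) (by omega) (by push_cast at hxn; omega))
      rcases h3 with ⟨-, h3⟩ | ⟨h3, h4⟩
      · have := T.runs c hc hvt _ h1 x hx h3 hpc
        omega
      · have hd := T.desc_of_mem hS hcS hpQ hpS hy
        have hxne : x ≠ c := by rintro rfl; exact hxS hcS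
        have hvxc : vis c < vis x := by
          rcases hcx.lt_or_eq with h | h
          · exact h
          · exact absurd (by rw [← T.vis_ord x hx, ← T.vis_ord c hc, h]) hxne
        -- On the tree path from `c` to `y` some edge leads from a number below `vis x` to one not
        -- below it. Inside a run this contradicts `runs` for `x`, across runs it contradicts
        -- `latest` for `x`.
        have step : ∀ z, Desc Q par c z → vis x ≤ vis z → False := by
          intro z hz
          induction hz with
          | refl => intro h; omega
          | tail hd hs ih' =>
            rename_i a b
            intro hxb
            obtain ⟨ha, hb, rfl⟩ := hs
            by_cases hxa : vis x ≤ vis (par b)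
            · exact ih' hxa
            · rcases T.parent b hb with ⟨-, h5, -⟩ | ⟨-, -, h5⟩
              · have := T.pos _ ha; omega
              rcases h5 with ⟨-, h5⟩ | ⟨-, h5⟩
              · have := T.runs x hx h3 _ ha b hb h5 (by omega)
                omega
              · have h6 := T.latest x hx h3 _ ha b hb h5 (by omega) hxb
                have := T.vis_le_of_desc hd
                omega
        exact step y hd hxy
  have := T.vis_range x hx
  exact key (vis x).toNat x hx hcx hxy (by omega)

/-- The condition on search numbers that the check tests says that `S` is closed under `nx`. -/
theorem closed_iff (nx : ℤ → ℤ) (hnx : ∀ x ∈ Q, nx x ∈ Q) :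
    (∀ x, Desc Q par c x → vis c ≤ vis (nx x) ∧ ∃ y, Desc Q par c y ∧ vis (nx x) ≤ vis y) ↔
      ∀ x ∈ S, nx x ∈ S := by
  constructor
  · intro H x hx
    obtain ⟨h1, y, h2, h3⟩ := H x (T.desc_of_mem hS hcS hpQ hpS hx)
    exact T.mem_of_between hS hcS hpQ hpS (hnx x (hS.subset x hx)) h1 h3
      (T.mem_of_desc hS hcS hpQ hpS h2)
  · intro H x hx
    have h1 := T.desc_of_mem hS hcS hpQ hpS (H x (T.mem_of_desc hS hcS hpQ hpS hx))
    exact ⟨T.vis_le_of_desc h1, _, h1, le_rfl⟩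

end Entry

end SearchTree

/-! ### Maxima over subtrees -/

/-- All tiles with search number greater than `i` have passed their value in `G` on to their
parents, starting from the values `f`. -/
structure AggInv (Q : Finset ℤ) (vis par f G : ℤ → ℤ) (i : ℤ) : Prop where
  own : ∀ a ∈ Q, f a ≤ G a
  attained : ∀ a ∈ Q, ∃ x, x ∈ Q ∧ Desc Q par a x ∧ G a = f x
  passed : ∀ a ∈ Q, par a ∈ Q → i < vis a → G a ≤ G (par a)

namespace AggInv

variable {Q : Finset ℤ} {h v ρ : ℤ} {ord vis par vt f G : ℤ → ℤ} {i : ℤ}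

/-- All proper descendants of `c` have numbers above `vis c ≥ i` and hence have already passed their
values on. -/
theorem le_of_desc (T : SearchTree Q h v ρ ord vis par vt) (A : AggInv Q vis par f G i) {c x : ℤ}
    (hc : c ∈ Q) (hci : i ≤ vis c) (hx : Desc Q par c x) : f x ≤ G c := by
  have key : G x ≤ G c ∧ x ∈ Q := by
    induction hx with
    | refl => exact ⟨le_rfl, hc⟩
    | tail hd hs ih =>
      refine ⟨le_trans ?_ ih.1, hs.2.1⟩
      have h1 := T.vis_le_of_desc hd
      obtain ⟨ha, hb, rfl⟩ := hs
      refine A.passed _ hb ha ?_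
      rcases T.parent _ hb with ⟨-, h2, -⟩ | ⟨-, h2, -⟩
      · have := T.pos _ ha; omega
      · omega
  exact (A.own x key.2).trans key.1

/-- Parents have smaller numbers than their children, so an aggregate no longer changes once it has
been passed on. For the root the update goes to index 0, which is no tile. -/
theorem step (T : SearchTree Q h v ρ ord vis par vt) (A : AggInv Q vis par f G i) (h1 : 1 ≤ i)
    (hi : i ≤ Q.card) : AggInv Q vis par f
      (if 0 < G (ord (i - 1)) - G (par (ord (i - 1))) then
        Function.update G (par (ord (i - 1))) (G (ord (i - 1))) else G) (i - 1) := by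
  obtain ⟨haQ, hva⟩ := T.ord_vis (i - 1) (by omega) (by omega)
  set a := ord (i - 1) with ha
  have hva : vis a = i := by omega
  have honly : ∀ b ∈ Q, i - 1 < vis b → b = a ∨ i < vis b := by
    intro b hb hbi
    rcases (show i ≤ vis b by omega).lt_or_eq with h2 | h2
    · exact Or.inr h2
    · left; rw [ha, ← T.vis_ord b hb, ← h2]
  split_ifs with hlt
  · have hle : ∀ b, G b ≤ Function.update G (par a) (G a) b := by
      intro b
      by_cases hb : b = par a
      · subst hb; rw [Function.update_self]; omega
      · rw [Function.update_of_ne hb]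
    refine ⟨fun b hb => (A.own b hb).trans (hle b), fun b hb => ?_, fun b hb hp hbi => ?_⟩
    · by_cases hbp : b = par a
      · subst hbp
        obtain ⟨x, hx, hd, he⟩ := A.attained a haQ
        exact ⟨x, hx, .head ⟨hb, haQ, rfl⟩ hd, by rw [Function.update_self, he]⟩
      · rw [Function.update_of_ne hbp]; exact A.attained b hb
    · have hbp : b ≠ par a := by
        rintro rfl
        rcases T.parent a haQ with ⟨-, h2, -⟩ | ⟨-, h2, -⟩
        · have := T.pos _ hb; omega
        · omega
      rw [Function.update_of_ne hbp]
      rcases honly b hb hbi with rfl | h2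
      · rw [Function.update_self]
      · exact (A.passed b hb hp h2).trans (hle _)
  · refine ⟨A.own, A.attained, fun b hb hp hbi => ?_⟩
    rcases honly b hb hbi with rfl | h2
    · omega
    · exact A.passed b hb hp h2

end AggInv

/-! ### The search loop of the program implements the two-stack search. -/

namespace RAM

/-- The tiles with codes `Q` are entered in the tables of `s`. -/
structure Holds (D : ℕ) (Q : Finset ℤ) (h v : ℤ) (s : State) : Prop where
  card : s.reg 0 = Q.card
  mem : ∀ a, 0 ≤ a → arr s 0 a = if a ∈ Q then 1 else 0
  large : ∀ a ∈ Q, 0 < a ∧ h < a ∧ v < a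
  small : ∀ a ∈ Q, a + h ≤ D ∧ a + v ≤ D
  h_pos : 0 < h
  v_pos : 0 < v

def SearchState (Q : Finset ℤ) (h v ρ : ℤ) (vis : Fin 32) (s : State) : Prop :=
  SearchInv Q h v ρ (arr s 13) (arr s 14) (arr s 15) (arr s 16) (arr s 17) (arr s vis) (arr s 23)
    (arr s 24) (s.reg 10) (s.reg 11) (s.reg 1)

/-- Each round pops one entry, and a visit pushes four and raises the counter by one. Weight 5 on
the counter makes the potential fall in either case. -/
theorem SearchState.step {W D : ℕ} {Q : Finset ℤ} (p : Params W D Q.card) {h v ρ : ℤ} {vis : Fin 32}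
    {s : State}
    {eh ev : Expr} {B : ℤ} (hs : Bounded D s)
    (hvis : vis = 21 ∨ vis = 22) (hρ : ρ ∈ Q) (H : Holds D Q h v s) (hB : s.reg 6 = B)
    (heh : ∀ s' : State, s'.reg 6 = B → eh.eval s' = h)
    (hev : ∀ s' : State, s'.reg 6 = B → ev.eval s' = v)
    (I : SearchState Q h v ρ vis s) (hg : 0 < s.reg 10 + s.reg 11) :
    (searchBody vis eh ev).Safe D s ∧ SearchState Q h v ρ vis ((searchBody vis eh ev).run s) ∧
      ((searchBody vis eh ev).run s).reg 10 + ((searchBody vis eh ev).run s).reg 11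
        - 5 * ((searchBody vis eh ev).run s).reg 1 < s.reg 10 + s.reg 11 - 5 * s.reg 1 := by
  unfold SearchState at I
  have hn1 := I.nh_nonneg
  have hn2 := I.nv_nonneg
  have hn3 := I.cnt_nonneg
  have hn4 := I.nh_le
  have hn5 := I.nv_le
  have hn6 := I.cnt_le
  have hcl := p.card_le
  have hav : ∀ a, 0 ≤ a → (0 < arr s 0 a - arr s vis a ↔ a ∈ Q ∧ arr s vis a = 0) := by
    intro a ha
    rw [H.mem a ha]
    by_cases haQ : a ∈ Q
    · have := I.vis_range a haQ
      rw [if_pos haQ]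
      constructor
      · intro h; exact ⟨haQ, by omega⟩
      · intro h; omega
    · have := I.vis_out a ha haQ
      rw [if_neg haQ, this]
      simp [haQ]
  by_cases h10 : 0 < s.reg 10
  · have hent := I.hent (s.reg 10 - 1) (by omega) (by omega)
    -- Tables are meaningful only at nonnegative indices; negative ones would address the input.
    -- Codes of tiles exceed both strides, so even codes of non-tiles next to a tile are safe.
    have ha0 : 0 ≤ arr s 13 (s.reg 10 - 1) := by
      rcases hent with ⟨h1, -⟩ | ⟨h1, -, h2⟩
      · rw [h1]; have := H.large ρ hρ; omega
      · have := H.large _ h1; have := H.h_pos; rcases h2 with h2 | h2 <;> omega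
    by_cases hg' : 0 < arr s 0 (arr s 13 (s.reg 10 - 1)) - arr s vis (arr s 13 (s.reg 10 - 1))
    · obtain ⟨haQ, hva⟩ := (hav _ ha0).1 hg'
      have hlt := I.cnt_lt haQ hva
      have hla := H.large _ haQ
      have hsm := H.small _ haQ
      have hh := H.h_pos
      have hv := H.v_pos
      have e1 := hs.arr 13 (s.reg 10 - 1)
      have e2 := hs.arr 14 (s.reg 10 - 1)
      have key := I.visit haQ hva (p := arr s 14 (s.reg 10 - 1)) (t := 0) (mh := s.reg 10 - 1)
        (mv := s.reg 11) (Or.inl ⟨rfl, hent.imp (fun h => h) (fun h => h), rfl, rfl, h10, rfl⟩)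
      rcases hvis with rfl | rfl <;>
      · refine ⟨?_, ?_, ?_⟩
        · simp [searchBody, popBody, visitBody, h10, sub_pos.1 hg', heh, hev, hB]
          simp only [abs_le] at *
          omega
        · simp [SearchState, searchBody, popBody, visitBody, h10, sub_pos.1 hg', heh, hev, hB]
          simp only [sub_add_cancel] at key
          convert key using 1 <;> omega
        · simp [searchBody, popBody, visitBody, h10, sub_pos.1 hg', heh, hev, hB]
          omega
    · have key := I.pop_left h10 (by
        by_contra hc
        push Not at hc
        have h3 := I.vis_range _ hc.1
        exact hg' ((hav _ ha0).2 ⟨hc.1, by omega⟩)) hρ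
      have e1 := hs.arr 13 (s.reg 10 - 1)
      have e2 := hs.arr 14 (s.reg 10 - 1)
      rcases hvis with rfl | rfl <;>
      · refine ⟨?_, ?_, ?_⟩
        · simp [searchBody, popBody, h10, mt sub_pos.2 hg']
          simp only [abs_le] at *
          omega
        · simpa [SearchState, searchBody, popBody, h10, mt sub_pos.2 hg'] using key
        · simp [searchBody, popBody, h10, mt sub_pos.2 hg']
  · have h10' : s.reg 10 = 0 := by omega
    have h11 : 0 < s.reg 11 := by omega
    have hent := I.vent (s.reg 11 - 1) (by omega) (by omega)
    have ha0 : 0 ≤ arr s 15 (s.reg 11 - 1) := by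
      have := H.large _ hent.1
      have := H.v_pos
      rcases hent.2.2 with h2 | h2 <;> omega
    by_cases hg' : 0 < arr s 0 (arr s 15 (s.reg 11 - 1)) - arr s vis (arr s 15 (s.reg 11 - 1))
    · obtain ⟨haQ, hva⟩ := (hav _ ha0).1 hg'
      have hlt := I.cnt_lt haQ hva
      have hla := H.large _ haQ
      have hsm := H.small _ haQ
      have hh := H.h_pos
      have hv := H.v_pos
      have e1 := hs.arr 15 (s.reg 11 - 1)
      have e2 := hs.arr 16 (s.reg 11 - 1)
      have key := I.visit haQ hva (p := arr s 16 (s.reg 11 - 1)) (t := 1) (mh := s.reg 10)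
        (mv := s.reg 11 - 1) (Or.inr ⟨rfl, h10', rfl, rfl, h11, rfl, rfl⟩)
      rcases hvis with rfl | rfl <;>
      · refine ⟨?_, ?_, ?_⟩
        · simp [searchBody, popBody, visitBody, h10, sub_pos.1 hg', heh, hev, hB]
          simp only [abs_le] at *
          omega
        · simp [SearchState, searchBody, popBody, visitBody, h10, sub_pos.1 hg', heh, hev, hB]
          simp only [sub_add_cancel] at key
          convert key using 1 <;> omega
        · simp [searchBody, popBody, visitBody, h10, sub_pos.1 hg', heh, hev, hB]
          omega
    · have key := I.pop_right h11 (by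
        by_contra hc
        push Not at hc
        have h3 := I.vis_range _ hc.1
        exact hg' ((hav _ ha0).2 ⟨hc.1, by omega⟩))
      have e1 := hs.arr 15 (s.reg 11 - 1)
      have e2 := hs.arr 16 (s.reg 11 - 1)
      rcases hvis with rfl | rfl <;>
      · refine ⟨?_, ?_, ?_⟩
        · simp [searchBody, popBody, h10, mt sub_pos.2 hg']
          simp only [abs_le] at *
          omega
        · simpa [SearchState, searchBody, popBody, h10, mt sub_pos.2 hg'] using key
        · simp [searchBody, popBody, h10, mt sub_pos.2 hg']

theorem Holds.congr {D : ℕ} {Q : Finset ℤ} {h v : ℤ} {s s' : State} (H : Holds D Q h v s)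
    (h0 : arr s' 0 = arr s 0) (h1 : s'.reg 0 = s.reg 0) : Holds D Q h v s' :=
  { H with card := h1.trans H.card, mem := fun a ha => by rw [h0]; exact H.mem a ha }

/-- Adjacent in the grid, on the level of codes. -/
def CodeConn (Q : Finset ℤ) (h v ρ : ℤ) : Prop :=
  ∀ a ∈ Q, Relation.ReflTransGen
    (fun a b => a ∈ Q ∧ b ∈ Q ∧ (StrideAdj h a b ∨ StrideAdj v a b)) ρ a

theorem search_runs {W D : ℕ} {Q : Finset ℤ} (p : Params W D Q.card) {h v : ℤ} {vis : Fin 32}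
    {s : State} {eh ev : Expr} {B : ℤ} (hs : Bounded D s) (hvis : vis = 21 ∨ vis = 22)
    (hst : (search vis eh ev).static = true)
    (hρ : s.reg 7 ∈ Q) (H : Holds D Q h v s) (hB : s.reg 6 = B)
    (heh : ∀ s' : State, s'.reg 6 = B → eh.eval s' = h)
    (hev : ∀ s' : State, s'.reg 6 = B → ev.eval s' = v)
    (hconn : CodeConn Q h v (s.reg 7)) (hz : ∀ a, 0 ≤ a → arr s vis a = 0) :
    Runs W D Q.card (search vis eh ev) s fun s' =>
      SearchTree Q h v (s.reg 7) (arr s' 17) (arr s' vis) (arr s' 23) (arr s' 24) := by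
  have hD := p.card_le
  have e7 := hs.1 7
  simp only [search, Cmd.static, Bool.and_eq_true] at hst
  refine Runs.seq (Q := fun s' => SearchState Q h v (s.reg 7) vis s' ∧ Holds D Q h v s' ∧
    s'.reg 6 = B ∧ s'.reg 10 = 1 ∧ s'.reg 11 = 0 ∧ s'.reg 1 = 0)
    (Runs.of_run p hs hst.1 ?_ ?_) ?_
  · simp
    exact ⟨by omega, e7⟩
  · refine ⟨?_, H.congr (by simp) (by simp), by simp [hB], by simp, by simp, by simp⟩
    have hQ : ∀ a ∈ Q, 0 ≤ a := fun a ha => (H.large a ha).1.le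
    rcases hvis with rfl | rfl
    · have := SearchInv.start (h := h) (v := v) (ρ := s.reg 7)
        (hs := Function.update (arr s 13) 0 (s.reg 7)) (hp := Function.update (arr s 14) 0 0)
        (vs := arr s 15) (vp := arr s 16) (ord := arr s 17) (vis := arr s 21) (par := arr s 23)
        (vt := arr s 24) hz hQ (by simp) (by simp)
      simpa [SearchState] using this
    · have := SearchInv.start (h := h) (v := v) (ρ := s.reg 7)
        (hs := Function.update (arr s 13) 0 (s.reg 7)) (hp := Function.update (arr s 14) 0 0)
        (vs := arr s 15) (vp := arr s 16) (ord := arr s 17) (vis := arr s 22) (par := arr s 23)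
        (vt := arr s 24) hz hQ (by simp) (by simp)
      simpa [SearchState] using this
  · rintro s₁ hs₁ hf₁ ⟨I₁, H₁, hB₁, h10, h11, h1⟩
    refine Runs.mono (Runs.loop p (by simpa only [Cmd.static, Bool.and_eq_true] using hst.2)
      (SearchState Q h v (s.reg 7) vis)
      -- The shift keeps the potential positive, as there are at most `Q.card` visits.
      (fun s' => s'.reg 10 + s'.reg 11 - 5 * s'.reg 1 + 5 * Q.card) hs₁ I₁ ?_ ?_) ?_
    · have := p.pos
      simp only [h10, h11, h1]
      omega
    · intro s₂ hs₂ hf₂ I₂ hg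
      have h0 : arr s₂ 0 = arr s₁ 0 := hf₂.arr 0 (by rcases hvis with rfl | rfl <;> rfl)
      have h1 : s₂.reg 0 = s₁.reg 0 := hf₂.reg 0 rfl
      have h2 : s₂.reg 6 = s₁.reg 6 := hf₂.reg 6 rfl
      obtain ⟨h3, h4, h5⟩ := SearchState.step p hs₂ hvis hρ (H₁.congr h0 h1) (h2.trans hB₁) heh hev
        I₂ (by simpa using hg)
      refine ⟨h3, h4, ?_, by omega⟩
      have := SearchInv.cnt_le I₂
      simp only [eval_hadd, eval_reg] at hg
      omega
    · rintro s' - - ⟨I', hg⟩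
      exact SearchInv.finish I' (by simpa using hg) (fun a ha => (H.large a ha).1) hconn

end RAM

/-- All search numbers of `nx` of descendants of `c` are search numbers of descendants of `c`. -/
def DescClosed (Q : Finset ℤ) (vis par nx : ℤ → ℤ) (c : ℤ) : Prop :=
  ∀ x, Desc Q par c x → vis c ≤ vis (nx x) ∧ ∃ y, Desc Q par c y ∧ vis (nx x) ≤ vis y

theorem SearchTree.aggInv_start {Q : Finset ℤ} {h v ρ : ℤ} {ord vis par vt : ℤ → ℤ}
    (T : SearchTree Q h v ρ ord vis par vt) {f G : ℤ → ℤ} (hG : ∀ a ∈ Q, G a = f a) :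
    AggInv Q vis par f G Q.card :=
  ⟨fun a ha => (hG a ha).ge, fun a ha => ⟨a, ha, .refl, hG a ha⟩,
    fun a ha _ hlt => by have := T.vis_range a ha; omega⟩

/-- The test on the aggregated values. -/
theorem descClosed_iff_of_agg {Q : Finset ℤ} {h v ρ : ℤ} {ord vis par vt nx F G L : ℤ → ℤ} {i c : ℤ}
    (T : SearchTree Q h v ρ ord vis par vt)
    (AF : AggInv Q vis par (fun x => vis (nx x)) F i)
    (AG : AggInv Q vis par (fun x => -vis (nx x)) G i)
    (AL : AggInv Q vis par vis L i) (hc : c ∈ Q) (hi : i ≤ vis c) :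
    F c ≤ L c ∧ G c + vis c ≤ 0 ↔ DescClosed Q vis par nx c := by
  obtain ⟨x₁, hx₁, hd₁, he₁⟩ := AF.attained c hc
  obtain ⟨x₂, hx₂, hd₂, he₂⟩ := AG.attained c hc
  obtain ⟨x₃, hx₃, hd₃, he₃⟩ := AL.attained c hc
  constructor
  · rintro ⟨h1, h2⟩ x hx
    have h3 := AF.le_of_desc T hc hi hx
    have h4 := AG.le_of_desc T hc hi hx
    exact ⟨by omega, x₃, hd₃, by omega⟩
  · intro H
    obtain ⟨-, y, hy, h1⟩ := H x₁ hd₁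
    obtain ⟨h2, -⟩ := H x₂ hd₂
    have h3 := AL.le_of_desc T hc hi hy
    omega

/-! ### The sweep that tests all entries for one direction. -/

namespace RAM

theorem run_raise (s : State) (f : Fin 32) : (raise f).run s =
    if arr s f (s.reg 11) < arr s f (s.reg 10) then
      setArr s f (s.reg 11) (arr s f (s.reg 10)) else s := by
  unfold raise
  split_ifs with h
  · exact Cmd.run_ite_pos (sub_pos.2 h)
  · exact Cmd.run_ite_neg (mt sub_pos.1 h)

theorem arr_raise (s : State) (f g : Fin 32) :
    arr ((raise f).run s) g = if g = f then
      (if 0 < arr s f (s.reg 10) - arr s f (s.reg 11) then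
        Function.update (arr s f) (s.reg 11) (arr s f (s.reg 10)) else arr s f)
      else arr s g := by
  simp only [run_raise, sub_pos]
  split_ifs with h1 h2 h2
  · subst h2; simp
  · simp [h2]
  · rw [h2]
  · rfl

theorem reg_raise (s : State) (f : Fin 32) : ((raise f).run s).reg = s.reg := by
  rw [run_raise]
  split_ifs <;> rfl

theorem safe_raise {D : ℕ} {s : State} (f : Fin 32) (h : Bounded D s) : (raise f).Safe D s := by
  unfold raise
  by_cases hc : 0 < (rd f (.reg 10) - rd f (.reg 11)).eval s
  · rw [Cmd.safe_ite_pos hc]; exact h.arr _ _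
  · rw [Cmd.safe_ite_neg hc]; trivial

theorem Bounded.run_raise {D : ℕ} {s : State} (f : Fin 32) (h : Bounded D s) :
    Bounded D ((raise f).run s) := by
  rw [RAM.run_raise]
  split_ifs
  · exact h.setM _ (h.arr _ _)
  · exact h

theorem run_record (s : State) (vis : Fin 32) : (record vis).run s =
    if 0 < arr s 24 (s.reg 10) ∧ arr s 18 (s.reg 10) ≤ arr s 20 (s.reg 10) ∧
      arr s 19 (s.reg 10) + arr s vis (s.reg 10) ≤ 0 then
      setR (setR s 8 (s.reg 10)) 9 (s.reg 11) else s := by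
  unfold record
  by_cases h1 : 0 < arr s 24 (s.reg 10)
  · rw [Cmd.run_ite_pos (by simpa using h1)]
    by_cases h2 : arr s 18 (s.reg 10) ≤ arr s 20 (s.reg 10)
    · rw [Cmd.run_ite_neg (by simpa using h2)]
      by_cases h3 : arr s 19 (s.reg 10) + arr s vis (s.reg 10) ≤ 0
      · rw [Cmd.run_ite_neg (by simpa using h3), if_pos ⟨h1, h2, h3⟩]
        simp
      · rw [Cmd.run_ite_pos (by simpa using h3), if_neg (by tauto)]
        rfl
    · rw [Cmd.run_ite_pos (by simpa using h2), if_neg (by tauto)]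
      rfl
  · rw [Cmd.run_ite_neg (by simpa using h1), if_neg (by tauto)]
    rfl

theorem arr_record (s : State) (vis g : Fin 32) : arr ((record vis).run s) g = arr s g := by
  rw [run_record]
  split_ifs <;> rfl

theorem reg_record (s : State) (vis : Fin 32) (i : ℕ) : ((record vis).run s).reg i =
    if 0 < arr s 24 (s.reg 10) ∧ arr s 18 (s.reg 10) ≤ arr s 20 (s.reg 10) ∧
      arr s 19 (s.reg 10) + arr s vis (s.reg 10) ≤ 0 then
      (if i = 8 then s.reg 10 else if i = 9 then s.reg 11 else s.reg i) else s.reg i := by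
  rw [run_record]
  split_ifs <;> simp_all

theorem safe_record {D : ℕ} {s : State} (vis : Fin 32) (h : Bounded D s) :
    (record vis).Safe D s := by
  unfold record
  by_cases h1 : 0 < (rd 24 (.reg 10)).eval s
  · rw [Cmd.safe_ite_pos h1]
    by_cases h2 : 0 < (rd 18 (.reg 10) - rd 20 (.reg 10)).eval s
    · rw [Cmd.safe_ite_pos h2]; trivial
    · rw [Cmd.safe_ite_neg h2]
      by_cases h3 : 0 < (rd 19 (.reg 10) + rd vis (.reg 10)).eval s
      · rw [Cmd.safe_ite_pos h3]; trivial
      · rw [Cmd.safe_ite_neg h3]; simp [h.1]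
  · rw [Cmd.safe_ite_neg h1]; trivial

theorem Bounded.run_record {D : ℕ} {s : State} (vis : Fin 32) (h : Bounded D s) :
    Bounded D ((record vis).run s) := by
  rw [RAM.run_record]
  split_ifs
  · exact (h.setR _ (h.1 _)).setR _ (h.1 _)
  · exact h

/-- What is known about the result registers after checking the tiles with search number above
`i`. -/
def CheckResult (Q : Finset ℤ) (vis par vt nx : ℤ → ℤ) (s s' : State) (i : ℤ) : Prop :=
  (s'.reg 8 = s.reg 8 ∧ s'.reg 9 = s.reg 9 ∧
    ∀ c ∈ Q, i < vis c → vt c = 1 → ¬ DescClosed Q vis par nx c) ∨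
  (s'.reg 8 ∈ Q ∧ vt (s'.reg 8) = 1 ∧ s'.reg 9 = par (s'.reg 8) ∧
    DescClosed Q vis par nx (s'.reg 8))

/-- The second loop goes backwards through the search order, and its counter is the index of the
three `AggInv` invariants. When a tile is tested, all its descendants have passed their values on,
so its aggregates describe exactly its subtree. -/
theorem check_runs {W D : ℕ} {Q : Finset ℤ} (p : Params W D Q.card) {h v ρ : ℤ} {vis nx : Fin 32}
    {s : State} (hs : Bounded D s) (hvis : vis = 21 ∨ vis = 22)
    (hnx' : nx = 9 ∨ nx = 10 ∨ nx = 11 ∨ nx = 12)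
    (H : s.reg 0 = Q.card)
    (T : SearchTree Q h v ρ (arr s 17) (arr s vis) (arr s 23) (arr s 24)) :
    Runs W D Q.card (check vis nx) s fun s' =>
      CheckResult Q (arr s vis) (arr s 23) (arr s 24) (arr s nx) s s' 0 := by
  have hD := p.card_le
  have hN := p.pos
  have hv21 : vis ≠ 18 ∧ vis ≠ 19 ∧ vis ≠ 20 := by rcases hvis with rfl | rfl <;> decide
  have hn9 : nx ≠ 18 ∧ nx ≠ 19 ∧ nx ≠ 20 := by rcases hnx' with rfl | rfl | rfl | rfl <;> decide
  have keep : ∀ g : Fin 32, g ≠ 18 → g ≠ 19 → g ≠ 20 →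
      (initBody vis nx).touches g = false ∧ (checkBody vis).touches g = false := by
    -- The set of arrays written does not depend on `vis` and `nx`, so a single instance can be
    -- decided.
    have : ∀ g : Fin 32, g ≠ 18 → g ≠ 19 → g ≠ 20 →
      (initBody 0 0).touches g = false ∧ (checkBody 0).touches g = false := by decide
    exact this
  have hst : (check vis nx).static = true := by
    rcases hvis with rfl | rfl <;> rcases hnx' with rfl | rfl | rfl | rfl <;> rfl
  simp only [check, Cmd.static, Bool.and_eq_true] at hst
  refine Runs.seq (Q := fun s' => arr s' = arr s ∧ s'.reg 1 = 0 ∧ ∀ i, i ≠ 1 → s'.reg i = s.reg i)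
    (Runs.of_run p hs hst.1 (by simp) ?_) ?_
  · exact ⟨by funext f; simp, by simp, fun i hi => by simp [hi]⟩
  rintro s₁ hs₁ - ⟨ha₁, h1, hr₁⟩
  refine Runs.seq (Runs.loop p (by simpa only [Cmd.static, Bool.and_eq_true] using hst.2.1)
    (fun s' => 0 ≤ s'.reg 1 ∧ s'.reg 1 ≤ Q.card ∧ ∀ i, 0 ≤ i → i < s'.reg 1 →
      arr s' 18 (arr s 17 i) = arr s vis (arr s nx (arr s 17 i)) ∧
      arr s' 19 (arr s 17 i) = -arr s vis (arr s nx (arr s 17 i)) ∧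
      arr s' 20 (arr s 17 i) = arr s vis (arr s 17 i))
    (fun s' => Q.card - s'.reg 1) hs₁ ⟨by omega, by omega, by intros; omega⟩ (by omega) ?_) ?_
  · rintro s₂ hs₂ hf₂ ⟨h2, h3, h4⟩ hg
    have h0 : s₂.reg 0 = Q.card := by rw [hf₂.reg 0 rfl, hr₁ 0 (by omega), H]
    simp only [eval_hsub, eval_reg, h0] at hg
    have hA : ∀ g : Fin 32, g ≠ 18 → g ≠ 19 → g ≠ 20 → arr s₂ g = arr s g := by
      intro g hg1 hg2 hg3
      rw [hf₂.arr g (keep g hg1 hg2 hg3).1, ha₁]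
    have e17 := hA 17 (by decide) (by decide) (by decide)
    have evis := hA vis hv21.1 hv21.2.1 hv21.2.2
    have enx := hA nx hn9.1 hn9.2.1 hn9.2.2
    have b1 := hs₂.arr 17 (s₂.reg 1)
    have b2 := hs₂.arr vis (arr s₂ nx (arr s₂ 17 (s₂.reg 1)))
    have b3 := hs₂.arr vis (arr s₂ 17 (s₂.reg 1))
    refine ⟨?_, ⟨?_, ?_, ?_⟩, by omega, ?_⟩
    · simp [initBody, hv21]
      simp only [abs_le] at *
      omega
    · simp [initBody]; omega
    · simp [initBody]; omega
    · simp only [initBody, Cmd.run, block, eval_rd, eval_reg, reg_setR, reg_setArr, eval_hadd,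
        eval_lit, arr_setR, run_wr, eval_hsub, arr_setArr]
      simp [hv21, e17, evis, enx]
      intro i hi0 hi
      by_cases hic : i = s₂.reg 1
      · subst hic; simp
      · have hne : arr s 17 i ≠ arr s 17 (s₂.reg 1) := by
          intro he
          have h5 := (T.ord_vis i hi0 (by omega)).2
          have h6 := (T.ord_vis (s₂.reg 1) h2 (by omega)).2
          rw [he] at h5
          omega
        simp only [Function.update_of_ne hne]
        exact h4 i hi0 (by omega)
    · simp [initBody]
  rintro s₂ hs₂ hf₂ ⟨⟨h2, h3, h4⟩, hg⟩
  have h0 : s₂.reg 0 = Q.card := by rw [hf₂.reg 0 rfl, hr₁ 0 (by omega), H]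
  simp only [eval_hsub, eval_reg, h0] at hg
  have hA₂ : ∀ g : Fin 32, g ≠ 18 → g ≠ 19 → g ≠ 20 → arr s₂ g = arr s g := by
    intro g hg1 hg2 hg3
    rw [hf₂.arr g (keep g hg1 hg2 hg3).1, ha₁]
  have hinit : ∀ a ∈ Q, arr s₂ 18 a = arr s vis (arr s nx a) ∧
      arr s₂ 19 a = -arr s vis (arr s nx a) ∧ arr s₂ 20 a = arr s vis a := by
    intro a ha
    have h5 := T.vis_range a ha
    have := h4 (arr s vis a - 1) (by omega) (by omega)
    rwa [T.vis_ord a ha] at this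
  have hr8 : s₂.reg 8 = s.reg 8 := by rw [hf₂.reg 8 rfl, hr₁ 8 (by omega)]
  have hr9 : s₂.reg 9 = s.reg 9 := by rw [hf₂.reg 9 rfl, hr₁ 9 (by omega)]
  refine Runs.mono (Runs.loop p (by simpa only [Cmd.static, Bool.and_eq_true] using hst.2.2)
    (fun s' => 0 ≤ s'.reg 1 ∧ s'.reg 1 ≤ Q.card ∧
      AggInv Q (arr s vis) (arr s 23) (fun x => arr s vis (arr s nx x)) (arr s' 18) (s'.reg 1) ∧
      AggInv Q (arr s vis) (arr s 23) (fun x => -arr s vis (arr s nx x)) (arr s' 19) (s'.reg 1) ∧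
      AggInv Q (arr s vis) (arr s 23) (arr s vis) (arr s' 20) (s'.reg 1) ∧
      CheckResult Q (arr s vis) (arr s 23) (arr s 24) (arr s nx) s s' (s'.reg 1))
    (fun s' => s'.reg 1) hs₂ ⟨h2, h3, ?_, ?_, ?_, ?_⟩ (by omega) ?_) ?_
  · rw [show s₂.reg 1 = Q.card by omega]
    exact T.aggInv_start fun a ha => (hinit a ha).1
  · rw [show s₂.reg 1 = Q.card by omega]
    exact T.aggInv_start fun a ha => (hinit a ha).2.1
  · rw [show s₂.reg 1 = Q.card by omega]
    exact T.aggInv_start fun a ha => (hinit a ha).2.2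
  · exact Or.inl ⟨hr8, hr9, fun c hc hlt => by have := T.vis_range c hc; omega⟩
  · rintro s₃ hs₃ hf₃ ⟨h5, h6, AF, AG, AL, hres⟩ hg'
    have hg' : 0 < s₃.reg 1 := hg'
    have hA : ∀ g : Fin 32, g ≠ 18 → g ≠ 19 → g ≠ 20 → arr s₃ g = arr s g := by
      intro g hg1 hg2 hg3
      rw [hf₃.arr g (keep g hg1 hg2 hg3).2, hA₂ g hg1 hg2 hg3]
    have e17 := hA 17 (by decide) (by decide) (by decide)
    have e23 := hA 23 (by decide) (by decide) (by decide)
    have e24 := hA 24 (by decide) (by decide) (by decide)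
    have evis := hA vis hv21.1 hv21.2.1 hv21.2.2
    set a := arr s 17 (s₃.reg 1 - 1) with ha
    obtain ⟨haQ, hva⟩ := T.ord_vis (s₃.reg 1 - 1) (by omega) (by omega)
    rw [← ha] at haQ hva
    set s₄ := setR (setR (setR s₃ 1 (s₃.reg 1 - 1)) 10 a) 11 (arr s 23 a) with hs4
    have hrun : (checkBody vis).run s₃ =
        (raise 20).run ((raise 19).run ((raise 18).run ((record vis).run s₄))) := by
      simp only [checkBody, block, Cmd.run, eval_hsub, eval_reg, eval_lit, eval_rd, reg_setR,
        arr_setR, e17, e23, hs4, if_true]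
      rfl
    have hb₄ : Bounded D s₄ := by
      refine ((hs₃.setR _ ?_).setR _ ?_).setR _ ?_
      · rw [abs_le]; omega
      · rw [ha, ← e17]; exact hs₃.arr _ _
      · rw [← e23]; exact hs₃.arr _ _
    have r10 : s₄.reg 10 = a := by simp [hs4]
    have r11 : s₄.reg 11 = arr s 23 a := by simp [hs4]
    have r1 : s₄.reg 1 = s₃.reg 1 - 1 := by simp [hs4]
    have r8 : s₄.reg 8 = s₃.reg 8 := by simp [hs4]
    have r9 : s₄.reg 9 = s₃.reg 9 := by simp [hs4]
    have a4 : arr s₄ = arr s₃ := by funext f; simp [hs4]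
    have rr : ∀ i, ((checkBody vis).run s₃).reg i = ((record vis).run s₄).reg i := by
      intro i; rw [hrun, reg_raise, reg_raise, reg_raise]
    have rr1 : ((checkBody vis).run s₃).reg 1 = s₃.reg 1 - 1 := by
      rw [rr, reg_record, ← r1]; simp
    have q10 : ((record vis).run s₄).reg 10 = a := by rw [reg_record]; simp [r10]
    have q11 : ((record vis).run s₄).reg 11 = arr s 23 a := by rw [reg_record]; simp [r11]
    refine ⟨?_, ⟨by rw [rr1]; omega, by rw [rr1]; omega, ?_, ?_, ?_, ?_⟩, hg', by rw [rr1]; omega⟩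
    · have b1 := hb₄.run_record vis
      have b2 := b1.run_raise 18
      have b3 := b2.run_raise 19
      have e1 : |s₃.reg 1 - 1| ≤ (D : ℤ) := by rw [abs_le]; omega
      have e2 := hs₃.arr 17 (s₃.reg 1 - 1)
      have e3 := hs₃.arr 23 a
      simp only [checkBody, block, Cmd.Safe, Cmd.run, eval_hsub, eval_reg, eval_lit, eval_rd,
        reg_setR, arr_setR, if_true]
      simp only [e17, e23] at e2 e3 ⊢
      exact ⟨e1, e2, e3, safe_record _ hb₄, safe_raise _ b1, safe_raise _ b2, safe_raise _ b3,
        trivial⟩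
    · have := AF.step T (by omega) h6
      rw [rr1, hrun]
      simpa [arr_raise, reg_raise, arr_record, q10, q11, a4, ← ha] using this
    · have := AG.step T (by omega) h6
      rw [rr1, hrun]
      simpa [arr_raise, reg_raise, arr_record, q10, q11, a4, ← ha] using this
    · have := AL.step T (by omega) h6
      rw [rr1, hrun]
      simpa [arr_raise, reg_raise, arr_record, q10, q11, a4, ← ha] using this
    · have htest := descClosed_iff_of_agg T AF AG AL haQ (by omega)
      have hvt : 0 < arr s 24 a ↔ arr s 24 a = 1 := by
        rcases T.parent a haQ with ⟨-, -, h7, -⟩ | ⟨-, -, ⟨h7, -⟩ | ⟨h7, -⟩⟩ <;> omega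
      have hcond : (0 < arr s₄ 24 (s₄.reg 10) ∧ arr s₄ 18 (s₄.reg 10) ≤ arr s₄ 20 (s₄.reg 10) ∧
          arr s₄ 19 (s₄.reg 10) + arr s₄ vis (s₄.reg 10) ≤ 0) ↔
          arr s 24 a = 1 ∧ DescClosed Q (arr s vis) (arr s 23) (arr s nx) a := by
        rw [r10, a4, evis, e24, hvt, htest]
      have R8 := rr 8
      have R9 := rr 9
      rw [reg_record] at R8 R9
      by_cases hc : arr s 24 a = 1 ∧ DescClosed Q (arr s vis) (arr s 23) (arr s nx) a
      · rw [if_pos (hcond.2 hc)] at R8 R9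
        simp only [if_true, r10, r11] at R8 R9
        right
        rw [R8, R9]
        exact ⟨haQ, hc.1, by simp, hc.2⟩
      · rw [if_neg (mt hcond.1 hc)] at R8 R9
        rw [r8] at R8
        rw [r9] at R9
        unfold CheckResult
        rw [R8, R9, rr1]
        refine hres.imp (fun ⟨h7, h8, h9⟩ => ⟨h7, h8, fun c hc' hlt hvc hcl => ?_⟩) id
        rcases (show s₃.reg 1 ≤ arr s vis c by omega).lt_or_eq with h10 | h10
        · exact h9 c hc' h10 hvc hcl
        · have : c = a := by
            rw [← T.vis_ord c hc', ← h10]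
          subst this
          exact hc ⟨hvc, hcl⟩
  · rintro s' - - ⟨⟨h5, h6, -, -, -, hres⟩, hg'⟩
    have hg' : s'.reg 1 ≤ 0 := hg'
    rwa [show s'.reg 1 = 0 by omega] at hres

end RAM

/-! ### One stage: a search followed by the tests for the four directions. -/

namespace RAM

/-- The arrays that hold the next tiles in the four directions. -/
def dirs : Finset (Fin 32) := {9, 10, 11, 12}

/-- What a stage finds out: either no side is closed under one of the maps `nx`, or the result
registers hold two neighbors whose separation yields such a side. -/
def StageResult (Q : Finset ℤ) (h v ρ : ℤ) (nx : Fin 32 → ℤ → ℤ) (s : State) : Prop :=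
  (s.reg 8 = 0 ∧ ∀ S, IsSide Q h v S → S.Nonempty → ρ ∉ S → ∀ f ∈ dirs, ¬ ∀ x ∈ S, nx f x ∈ S) ∨
  (s.reg 8 ∈ Q ∧ s.reg 9 ∈ Q ∧ StrideAdj v (s.reg 9) (s.reg 8) ∧ ∃ f ∈ dirs,
    ∀ S, IsSide Q h v S → s.reg 8 ∈ S → s.reg 9 ∉ S → ∀ x ∈ S, nx f x ∈ S)

/-- What is known after the checks of the directions in `F`. -/
def Checked (Q : Finset ℤ) (vis par vt : ℤ → ℤ) (nx : Fin 32 → ℤ → ℤ) (F : Finset (Fin 32))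
    (s : State) : Prop :=
  (s.reg 8 = 0 ∧ ∀ f ∈ F, ∀ c ∈ Q, vt c = 1 → ¬ DescClosed Q vis par (nx f) c) ∨
  ∃ f ∈ dirs, s.reg 8 ∈ Q ∧ vt (s.reg 8) = 1 ∧ s.reg 9 = par (s.reg 8) ∧
    DescClosed Q vis par (nx f) (s.reg 8)

theorem CheckResult.checked {Q : Finset ℤ} {vis par vt : ℤ → ℤ} {nx : Fin 32 → ℤ → ℤ} {s s' : State}
    {F : Finset (Fin 32)} {f : Fin 32} (h : CheckResult Q vis par vt (nx f) s s' 0)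
    (hf : f ∈ dirs) (hvis : ∀ c ∈ Q, 0 < vis c) (h0 : Checked Q vis par vt nx F s) :
    Checked Q vis par vt nx (insert f F) s' := by
  rcases h with ⟨h1, h2, h3⟩ | h1
  · unfold Checked
    rw [h1, h2]
    refine h0.imp (fun h => ⟨h.1, fun g hg c hc => ?_⟩) id
    rcases Finset.mem_insert.1 hg with rfl | hg
    · exact h3 c hc (hvis c hc)
    · exact h.2 g hg c hc
  · exact Or.inr ⟨f, hf, h1⟩

/-- A closed side without the root has an entry, which passes the test by `SearchTree.closed_iff`;
so if nothing is recorded, there is none. Conversely, a recorded tile has passed a test that means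
closedness for every side separating it from its parent. -/
theorem stage_runs {W D : ℕ} {Q : Finset ℤ} (p : Params W D Q.card) {h v : ℤ} {vis : Fin 32}
    {s : State} {eh ev : Expr} {B : ℤ} (hs : Bounded D s) (hvis : vis = 21 ∨ vis = 22)
    (hst : (search vis eh ev).static = true)
    (hρ : s.reg 7 ∈ Q) (H : Holds D Q h v s) (hB : s.reg 6 = B)
    (heh : ∀ s' : State, s'.reg 6 = B → eh.eval s' = h)
    (hev : ∀ s' : State, s'.reg 6 = B → ev.eval s' = v)
    (hconn : CodeConn Q h v (s.reg 7)) (hz : ∀ a, 0 ≤ a → arr s vis a = 0)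
    (hnx : ∀ f ∈ dirs, ∀ x ∈ Q, arr s f x ∈ Q) (h8 : s.reg 8 = 0) :
    Runs W D Q.card (stage vis eh ev) s (StageResult Q h v (s.reg 7) (arr s)) := by
  have kS : ∀ f ∈ dirs, (search vis eh ev).touches f = false := by
    rcases hvis with rfl | rfl <;> intro f hf <;>
      (simp only [dirs, Finset.mem_insert, Finset.mem_singleton] at hf;
       rcases hf with rfl | rfl | rfl | rfl <;> rfl)
  have kC : ∀ g : Fin 32, g ≠ 18 → g ≠ 19 → g ≠ 20 → ∀ nx, (check vis nx).touches g = false := by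
    have : ∀ g : Fin 32, g ≠ 18 → g ≠ 19 → g ≠ 20 → (check 0 0).touches g = false := by decide
    exact fun g h1 h2 h3 _ => this g h1 h2 h3
  have hv18 : vis ≠ 18 ∧ vis ≠ 19 ∧ vis ≠ 20 := by rcases hvis with rfl | rfl <;> decide
  refine Runs.seq (search_runs p hs hvis hst hρ H hB heh hev hconn hz) ?_
  intro s₁ hs₁ hf₁ T
  have step : ∀ {s₂ : State} {nx : Fin 32}, nx ∈ dirs → Bounded D s₂ →
      (∀ g : Fin 32, g ≠ 18 → g ≠ 19 → g ≠ 20 → arr s₂ g = arr s₁ g) → s₂.reg 0 = s.reg 0 →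
      Runs W D Q.card (check vis nx) s₂ fun s₃ =>
        (∀ g : Fin 32, g ≠ 18 → g ≠ 19 → g ≠ 20 → arr s₃ g = arr s₁ g) ∧ s₃.reg 0 = s.reg 0 ∧
        CheckResult Q (arr s₁ vis) (arr s₁ 23) (arr s₁ 24) (arr s nx) s₂ s₃ 0 := by
    intro s₂ nx hnx' hs₂ ha h0
    have e17 := ha 17 (by decide) (by decide) (by decide)
    have e23 := ha 23 (by decide) (by decide) (by decide)
    have e24 := ha 24 (by decide) (by decide) (by decide)
    have ev := ha vis hv18.1 hv18.2.1 hv18.2.2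
    have en : arr s₂ nx = arr s nx := by
      rw [← hf₁.arr nx (kS nx hnx')]
      refine ha nx ?_ ?_ ?_ <;> rintro rfl <;> revert hnx' <;> decide
    have := check_runs (nx := nx) p hs₂ hvis (by simpa [dirs] using hnx') (h0.trans H.card)
      (T := by rw [e17, e23, e24, ev]; exact T)
    rw [ev, e23, e24, en] at this
    refine Runs.mono this fun s₃ _ hf h3 => ⟨fun g h4 h5 h6 => ?_, ?_, h3⟩
    · rw [hf.arr g (kC g h4 h5 h6 nx), ha g h4 h5 h6]
    · rw [hf.reg 0 rfl, h0]
  have hv : ∀ c ∈ Q, 0 < arr s₁ vis c := fun c hc => by have := T.vis_range c hc; omega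
  have h8' : s₁.reg 8 = 0 := by rw [hf₁.reg 8 rfl, h8]
  refine Runs.seq (step (by decide) hs₁ (fun _ _ _ _ => rfl) (hf₁.reg 0 rfl)) ?_
  rintro s₂ hs₂ - ⟨ha₂, h0₂, R₂⟩
  refine Runs.seq (step (by decide) hs₂ ha₂ h0₂) ?_
  rintro s₃ hs₃ - ⟨ha₃, h0₃, R₃⟩
  refine Runs.seq (step (by decide) hs₃ ha₃ h0₃) ?_
  rintro s₄ hs₄ - ⟨ha₄, h0₄, R₄⟩
  refine Runs.mono (step (by decide) hs₄ ha₄ h0₄) ?_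
  rintro s₅ hs₅ - ⟨ha₅, h0₅, R₅⟩
  have key := R₅.checked (nx := arr s) (by decide) hv (R₄.checked (nx := arr s) (by decide) hv
    (R₃.checked (nx := arr s) (by decide) hv (R₂.checked (nx := arr s) (F := ∅) (by decide) hv
      (Or.inl ⟨h8', by simp⟩))))
  rcases key with ⟨h1, hno⟩ | ⟨f, hf, h1, h2, h3, h4⟩
  · left
    refine ⟨h1, fun S hS hne hρS f hf hcl => ?_⟩
    obtain ⟨c, hcS, hvt, hpQ, hpS⟩ := T.exists_entry hS hne hρS
    have hdirs : ∀ f ∈ dirs, f ∈ insert 12 (insert 11 (insert 10 (insert 9 (∅ : Finset _)))) := by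
      decide
    exact hno f (hdirs f hf) c (hS.subset c hcS) hvt
      ((T.closed_iff hS hcS hpQ hpS _ (hnx f hf)).2 hcl)
  · right
    rcases T.parent _ h1 with ⟨-, -, h5, -⟩ | ⟨h5, h6, ⟨h7, -⟩ | ⟨-, h7⟩⟩
    · omega
    · omega
    refine ⟨h1, h3 ▸ h5, h3 ▸ h7, f, hf, fun S hS hc hp => ?_⟩
    exact (T.closed_iff hS hc h5 (h3 ▸ hp) _ (hnx f hf)).1 h4

end RAM

/-! ### Next tiles in a column -/

/-- `u` is the next tile of `A` below `t` in its column, or `t` itself if there is none. -/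
def IsNext {α : Type*} (cross key : α → ℤ) (A : Finset α) (t u : α) : Prop :=
  u ∈ A ∧ ((u = t ∧ ∀ w ∈ A, cross w = cross t → key t ≤ key w) ∨
    (cross u = cross t ∧ key u < key t ∧ ∀ w ∈ A, cross w = cross t → key w < key t → key w ≤ key u))

/-- The tables after the tiles in `A` have been linked. -/
structure LinkInv {α : Type*} [DecidableEq α] (P : Finset α) (code cross key : α → ℤ)
    (dn up last : ℤ → ℤ) (A : Finset α) : Prop where
  subset : A ⊆ P
  last_spec : ∀ x, 0 ≤ x → (last x = 0 ∧ ∀ u ∈ A, cross u ≠ x) ∨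
    ∃ t ∈ A, cross t = x ∧ last x = code t ∧ ∀ u ∈ A, cross u = x → key u ≤ key t
  dn_spec : ∀ t ∈ A, ∃ u, IsNext cross key A t u ∧ dn (code t) = code u
  up_spec : ∀ t ∈ A, ∃ u, IsNext cross (fun x => -key x) A t u ∧ up (code t) = code u
  fresh : ∀ t ∈ P, t ∉ A → dn (code t) = code t ∧ up (code t) = code t

namespace LinkInv

variable {α : Type*} [DecidableEq α] {P : Finset α} {code cross key : α → ℤ}
  {dn up last : ℤ → ℤ} {A : Finset α}

/-- Tiles arrive in increasing order of `key`. So the last tile seen in the column is the next one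
below the new tile, which in turn becomes the next one above it; no other link changes. -/
theorem step (I : LinkInv P code cross key dn up last A)
    (hcode : ∀ t ∈ P, ∀ u ∈ P, code t = code u → t = u) (hpos : ∀ t ∈ P, 0 < code t)
    (hcross : ∀ t ∈ P, 0 ≤ cross t)
    (hck : ∀ t ∈ P, ∀ u ∈ P, cross t = cross u → key t = key u → t = u)
    {t : α} (ht : t ∈ P) (htA : t ∉ A) (hmax : ∀ u ∈ A, key u ≤ key t) :
    LinkInv P code cross key
      (if 0 < last (cross t) then Function.update dn (code t) (last (cross t)) else dn)
      (if 0 < last (cross t) then Function.update up (last (cross t)) (code t) else up)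
      (Function.update last (cross t) (code t)) (insert t A) := by
  have hAP := I.subset
  have hlt : ∀ u ∈ A, cross u = cross t → key u < key t := by
    intro u hu hc
    refine lt_of_le_of_ne (hmax u hu) fun h => htA ?_
    rw [← hck u (hAP hu) t ht hc h]; exact hu
  have hcne : ∀ u ∈ P, u ≠ t → code u ≠ code t := fun u hu hne h => hne (hcode u hu t ht h)
  -- the next tile below does not change
  have keepDn : ∀ u ∈ A, ∀ w, IsNext cross key A u w → IsNext cross key (insert t A) u w := by
    rintro u hu w ⟨hw, h⟩
    refine ⟨Finset.mem_insert_of_mem hw, ?_⟩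
    rcases h with ⟨h1, h2⟩ | ⟨h1, h2, h3⟩
    · refine Or.inl ⟨h1, fun z hz hc => ?_⟩
      rcases Finset.mem_insert.1 hz with rfl | hz
      · exact hmax u hu
      · exact h2 z hz hc
    · refine Or.inr ⟨h1, h2, fun z hz hc hk => ?_⟩
      rcases Finset.mem_insert.1 hz with rfl | hz
      · have := hmax u hu; omega
      · exact h3 z hz hc hk
  have selfUp : IsNext cross (fun x => -key x) (insert t A) t t := by
    refine ⟨Finset.mem_insert_self _ _, Or.inl ⟨rfl, fun z hz hc => ?_⟩⟩
    rcases Finset.mem_insert.1 hz with rfl | hz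
    · exact le_rfl
    · have := hmax z hz; simp only; omega
  have hlast : ∀ x, 0 ≤ x →
      (Function.update last (cross t) (code t) x = 0 ∧ ∀ u ∈ insert t A, cross u ≠ x) ∨
      ∃ u ∈ insert t A, cross u = x ∧ Function.update last (cross t) (code t) x = code u ∧
        ∀ w ∈ insert t A, cross w = x → key w ≤ key u := by
    intro x hx
    by_cases hxt : x = cross t
    · subst hxt
      refine Or.inr ⟨t, Finset.mem_insert_self _ _, rfl, Function.update_self .., fun w hw _ => ?_⟩
      rcases Finset.mem_insert.1 hw with rfl | hw
      · exact le_rfl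
      · exact hmax w hw
    · rw [Function.update_of_ne hxt]
      rcases I.last_spec x hx with ⟨h1, h2⟩ | ⟨u, hu, h1, h2, h3⟩
      · refine Or.inl ⟨h1, fun u hu => ?_⟩
        rcases Finset.mem_insert.1 hu with rfl | hu
        · exact Ne.symm hxt
        · exact h2 u hu
      · refine Or.inr ⟨u, Finset.mem_insert_of_mem hu, h1, h2, fun w hw hc => ?_⟩
        rcases Finset.mem_insert.1 hw with rfl | hw
        · exact absurd hc.symm hxt
        · exact h3 w hw hc
  have keepUp : ∀ u ∈ A, cross u ≠ cross t → ∀ w, IsNext cross (fun x => -key x) A u w →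
      IsNext cross (fun x => -key x) (insert t A) u w := by
    rintro u hu hne w ⟨hw, h⟩
    refine ⟨Finset.mem_insert_of_mem hw, ?_⟩
    rcases h with ⟨h1, h2⟩ | ⟨h1, h2, h3⟩
    · refine Or.inl ⟨h1, fun z hz hc => ?_⟩
      rcases Finset.mem_insert.1 hz with rfl | hz
      · exact absurd hc.symm hne
      · exact h2 z hz hc
    · refine Or.inr ⟨h1, h2, fun z hz hc hk => ?_⟩
      rcases Finset.mem_insert.1 hz with rfl | hz
      · exact absurd hc.symm hne
      · exact h3 z hz hc hk
  refine ⟨Finset.insert_subset ht hAP, hlast, ?_, ?_, ?_⟩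
  · intro u hu
    rcases I.last_spec _ (hcross t ht) with ⟨h1, h2⟩ | ⟨q, hq, h1, h2, h3⟩
    · rw [if_neg (by omega)]
      rcases Finset.mem_insert.1 hu with rfl | hu
      · refine ⟨u, ⟨Finset.mem_insert_self _ _, Or.inl ⟨rfl, fun z hz hc => ?_⟩⟩,
          (I.fresh u ht htA).1⟩
        rcases Finset.mem_insert.1 hz with rfl | hz
        · exact le_rfl
        · exact absurd hc (h2 z hz)
      · obtain ⟨w, hw, he⟩ := I.dn_spec u hu
        exact ⟨w, keepDn u hu w hw, he⟩
    · rw [if_pos (by rw [h2]; exact hpos q (hAP hq)), h2]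
      rcases Finset.mem_insert.1 hu with rfl | hu
      · refine ⟨q, ⟨Finset.mem_insert_of_mem hq, Or.inr ⟨h1, hlt q hq h1, fun z hz hc hk => ?_⟩⟩,
          Function.update_self ..⟩
        rcases Finset.mem_insert.1 hz with rfl | hz
        · exact absurd hk (lt_irrefl _)
        · exact h3 z hz hc
      · obtain ⟨w, hw, he⟩ := I.dn_spec u hu
        refine ⟨w, keepDn u hu w hw, ?_⟩
        rw [Function.update_of_ne (hcne u (hAP hu) fun h => htA (h ▸ hu)), he]
  · intro u hu
    rcases I.last_spec _ (hcross t ht) with ⟨h1, h2⟩ | ⟨q, hq, h1, h2, h3⟩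
    · rw [if_neg (by omega)]
      rcases Finset.mem_insert.1 hu with rfl | hu
      · exact ⟨u, selfUp, (I.fresh u ht htA).2⟩
      · obtain ⟨w, hw, he⟩ := I.up_spec u hu
        exact ⟨w, keepUp u hu (h2 u hu) w hw, he⟩
    · rw [if_pos (by rw [h2]; exact hpos q (hAP hq)), h2]
      by_cases huq : u = q
      · subst huq
        refine ⟨t, ⟨Finset.mem_insert_self _ _, Or.inr ⟨h1.symm, ?_, fun z hz hc hk => ?_⟩⟩,
          Function.update_self ..⟩
        · have := hlt u hq h1; simp only; omega
        · rcases Finset.mem_insert.1 hz with rfl | hz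
          · exact le_rfl
          · have := h3 z hz (hc.trans h1); simp only at hk; omega
      · rcases Finset.mem_insert.1 hu with rfl | hu
        · rw [Function.update_of_ne fun h => huq (hcode _ ht _ (hAP hq) h)]
          exact ⟨u, selfUp, (I.fresh u ht htA).2⟩
        · rw [Function.update_of_ne fun h => huq (hcode _ (hAP hu) _ (hAP hq) h)]
          obtain ⟨w, hw, he⟩ := I.up_spec u hu
          refine ⟨w, ?_, he⟩
          by_cases hc : cross u = cross t
          · have hk : key u < key q := by
              refine lt_of_le_of_ne (h3 u hu hc) fun h => huq ?_
              exact hck u (hAP hu) q (hAP hq) (hc.trans h1.symm) h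
            obtain ⟨hwA, h4 | ⟨h4, h5, h6⟩⟩ := hw
            · have := h4.2 q hq (h1.trans hc.symm); simp only at this; omega
            · refine ⟨Finset.mem_insert_of_mem hwA, Or.inr ⟨h4, h5, fun z hz hcz hkz => ?_⟩⟩
              rcases Finset.mem_insert.1 hz with rfl | hz
              · have := hmax w hwA; simp only; omega
              · exact h6 z hz hcz hkz
          · exact keepUp u hu hc w hw
  · intro u hu huA
    have h1 : u ≠ t := by rintro rfl; exact huA (Finset.mem_insert_self _ _)
    have h2 : u ∉ A := fun h => huA (Finset.mem_insert_of_mem h)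
    obtain ⟨h3, h4⟩ := I.fresh u hu h2
    rcases I.last_spec _ (hcross t ht) with ⟨h5, -⟩ | ⟨q, hq, -, h5, -⟩
    · rw [if_neg (by omega), if_neg (by omega)]; exact ⟨h3, h4⟩
    · have h6 : 0 < last (cross t) := by rw [h5]; exact hpos q (hAP hq)
      rw [if_pos h6, if_pos h6, Function.update_of_ne (hcne u hu h1), Function.update_of_ne]
      · exact ⟨h3, h4⟩
      · rw [h5]
        exact fun h => h2 (by rw [hcode u hu q (hAP hq) h]; exact hq)

end LinkInv

/-- A set of tiles closed under the next tile below contains everything below its tiles. -/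
theorem closed_next_iff {α : Type*} {cross key : α → ℤ} {P : Finset α} {S : Set α}
    (hS : ∀ t ∈ S, t ∈ P)
    (hck : ∀ t ∈ P, ∀ u ∈ P, cross t = cross u → key t = key u → t = u) {nx : α → α}
    (hnx : ∀ t ∈ P, IsNext cross key P t (nx t)) :
    (∀ t ∈ S, nx t ∈ S) ↔
      ∀ t ∈ S, ∀ u ∈ P, cross u = cross t → key u < key t → u ∈ S := by
  constructor
  · intro H
    have main : ∀ n : ℕ, ∀ t ∈ S, ∀ u ∈ P, cross u = cross t → key u < key t →
        key t - key u ≤ n → u ∈ S := by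
      intro n
      induction n with
      | zero => intros; omega
      | succ n ih =>
        intro t ht u hu hc hk hn
        have h1 := H t ht
        obtain ⟨-, ⟨-, h2⟩ | ⟨h2, h3, h4⟩⟩ := hnx t (hS t ht)
        · have := h2 u hu hc; omega
        · have h5 := h4 u hu hc hk
          rcases h5.lt_or_eq with h6 | h6
          · exact ih _ h1 u hu (hc.trans h2.symm) h6 (by push_cast at hn; omega)
          · rw [hck u hu _ (hS _ h1) (hc.trans h2.symm) h6]; exact h1
    exact fun t ht u hu hc hk => main _ t ht u hu hc hk (Int.toNat_of_nonneg (by omega)).ge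
  · intro H t ht
    obtain ⟨h1, ⟨h2, -⟩ | ⟨h2, h3, -⟩⟩ := hnx t (hS t ht)
    · rw [h2]; exact ht
    · exact H t ht _ h1 h2 h3

/-- The list `l` is stored as a linked list with head `a` and links `nxt`. -/
def Linked (nxt : ℤ → ℤ) : ℤ → List ℤ → Prop
  | a, [] => a = 0
  | a, b :: l => a = b ∧ Linked nxt (nxt b) l

theorem Linked.update {nxt : ℤ → ℤ} {c x : ℤ} : ∀ {l : List ℤ} {a : ℤ}, Linked nxt a l → c ∉ l →
    Linked (Function.update nxt c x) a l
  | [], _, h, _ => h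
  | b :: l, a, h, hc => by
    simp only [List.mem_cons, not_or] at hc
    refine ⟨h.1, ?_⟩
    rw [Function.update_of_ne (Ne.symm hc.1)]
    exact h.2.update hc.2

/-- The tiles of `A`, sorted into linked lists by their key. -/
def Buckets {α : Type*} (code key : α → ℤ) (nxt head : ℤ → ℤ) (A : Finset α) : Prop :=
  ∀ y, 0 ≤ y → ∃ l : List α, Linked nxt (head y) (l.map code) ∧ l.Nodup ∧
    ∀ t, t ∈ l ↔ t ∈ A ∧ key t = y

/-- The tile is put in front of its list. The only link overwritten is its own, which occurs in no
list yet. -/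
theorem Buckets.insert {α : Type*} [DecidableEq α] {code key : α → ℤ} {nxt head : ℤ → ℤ}
    {A : Finset α} (h : Buckets code key nxt head A) {t : α} (htA : t ∉ A)
    (hcode : ∀ u ∈ A, code u ≠ code t) :
    Buckets code key (Function.update nxt (code t) (head (key t)))
      (Function.update head (key t) (code t)) (insert t A) := by
  intro y hy
  obtain ⟨l, h1, h2, h3⟩ := h y hy
  have hl : code t ∉ l.map code := by
    rw [List.mem_map]
    rintro ⟨u, hu, he⟩
    exact hcode u ((h3 u).1 hu).1 he
  by_cases hyt : y = key t
  · subst hyt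
    refine ⟨t :: l, ⟨Function.update_self .., ?_⟩, ?_, fun u => ?_⟩
    · rw [Function.update_self]
      exact h1.update hl
    · exact List.nodup_cons.2 ⟨fun hm => htA ((h3 t).1 hm).1, h2⟩
    · rw [List.mem_cons, h3, Finset.mem_insert]
      constructor
      · rintro (rfl | h)
        · exact ⟨Or.inl rfl, rfl⟩
        · exact ⟨Or.inr h.1, h.2⟩
      · rintro ⟨h | h, hk⟩
        · exact Or.inl h
        · exact Or.inr ⟨h, hk⟩
  · refine ⟨l, ?_, h2, fun u => ?_⟩
    · rw [Function.update_of_ne hyt]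
      exact h1.update hl
    · rw [h3, Finset.mem_insert]
      constructor
      · exact fun h => ⟨Or.inr h.1, h.2⟩
      · rintro ⟨rfl | h, hk⟩
        · exact absurd hk.symm hyt
        · exact ⟨h, hk⟩

/-- The number under which the tile `t` is stored. -/
def tileCode (xm ym B : ℤ) (t : ℤ × ℤ) : ℤ := (t.1 - xm + 1) * B + (t.2 - ym + 1)

/-- The normalized second coordinate ranges over 0, ..., N + 1. The margin of one row on each side
keeps a neighbor across the border from sharing its code with a tile of another column. -/
theorem tileCode_inj {xm ym N : ℤ} {t u : ℤ × ℤ} (ht : ym - 1 ≤ t.2 ∧ t.2 ≤ ym + N)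
    (hu : ym - 1 ≤ u.2 ∧ u.2 ≤ ym + N) (h : tileCode xm ym (N + 2) t = tileCode xm ym (N + 2) u) :
    t = u := by
  unfold tileCode at h
  have h1 : t.1 = u.1 := by
    rcases lt_trichotomy t.1 u.1 with hlt | heq | hlt
    · nlinarith
    · exact heq
    · nlinarith
  rw [h1] at h
  exact Prod.ext h1 (by linarith)

/-! ### Reading the input and filling the tables. -/

namespace RAM

/-- With negative indices included, the 32 arrays cover every address. -/
theorem mem_eq_of_arr {s s' : State} (h : ∀ f, arr s' f = arr s f) : s'.mem = s.mem := by
  funext z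
  have hf : ((-z - 1) % 32).toNat < 32 := by omega
  have := congrFun (h ⟨_, hf⟩) ((-z - 1) / 32)
  simp only [arr] at this
  rwa [show -((((-z - 1) % 32).toNat : ℕ) : ℤ) - 1 - 32 * ((-z - 1) / 32) = z by omega] at this

theorem arr_input (L : List (ℤ × ℤ)) (f : Fin 32) {a : ℤ} (ha : 0 ≤ a) : arr (input L) f a = 0 := by
  simp only [arr, input]
  rw [if_pos (by omega)]

theorem mem_input (L : List (ℤ × ℤ)) {k : ℤ} (hk : 0 ≤ k) :
    (input L).mem (2 * k) = (L.getD k.toNat (0, 0)).1 ∧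
    (input L).mem (2 * k + 1) = (L.getD k.toNat (0, 0)).2 := by
  simp only [input]
  constructor
  · rw [if_neg (by omega), if_pos (by omega)]
    congr; omega
  · rw [if_neg (by omega), if_neg (by omega)]
    congr; omega

theorem mem_iff_getD (L : List (ℤ × ℤ)) (t : ℤ × ℤ) :
    t ∈ L ↔ ∃ k : ℤ, 0 ≤ k ∧ k < L.length ∧ L.getD k.toNat (0, 0) = t := by
  rw [List.mem_iff_getElem]
  constructor
  · rintro ⟨i, hi, rfl⟩
    exact ⟨i, by omega, by omega, by simp [hi]⟩
  · rintro ⟨k, h0, h1, rfl⟩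
    refine ⟨k.toNat, by omega, ?_⟩
    rw [List.getD_eq_getElem _ _ (by omega)]

theorem scan_runs {W D : ℕ} {L : List (ℤ × ℤ)} (p : Params W D L.length)
    (hb : Bounded D (input L)) :
    Runs W D L.length scan (input L) fun s => s.mem = (input L).mem ∧ s.reg 0 = L.length ∧
      (∀ t ∈ L, s.reg 2 ≤ t.1 ∧ s.reg 3 ≤ t.2) ∧ (∃ t ∈ L, t.1 = s.reg 2) ∧
      ∃ t ∈ L, t.2 = s.reg 3 := by
  have hN := p.pos
  have hD := p.card_le
  have hbm := hb.2
  have h0 := mem_input L le_rfl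
  have ht0 : L.getD (0 : ℤ).toNat (0, 0) ∈ L := (mem_iff_getD L _).2 ⟨0, le_rfl, by omega, rfl⟩
  refine Runs.seq (Q := fun s => s.mem = (input L).mem ∧ s.reg 0 = L.length ∧ s.reg 1 = 0 ∧
    s.reg 2 = (L.getD (0 : ℤ).toNat (0, 0)).1 ∧ s.reg 3 = (L.getD (0 : ℤ).toNat (0, 0)).2)
    (Runs.of_run p hb rfl ?_ ?_) ?_
  · simp; exact ⟨hbm 0, hbm 1⟩
  · refine ⟨by simp, by simp [input], by simp, ?_, ?_⟩
    · rw [← h0.1]; simp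
    · rw [← h0.2]; simp
  rintro s₁ hs₁ - ⟨hm₁, hr₁, h1, h2, h3⟩
  refine Runs.mono (Runs.loop p rfl (fun s => 0 ≤ s.reg 1 ∧ s.reg 1 ≤ L.length ∧
    (∀ k, 0 ≤ k → k < s.reg 1 → s.reg 2 ≤ (L.getD k.toNat (0, 0)).1 ∧
      s.reg 3 ≤ (L.getD k.toNat (0, 0)).2) ∧
    (∃ t ∈ L, t.1 = s.reg 2) ∧ ∃ t ∈ L, t.2 = s.reg 3) (fun s => L.length - s.reg 1)
    hs₁ ⟨by omega, by omega, by intros; omega, ⟨_, ht0, h2.symm⟩, ⟨_, ht0, h3.symm⟩⟩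
    (by omega) ?_) ?_
  · rintro s hs hf ⟨h4, h5, h6, h7, h8⟩ hg
    have hr : s.reg 0 = L.length := (hf.reg 0 rfl).trans hr₁
    have hm : s.mem = (input L).mem := by
      rw [← hm₁]; exact mem_eq_of_arr fun f => hf.arr f (by revert f; decide)
    simp only [eval_hsub, eval_reg, hr] at hg
    obtain ⟨e1, e2⟩ := mem_input L h4
    have htL : L.getD (s.reg 1).toNat (0, 0) ∈ L :=
      (mem_iff_getD L _).2 ⟨s.reg 1, h4, by omega, rfl⟩
    set t := L.getD (s.reg 1).toNat (0, 0) with ht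
    have b1 : |t.1| ≤ (D : ℤ) := by rw [← e1]; exact hbm _
    have b2 : |t.2| ≤ (D : ℤ) := by rw [← e2]; exact hbm _
    have b3 : |s.reg 1 + 1| ≤ (D : ℤ) := by rw [abs_le]; omega
    have hk : ∀ k, 0 ≤ k → k < s.reg 1 + 1 → k < s.reg 1 ∨ L.getD k.toNat (0, 0) = t := by
      intro k _ hk
      rcases (show k ≤ s.reg 1 by omega).lt_or_eq with h | h
      · exact Or.inl h
      · right; rw [h]
    have r1 : ∀ k, 0 ≤ k → k < s.reg 1 + 1 → min (s.reg 2) t.1 ≤ (L.getD k.toNat (0, 0)).1 ∧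
        min (s.reg 3) t.2 ≤ (L.getD k.toNat (0, 0)).2 := by
      intro k hk0 hk1
      rcases hk k hk0 hk1 with h | h
      · exact ⟨(min_le_left _ _).trans (h6 k hk0 h).1, (min_le_left _ _).trans (h6 k hk0 h).2⟩
      · rw [h]; exact ⟨min_le_right _ _, min_le_right _ _⟩
    have q2 : (scanBody.run s).reg 2 = min (s.reg 2) t.1 := by
      by_cases hx : t.1 < s.reg 2 <;> by_cases hy : t.2 < s.reg 3 <;>
        simp [scanBody, hm, e1, e2, hx, hy] <;> omega
    have q3 : (scanBody.run s).reg 3 = min (s.reg 3) t.2 := by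
      by_cases hx : t.1 < s.reg 2 <;> by_cases hy : t.2 < s.reg 3 <;>
        simp [scanBody, hm, e1, e2, hx, hy] <;> omega
    have q1 : (scanBody.run s).reg 1 = s.reg 1 + 1 := by
      by_cases hx : t.1 < s.reg 2 <;> by_cases hy : t.2 < s.reg 3 <;>
        simp [scanBody, hm, e1, e2, hx, hy]
    refine ⟨?_, ⟨by omega, by omega, ?_, ?_, ?_⟩, by omega, by omega⟩
    · by_cases hx : t.1 < s.reg 2 <;> by_cases hy : t.2 < s.reg 3 <;>
        simp [scanBody, hm, e1, e2, hx, hy, b1, b2, b3]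
    · rw [q1, q2, q3]; exact r1
    · rw [q2]
      rcases min_choice (s.reg 2) t.1 with h | h
      · rw [h]; exact h7
      · exact ⟨t, htL, h.symm⟩
    · rw [q3]
      rcases min_choice (s.reg 3) t.2 with h | h
      · rw [h]; exact h8
      · exact ⟨t, htL, h.symm⟩
  · rintro s - hf ⟨⟨h4, h5, h6, h7, h8⟩, hg⟩
    have hr : s.reg 0 = L.length := (hf.reg 0 rfl).trans hr₁
    simp only [eval_hsub, eval_reg, hr] at hg
    refine ⟨?_, hr, fun t ht => ?_, h7, h8⟩
    · rw [← hm₁]; exact mem_eq_of_arr fun f => hf.arr f (by revert f; decide)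
    · obtain ⟨k, hk0, hk1, rfl⟩ := (mem_iff_getD L t).1 ht
      exact h6 k hk0 (by omega)

/-- The tables after the tiles in `A` have been read. -/
structure FillInv (xm ym B : ℤ) (A : Finset (ℤ × ℤ)) (s : State) : Prop where
  mem : ∀ c, 0 ≤ c → arr s 0 c = if c ∈ A.image (tileCode xm ym B) then 1 else 0
  fst : ∀ t ∈ A, arr s 1 (tileCode xm ym B t) = t.1 - xm + 1
  snd : ∀ t ∈ A, arr s 2 (tileCode xm ym B t) = t.2 - ym + 1
  self : ∀ f ∈ dirs, ∀ t ∈ A, arr s f (tileCode xm ym B t) = tileCode xm ym B t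
  rows : Buckets (tileCode xm ym B) (fun t => t.2 - ym + 1) (arr s 3) (arr s 4) A
  cols : Buckets (tileCode xm ym B) (fun t => t.1 - xm + 1) (arr s 5) (arr s 6) A
  root : A.Nonempty → s.reg 7 ∈ A.image (tileCode xm ym B)

theorem Finset.take_succ_image {T : ℤ → ℤ × ℤ} {i : ℤ} (hi : 0 ≤ i) :
    (Finset.Ico 0 (i + 1)).image T = insert (T i) ((Finset.Ico 0 i).image T) := by
  rw [← Finset.image_insert]
  congr 1
  ext k
  simp only [Finset.mem_Ico, Finset.mem_insert]
  omega

/-- All writes go to negative addresses, so the input is still intact in later rounds. As `L` has no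
duplicates, each tile read is new to the buckets. -/
theorem fill_runs {W D : ℕ} {L : List (ℤ × ℤ)} (p : Params W D L.length) (hL : L.Nodup)
    {s : State} (hs : Bounded D s) (hm : s.mem = (input L).mem) (hr : s.reg 0 = L.length)
    (hbox : ∀ t ∈ L, s.reg 2 ≤ t.1 ∧ t.1 < s.reg 2 + L.length ∧
      s.reg 3 ≤ t.2 ∧ t.2 < s.reg 3 + L.length)
    (hD : (L.length + 2) * (L.length + 2) ≤ D) :
    Runs W D L.length fill s fun s' => s'.reg 6 = L.length + 2 ∧
      FillInv (s.reg 2) (s.reg 3) (L.length + 2) L.toFinset s' := by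
  have hN := p.pos
  have hDN := p.card_le
  set N : ℤ := (L.length : ℤ) with hNdef
  set xm := s.reg 2
  set ym := s.reg 3
  set T : ℤ → ℤ × ℤ := fun k => L.getD k.toNat (0, 0) with hT
  have hTmem : ∀ k, 0 ≤ k → k < N → T k ∈ L := fun k h0 h1 => (mem_iff_getD L _).2 ⟨k, h0, h1, rfl⟩
  have hTinj : ∀ i j, 0 ≤ i → i < N → 0 ≤ j → j < N → T i = T j → i = j := by
    intro i j hi0 hi1 hj0 hj1 h
    simp only [hT] at h
    rw [List.getD_eq_getElem _ _ (by omega), List.getD_eq_getElem _ _ (by omega)] at h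
    have := (List.Nodup.getElem_inj_iff hL).1 h
    omega
  have hinj : ∀ t ∈ L, ∀ u ∈ L, tileCode xm ym (N + 2) t = tileCode xm ym (N + 2) u → t = u :=
    fun t ht u hu h => tileCode_inj (by have := hbox t ht; omega) (by have := hbox u hu; omega) h
  refine Runs.seq (Q := fun s' => s'.mem = (input L).mem ∧ s'.reg 0 = N ∧ s'.reg 1 = 0 ∧
    s'.reg 2 = xm ∧ s'.reg 3 = ym ∧ s'.reg 6 = N + 2) (Runs.of_run p hs rfl ?_ ?_) ?_
  · simp [hr]
    rw [abs_le]; omega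
  · simp [hr, hm, xm, ym]
  rintro s₁ hs₁ - ⟨hm₁, hr₁, h1, h2, h3, h6⟩
  refine Runs.mono (Runs.loop p rfl (fun s' => 0 ≤ s'.reg 1 ∧ s'.reg 1 ≤ N ∧
    (∀ z, 0 ≤ z → s'.mem z = (input L).mem z) ∧
    FillInv xm ym (N + 2) ((Finset.Ico 0 (s'.reg 1)).image T) s') (fun s' => N - s'.reg 1)
    hs₁ ⟨by omega, by omega, fun z _ => by rw [hm₁], ?_⟩ (by omega) ?_) ?_
  · have h0 : ∀ f c, 0 ≤ c → arr s₁ f c = 0 := by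
      intro f c hc
      rw [← arr_input L f hc]
      simp only [arr, hm₁]
    rw [h1]
    refine ⟨fun c hc => by simp [h0 0 c hc], by simp, by simp, by simp, ?_, ?_, by simp⟩
    · exact fun y hy => ⟨[], h0 4 y hy, List.nodup_nil, by simp⟩
    · exact fun y hy => ⟨[], h0 6 y hy, List.nodup_nil, by simp⟩
  · rintro s₂ hs₂ hf ⟨h4, h5, hm₂, F⟩ hg
    have r0 : s₂.reg 0 = N := (hf.reg 0 rfl).trans hr₁
    have r2 : s₂.reg 2 = xm := (hf.reg 2 rfl).trans h2
    have r3 : s₂.reg 3 = ym := (hf.reg 3 rfl).trans h3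
    have r6 : s₂.reg 6 = N + 2 := (hf.reg 6 rfl).trans h6
    simp only [eval_hsub, eval_reg, r0] at hg
    set i := s₂.reg 1
    obtain ⟨e1, e2⟩ := mem_input L h4
    rw [← hm₂ _ (by omega)] at e1 e2
    change s₂.mem (2 * i) = (T i).1 at e1
    change s₂.mem (2 * i + 1) = (T i).2 at e2
    have htL := hTmem i h4 (by omega)
    have hbt := hbox _ htL
    have htA : T i ∉ (Finset.Ico 0 i).image T := by
      simp only [Finset.mem_image, Finset.mem_Ico, not_exists, not_and]
      intro k hk he
      have := hTinj k i hk.1 (by omega) h4 (by omega) he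
      omega
    have hAL : ∀ u ∈ (Finset.Ico 0 i).image T, u ∈ L := by
      simp only [Finset.mem_image, Finset.mem_Ico]
      rintro u ⟨k, hk, rfl⟩
      exact hTmem k hk.1 (by omega)
    set t := T i with ht
    set x := t.1 - xm + 1 with hx
    set y := t.2 - ym + 1 with hy
    have hxr : 1 ≤ x ∧ x ≤ N := by omega
    have hyr : 1 ≤ y ∧ y ≤ N := by omega
    have hcode : tileCode xm ym (N + 2) t = x * (N + 2) + y := rfl
    set c := x * (N + 2) + y with hc
    have hc0 : 0 ≤ c ∧ c ≤ D := by
      have hD' : (N + 2) * (N + 2) ≤ (D : ℤ) := by rw [hNdef]; exact_mod_cast hD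
      constructor <;> nlinarith
    have hcne : ∀ u ∈ (Finset.Ico 0 i).image T, tileCode xm ym (N + 2) u ≠ c :=
      fun u hu h => htA (by rw [← hinj u (hAL u hu) t htL h]; exact hu)
    have bl : |s₂.reg 1 + 1| ≤ (D : ℤ) := by rw [abs_le]; omega
    have bx : |x| ≤ (D : ℤ) := by rw [abs_le]; omega
    have by' : |y| ≤ (D : ℤ) := by rw [abs_le]; omega
    have bc : |c| ≤ (D : ℤ) := by rw [abs_le]; omega
    have b4 := hs₂.arr 4 y
    have b6 := hs₂.arr 6 x
    have run1 : (fillBody.run s₂).reg 1 = i + 1 := by simp [fillBody, i]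
    refine ⟨?_, ⟨by omega, by omega, ?_, ?_⟩, by omega, by omega⟩
    · simp [fillBody, e1, e2, r2, r3, r6, ← hx, ← hy, ← hc, i, bx, by', bc, b4, b6, bl,
        show 1 ≤ D by omega]
    · intro z hz
      rw [← hm₂ z hz]
      simp [fillBody, e1, e2, r2, r3, r6, ← hx, ← hy, ← hc, i, mem_setArr_of_nonneg, hz, hc0,
        show 0 ≤ x by omega, show 0 ≤ y by omega]
    · rw [run1, Finset.take_succ_image h4]
      have U : ∀ (g : ℤ → ℤ) (w u : ℤ × ℤ → ℤ), (∀ u' ∈ (Finset.Ico 0 i).image T,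
          g (tileCode xm ym (N + 2) u') = w u') → ∀ u' ∈ insert t ((Finset.Ico 0 i).image T),
          Function.update g c (w t) (tileCode xm ym (N + 2) u') = w u' := by
        intro g w _ hgw u' hu'
        rcases Finset.mem_insert.1 hu' with rfl | hu'
        · rw [hcode, Function.update_self]
        · rw [Function.update_of_ne (hcne u' hu'), hgw u' hu']
      constructor
      · intro d hd
        have : arr (fillBody.run s₂) 0 = Function.update (arr s₂ 0) c 1 := by
          simp [fillBody, e1, e2, r2, r3, r6, ← hx, ← hy, ← hc, i]
        rw [this, Finset.image_insert, hcode]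
        by_cases hdc : d = c
        · subst hdc; simp
        · rw [Function.update_of_ne hdc, F.mem d hd]
          simp only [Finset.mem_insert, hdc, false_or]
      · have : arr (fillBody.run s₂) 1 = Function.update (arr s₂ 1) c x := by
          simp [fillBody, e1, e2, r2, r3, r6, ← hx, ← hy, ← hc, i]
        rw [this]
        exact U (arr s₂ 1) (fun t => t.1 - xm + 1) (fun _ => 0) F.fst
      · have : arr (fillBody.run s₂) 2 = Function.update (arr s₂ 2) c y := by
          simp [fillBody, e1, e2, r2, r3, r6, ← hx, ← hy, ← hc, i]
        rw [this]
        exact U (arr s₂ 2) (fun t => t.2 - ym + 1) (fun _ => 0) F.snd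
      · intro f hf
        have : arr (fillBody.run s₂) f = Function.update (arr s₂ f) c c := by
          have hf' := hf
          simp only [dirs, Finset.mem_insert, Finset.mem_singleton] at hf'
          rcases hf' with rfl | rfl | rfl | rfl <;>
            simp [fillBody, e1, e2, r2, r3, r6, ← hx, ← hy, ← hc, i]
        rw [this]
        exact U (arr s₂ f) (tileCode xm ym (N + 2)) (fun _ => 0) (F.self f hf)
      · have h3' : arr (fillBody.run s₂) 3 = Function.update (arr s₂ 3) c (arr s₂ 4 y) := by
          simp [fillBody, e1, e2, r2, r3, r6, ← hx, ← hy, ← hc, i]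
        have h4' : arr (fillBody.run s₂) 4 = Function.update (arr s₂ 4) y c := by
          simp [fillBody, e1, e2, r2, r3, r6, ← hx, ← hy, ← hc, i]
        rw [h3', h4']
        exact F.rows.insert htA hcne
      · have h3' : arr (fillBody.run s₂) 5 = Function.update (arr s₂ 5) c (arr s₂ 6 x) := by
          simp [fillBody, e1, e2, r2, r3, r6, ← hx, ← hy, ← hc, i]
        have h4' : arr (fillBody.run s₂) 6 = Function.update (arr s₂ 6) x c := by
          simp [fillBody, e1, e2, r2, r3, r6, ← hx, ← hy, ← hc, i]
        rw [h3', h4']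
        exact F.cols.insert htA hcne
      · intro _
        have : (fillBody.run s₂).reg 7 = c := by
          simp [fillBody, e1, e2, r2, r3, r6, ← hx, ← hy, ← hc, i]
        rw [this, ← hcode]
        exact Finset.mem_image_of_mem _ (Finset.mem_insert_self _ _)
  · rintro s₂ - hf ⟨⟨h4, h5, -, F⟩, hg⟩
    have r0 : s₂.reg 0 = N := (hf.reg 0 rfl).trans hr₁
    simp only [eval_hsub, eval_reg, r0] at hg
    refine ⟨(hf.reg 6 rfl).trans h6, ?_⟩
    have : (Finset.Ico 0 (s₂.reg 1)).image T = L.toFinset := by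
      ext t
      rw [List.mem_toFinset, mem_iff_getD, Finset.mem_image, show s₂.reg 1 = N by omega]
      simp only [Finset.mem_Ico, and_assoc, hT, hNdef]
    rwa [this] at F

end RAM

/-! ### Linking next tiles by a pass through the buckets. -/

namespace RAM

/-- In the invariant `l` is the rest of the current bucket, and `A` consists of the tiles of all
buckets opened so far except those in `l`. -/
theorem link_runs {W D : ℕ} {P : Finset (ℤ × ℤ)} (p : Params W D P.card)
    {code cross key : ℤ × ℤ → ℤ} {s : State} (hs : Bounded D s) {fc fn fh fl fd fu : Fin 32}
    (hf : (fc, fn, fh, fl, fd, fu) = (1, 3, 4, 7, 9, 10) ∨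
      (fc, fn, fh, fl, fd, fu) = (2, 5, 6, 8, 11, 12))
    (hr : s.reg 0 = P.card)
    (hcode : ∀ t ∈ P, ∀ u ∈ P, code t = code u → t = u) (hpos : ∀ t ∈ P, 0 < code t)
    (hcr : ∀ t ∈ P, 0 ≤ cross t) (hkey : ∀ t ∈ P, 1 ≤ key t ∧ key t ≤ P.card)
    (hck : ∀ t ∈ P, ∀ u ∈ P, cross t = cross u → key t = key u → t = u)
    (hfc : ∀ t ∈ P, arr s fc (code t) = cross t)
    (hB : Buckets code key (arr s fn) (arr s fh) P)
    (hlast : ∀ a, 0 ≤ a → arr s fl a = 0)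
    (hself : ∀ t ∈ P, arr s fd (code t) = code t ∧ arr s fu (code t) = code t) :
    Runs W D P.card (link fc fn fh fl fd fu) s fun s' => ∀ t ∈ P,
      (∃ u, IsNext cross key P t u ∧ arr s' fd (code t) = code u) ∧
      ∃ u, IsNext cross (fun x => -key x) P t u ∧ arr s' fu (code t) = code u := by
  have hN := p.pos
  have hD := p.card_le
  have hst : (link fc fn fh fl fd fu).static = true := by
    rcases hf with h | h <;> (obtain ⟨rfl, rfl, rfl, rfl, rfl, rfl⟩ := by simpa using h) <;> rfl
  simp only [link, Cmd.static, Bool.and_eq_true] at hst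
  refine Runs.seq (Q := fun s' => arr s' = arr s ∧ s'.reg 0 = P.card ∧ s'.reg 1 = 0 ∧
    s'.reg 10 = 0) (Runs.of_run p hs hst.1 (by simp) ?_) ?_
  · exact ⟨by funext f; simp, by simp [hr], by simp, by simp⟩
  rintro s₁ hs₁ - ⟨ha₁, hr₁, h1, h10⟩
  refine Runs.mono (Runs.loop_measure p
    (by simpa only [Cmd.static, Bool.and_eq_true] using hst.2)
    (fun n s' => ∃ (A : Finset (ℤ × ℤ)) (l : List (ℤ × ℤ)),
      LinkInv P code cross key (arr s' fd) (arr s' fu) (arr s' fl) A ∧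
      Linked (arr s fn) (s'.reg 10) (l.map code) ∧ l.Nodup ∧
      (∀ t ∈ l, t ∈ P ∧ key t = s'.reg 1) ∧ (∀ t ∈ P, t ∈ A ↔ key t ≤ s'.reg 1 ∧ t ∉ l) ∧
      0 ≤ s'.reg 1 ∧ s'.reg 1 ≤ P.card ∧
      -- Each round either opens a bucket or links a tile.
      (n : ℤ) = (P.card - s'.reg 1) + (P.card - A.card)) hs₁ (n := 2 * P.card) ?_ (by omega) ?_) ?_
  · refine ⟨∅, [], ⟨by simp, ?_, by simp, by simp, ?_⟩, by simpa [Linked] using h10, by simp,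
      by simp, ?_, by omega, by omega, ?_⟩
    · rw [ha₁]; exact fun x hx => Or.inl ⟨hlast x hx, by simp⟩
    · rw [ha₁]; exact fun t ht _ => hself t ht
    · intro t ht
      have := hkey t ht
      simp only [Finset.notMem_empty, List.not_mem_nil, not_false_eq_true, and_true, false_iff]
      omega
    · rw [h1]; push_cast; simp; ring
  · rintro n s₂ hs₂ hf₂ ⟨A, l, I, hl, hnd, hlP, hA, h2, h3, hn⟩ hg
    have r0 : s₂.reg 0 = P.card := by
      rw [← hr₁]; exact hf₂.reg 0 rfl
    have hfr : ∀ g : Fin 32, g ≠ fl → g ≠ fd → g ≠ fu → arr s₂ g = arr s g := by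
      intro g hg1 hg2 hg3
      rw [← ha₁]
      apply hf₂.arr g
      rcases hf with h | h <;> (obtain ⟨rfl, rfl, rfl, rfl, rfl, rfl⟩ := by simpa using h) <;>
        revert g <;> decide
    have efc : arr s₂ fc = arr s fc := by
      rcases hf with h | h <;> (obtain ⟨rfl, rfl, rfl, rfl, rfl, rfl⟩ := by simpa using h) <;>
        exact hfr _ (by decide) (by decide) (by decide)
    have efn : arr s₂ fn = arr s fn := by
      rcases hf with h | h <;> (obtain ⟨rfl, rfl, rfl, rfl, rfl, rfl⟩ := by simpa using h) <;>
        exact hfr _ (by decide) (by decide) (by decide)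
    have efh : arr s₂ fh = arr s fh := by
      rcases hf with h | h <;> (obtain ⟨rfl, rfl, rfl, rfl, rfl, rfl⟩ := by simpa using h) <;>
        exact hfr _ (by decide) (by decide) (by decide)
    simp only [eval_hadd, eval_hsub, eval_reg, r0] at hg
    have hAc : A.card ≤ P.card := Finset.card_le_card I.subset
    cases l with
    | nil =>
      have h10 : s₂.reg 10 = 0 := hl
      have hg' : ¬ 0 < (Expr.reg 10).eval s₂ := by rw [eval_reg, h10]; omega
      unfold linkBody
      rw [Cmd.run_ite_neg hg', Cmd.safe_ite_neg hg']
      have b1 : |s₂.reg 1 + 1| ≤ (D : ℤ) := by rw [abs_le]; omega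
      have b2 := hs₂.arr fh (s₂.reg 1 + 1)
      obtain ⟨l', hl1, hl2, hl3⟩ := hB (s₂.reg 1 + 1) (by omega)
      refine ⟨by simp [b1, b2], n - 1, by omega, A, l', ?_, ?_, hl2, ?_, ?_, ?_, ?_, ?_⟩
      · simpa using I
      · simpa [efh] using hl1
      · simpa using fun a b h => (hl3 (a, b)).1 h
      · intro t ht
        have := hA t ht
        have h4 := hl3 t
        simp only [List.not_mem_nil, not_false_eq_true, and_true] at this
        simp only [block, Cmd.run, reg_setR, eval_hadd, eval_reg, eval_lit]
        rw [this, h4]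
        simp
        constructor
        · intro h; exact ⟨by omega, fun _ => by omega⟩
        · rintro ⟨h5, h6⟩; have := h6 ht; omega
      · simp; omega
      · simp; omega
      · simp; omega
    | cons t l =>
      obtain ⟨h10, hl'⟩ := hl
      obtain ⟨htP, htk⟩ := hlP t List.mem_cons_self
      have htA : t ∉ A := fun h => ((hA t htP).1 h).2 List.mem_cons_self
      have hct := hpos t htP
      have hg' : 0 < (Expr.reg 10).eval s₂ := by rw [eval_reg, h10]; exact hct
      have hstep := I.step hcode hpos hcr hck htP htA fun u hu => by
        have := ((hA u (I.subset hu)).1 hu).1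
        omega
      have b1 := hs₂.arr fc (code t)
      have b2 := hs₂.arr fl (cross t)
      have b3 := hs₂.arr fn (code t)
      have b4 := hs₂.1 10
      rw [h10] at b4
      rw [efc, hfc t htP] at b1
      have hcard : (insert t A).card = A.card + 1 := Finset.card_insert_of_notMem htA
      have hins : (insert t A).card ≤ P.card := Finset.card_le_card hstep.subset
      rw [List.nodup_cons] at hnd
      have hA' : ∀ u ∈ P, u ∈ insert t A ↔ key u ≤ s₂.reg 1 ∧ u ∉ l := by
        intro u hu
        rw [Finset.mem_insert, hA u hu, List.mem_cons]
        by_cases hut : u = t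
        · subst hut; simp [htk, hnd.1]
        · simp [hut]
      have hl'' : ∀ u ∈ l, u ∈ P ∧ key u = s₂.reg 1 := fun u hu => hlP u (List.mem_cons_of_mem _ hu)
      have efc' : arr s₂ fc (code t) = cross t := by rw [efc, hfc t htP]
      unfold linkBody
      rw [Cmd.run_ite_pos hg', Cmd.safe_ite_pos hg']
      rw [← efn] at hl'
      by_cases hq : 0 < arr s₂ fl (cross t)
      · rw [if_pos hq, if_pos hq] at hstep
        rcases hf with h | h <;> (obtain ⟨rfl, rfl, rfl, rfl, rfl, rfl⟩ := by simpa using h)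
        · refine ⟨by simp [h10, efc', hq, b1, b2, b3, b4], n - 1, by omega, insert t A, l,
            ?_, ?_, hnd.2, ?_, ?_, ?_, ?_, ?_⟩
          · simpa [h10, efc', hq] using hstep
          · rw [← efn]; simpa [h10, efc', hq] using hl'
          · simpa [h10, efc', hq] using fun a b h => hl'' (a, b) h
          · intro u hu; simpa [h10, efc', hq] using hA' u hu
          all_goals simp [h10, efc', hq]; omega
        · refine ⟨by simp [h10, efc', hq, b1, b2, b3, b4], n - 1, by omega, insert t A, l,
            ?_, ?_, hnd.2, ?_, ?_, ?_, ?_, ?_⟩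
          · simpa [h10, efc', hq] using hstep
          · rw [← efn]; simpa [h10, efc', hq] using hl'
          · simpa [h10, efc', hq] using fun a b h => hl'' (a, b) h
          · intro u hu; simpa [h10, efc', hq] using hA' u hu
          all_goals simp [h10, efc', hq]; omega
      · rw [if_neg hq, if_neg hq] at hstep
        rcases hf with h | h <;> (obtain ⟨rfl, rfl, rfl, rfl, rfl, rfl⟩ := by simpa using h)
        · refine ⟨by simp [h10, efc', hq, b1, b2, b3, b4], n - 1, by omega, insert t A, l,
            ?_, ?_, hnd.2, ?_, ?_, ?_, ?_, ?_⟩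
          · simpa [h10, efc', hq] using hstep
          · rw [← efn]; simpa [h10, efc', hq] using hl'
          · simpa [h10, efc', hq] using fun a b h => hl'' (a, b) h
          · intro u hu; simpa [h10, efc', hq] using hA' u hu
          all_goals simp [h10, efc', hq]; omega
        · refine ⟨by simp [h10, efc', hq, b1, b2, b3, b4], n - 1, by omega, insert t A, l,
            ?_, ?_, hnd.2, ?_, ?_, ?_, ?_, ?_⟩
          · simpa [h10, efc', hq] using hstep
          · rw [← efn]; simpa [h10, efc', hq] using hl'
          · simpa [h10, efc', hq] using fun a b h => hl'' (a, b) h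
          · intro u hu; simpa [h10, efc', hq] using hA' u hu
          all_goals simp [h10, efc', hq]; omega
  · rintro s' - hf' ⟨⟨n, A, l, I, hl, hnd, hlP, hA, h2, h3, hn⟩, hg⟩
    have r0 : s'.reg 0 = P.card := by
      rw [← hr₁]; exact hf'.reg 0 rfl
    simp only [eval_hadd, eval_hsub, eval_reg, r0] at hg
    have hnil : l = [] := by
      cases l with
      | nil => rfl
      | cons t l =>
        have := hpos t (hlP t List.mem_cons_self).1
        have h10 : s'.reg 10 = code t := hl.1
        omega
    subst hnil
    have h10 : s'.reg 10 = 0 := hl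
    have hAP : A = P := by
      refine Finset.Subset.antisymm I.subset fun t ht => (hA t ht).2 ⟨?_, by simp⟩
      have := hkey t ht
      omega
    subst hAP
    exact fun t ht => ⟨I.dn_spec t ht, I.up_spec t ht⟩

end RAM

/-! ### Writing out the cut. -/

namespace RAM

theorem Holds.guard {D : ℕ} {Q : Finset ℤ} {h v : ℤ} {s : State} (H : Holds D Q h v s) {a b : ℤ}
    (ha : 0 ≤ a) (hb : 0 ≤ b) : 0 < arr s 0 a + arr s 0 b - 1 ↔ a ∈ Q ∧ b ∈ Q := by
  rw [H.mem a ha, H.mem b hb]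
  by_cases h1 : a ∈ Q <;> by_cases h2 : b ∈ Q <;> simp [h1, h2]

/-- The index in `output` is an integer, so the range of naturals is coerced there through a monadic
bind; this form has a natural index. -/
theorem output_eq (s : State) : output s = (List.range (s.reg 0).toNat).map fun k : ℕ =>
    (s.mem (s.reg 1 + 2 * (k : ℤ)), s.mem (s.reg 1 + 2 * (k : ℤ) + 1)) := by
  rw [output, List.bind_eq_flatMap]
  simp only [List.pure_def]
  rw [← List.map_eq_flatMap, List.map_map]
  rfl

/-- Here `m` is the number of steps back to the beginning of the chord and `n` its length. -/
theorem emit_runs {W D : ℕ} {Q : Finset ℤ} (p : Params W D Q.card) {h v : ℤ} {s : State}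
    {eh : Expr} {B : ℤ} (hs : Bounded D s) (H : Holds D Q h v s) (hB : s.reg 6 = B)
    (heh : ∀ s' : State, s'.reg 6 = B → eh.eval s' = h)
    {fa fc : Fin 32} {ra rc : ℕ} {da dc : ℤ}
    (hf : (fa, fc, ra, rc, da, dc) = (1, 2, 2, 3, 0, 1) ∨ (fa, fc, ra, rc, da, dc) = (2, 1, 3, 2, 1, 0))
    (hst : (emit fa fc ra rc da dc eh).static = true)
    (h8 : s.reg 8 ∈ Q) (h9 : s.reg 9 ∈ Q)
    (hal : ∀ a ∈ Q, 1 ≤ arr s fa a ∧ arr s fa a ≤ Q.card)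
    (hstep : ∀ a ∈ Q, a - h ∈ Q → arr s fa (a - h) = arr s fa a - 1)
    (hb : ∀ a ∈ Q, |arr s fa a + s.reg ra| < D ∧ |arr s fc a + s.reg rc| < D) :
    Runs W D Q.card (emit fa fc ra rc da dc eh) s fun s' => ∃ m n : ℕ, m < n ∧
      (∀ i : ℕ, i < n → s.reg 8 - m * h + i * h ∈ Q ∧ s.reg 9 - m * h + i * h ∈ Q) ∧
      ¬ (s.reg 8 - m * h - h ∈ Q ∧ s.reg 9 - m * h - h ∈ Q) ∧
      ¬ (s.reg 8 - m * h + n * h ∈ Q ∧ s.reg 9 - m * h + n * h ∈ Q) ∧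
      output s' = (List.range (n + 1)).map fun k : ℕ =>
        if da = 0 then
          (arr s fa (s.reg 8 - m * h) + s.reg ra - 1 + k,
            max (arr s fc (s.reg 8 - m * h)) (arr s fc (s.reg 9 - m * h)) + s.reg rc - 1)
        else
          (max (arr s fc (s.reg 8 - m * h)) (arr s fc (s.reg 9 - m * h)) + s.reg rc - 1,
            arr s fa (s.reg 8 - m * h) + s.reg ra - 1 + k) := by
  have hN := p.pos
  have hD := p.card_le
  have hh := H.h_pos
  simp only [emit, Cmd.static, Bool.and_eq_true] at hst
  obtain ⟨st1, st2, st3, st4⟩ := hst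
  refine Runs.seq (Runs.loop p (by simpa only [Cmd.static, Bool.and_eq_true] using st1)
    (fun s' => ∃ m : ℕ, s'.reg 8 = s.reg 8 - m * h ∧ s'.reg 9 = s.reg 9 - m * h ∧
      ∀ i : ℕ, i ≤ m → s.reg 8 - i * h ∈ Q ∧ s.reg 9 - i * h ∈ Q)
    -- The coordinate along the cut lies between 1 and `Q.card` and drops by one with each step
    -- back.
    (fun s' => arr s' fa (s'.reg 8)) hs ?_ ?_ ?_) ?_
  · refine ⟨0, by simp, by simp, fun i hi => ?_⟩
    obtain rfl : i = 0 := by omega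
    simpa using ⟨h8, h9⟩
  · have := (hal _ h8).2
    omega
  · rintro s₁ hs₁ hfr ⟨m, e8, e9, hm⟩ hg
    have harr : arr s₁ = arr s := funext fun f => hfr.arr f rfl
    have e6 := heh s₁ ((hfr.reg 6 rfl).trans hB)
    have q8 : s₁.reg 8 ∈ Q := e8 ▸ (hm m le_rfl).1
    have q9 : s₁.reg 9 ∈ Q := e9 ▸ (hm m le_rfl).2
    have l8 := (H.large _ q8).2.1
    have l9 := (H.large _ q9).2.1
    have b8 := abs_le.1 (hs₁.1 8)
    have b9 := abs_le.1 (hs₁.1 9)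
    simp only [eval_hsub, eval_hadd, eval_rd, eval_reg, eval_lit, e6, harr] at hg
    rw [H.guard (by omega) (by omega)] at hg
    have e6' : eh.eval (setR s₁ 8 (s₁.reg 8 - h)) = h := heh _ (by simpa using (hfr.reg 6 rfl).trans hB)
    refine ⟨?_, ⟨m + 1, ?_, ?_, ?_⟩, ?_, ?_⟩
    · simp only [backBody, Cmd.Safe, Cmd.run, eval_hsub, eval_reg, e6, e6', reg_setR]
      exact ⟨abs_le.2 ⟨by omega, by omega⟩, abs_le.2 ⟨by simp; omega, by simp; omega⟩⟩
    · simp [backBody, e6, e8]; ring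
    · simp [backBody, e6, e6', e9]; ring
    · intro i hi
      rcases Nat.lt_or_ge m i with h' | h'
      · obtain rfl : i = m + 1 := by omega
        rw [e8, e9] at hg
        convert hg using 2 <;> push_cast <;> ring
      · exact hm i h'
    · rw [harr]; linarith [(hal _ q8).1]
    · simp only [backBody, Cmd.run, eval_hsub, eval_reg, e6, reg_setR, arr_setR, harr]
      simp [hstep _ q8 hg.1]
  rintro s₁ hs₁ hfr ⟨⟨m, e8, e9, hm⟩, hg⟩
  have harr : arr s₁ = arr s := funext fun f => hfr.arr f rfl
  have e6 := heh s₁ ((hfr.reg 6 rfl).trans hB)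
  have q8 : s₁.reg 8 ∈ Q := e8 ▸ (hm m le_rfl).1
  have q9 : s₁.reg 9 ∈ Q := e9 ▸ (hm m le_rfl).2
  have l8 := (H.large _ q8).2.1
  have l9 := (H.large _ q9).2.1
  simp only [eval_hsub, eval_hadd, eval_rd, eval_reg, eval_lit, e6, harr] at hg
  rw [← not_lt, H.guard (by omega) (by omega), e8, e9] at hg
  have era : s₁.reg ra = s.reg ra := by
    rcases hf with h | h <;> (obtain ⟨rfl, rfl, rfl, rfl, rfl, rfl⟩ := by simpa using h) <;>
      exact hfr.reg _ rfl
  have erc : s₁.reg rc = s.reg rc := by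
    rcases hf with h | h <;> (obtain ⟨rfl, rfl, rfl, rfl, rfl, rfl⟩ := by simpa using h) <;>
      exact hfr.reg _ rfl
  have r6 : s₁.reg 6 = B := (hfr.reg 6 rfl).trans hB
  obtain ⟨hda, ha10, hc10, hc11⟩ : (da = 0 ∧ dc = 1 ∨ da = 1 ∧ dc = 0) ∧ ra ≠ 10 ∧ rc ≠ 10 ∧ rc ≠ 11 := by
    rcases hf with h | h <;> (obtain ⟨rfl, rfl, rfl, rfl, rfl, rfl⟩ := by simpa using h) <;> decide
  have hda0 : 0 ≤ da := by omega
  have hdc0 : 0 ≤ dc := by omega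
  clear hfr hs hB hf
  set c := s.reg 8 - m * h with hc
  set q := s.reg 9 - m * h with hq
  set x := arr s fa c + s.reg ra - 1 with hx
  set y := max (arr s fc c) (arr s fc q) + s.reg rc - 1 with hy
  have cQ : c ∈ Q := (hm m le_rfl).1
  have qQ : q ∈ Q := (hm m le_rfl).2
  have by8 := abs_lt.1 (hb c cQ).2
  have by9 := abs_lt.1 (hb q qQ).2
  have bx8 := abs_lt.1 (hb c cQ).1
  have hxD : |x| ≤ D := abs_le.2 ⟨by omega, by omega⟩
  have hcD : |arr s fc c + s.reg rc - 1| ≤ D := abs_le.2 ⟨by omega, by omega⟩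
  have hyD : |y| ≤ D := abs_le.2 (by rcases max_choice (arr s fc c) (arr s fc q) with h | h <;>
    rw [hy, h] <;> constructor <;> omega)
  refine Runs.seq (Q := fun s' => s'.reg 6 = B ∧ s'.reg 8 = c ∧ s'.reg 9 = q ∧ s'.reg 10 = x ∧
    s'.reg 11 = y ∧ s'.reg 1 = 0 ∧ (∀ f a, 0 ≤ a → arr s' f a = arr s f a) ∧
    s'.mem da = x ∧ s'.mem dc = y) (Runs.of_run p hs₁ st2 ?_ ?_) ?_
  · unfold startBody
    rcases lt_or_ge (arr s fc c) (arr s fc q) with hlt | hge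
    · rw [max_eq_right hlt.le] at hy
      simp [putCorner, e8, e9, harr, era, erc, hc10, hc11, hlt, ← hx, ← hy, hyD, hxD, hcD]
    · rw [max_eq_left hge] at hy
      simp [putCorner, e8, e9, harr, era, erc, hc10, hge.not_gt, ← hx, ← hy, hyD, hxD]
  · unfold startBody
    rcases lt_or_ge (arr s fc c) (arr s fc q) with hlt | hge
    · rw [max_eq_right hlt.le] at hy
      simp [putCorner, e8, e9, harr, era, erc, hc10, hc11, hlt, ← hx, ← hy, mem_setM, r6]
      refine ⟨fun f a ha => ?_, by omega⟩
      rw [arr_setM_of_nonneg _ _ hdc0 _ ha, arr_setM_of_nonneg _ _ hda0 _ ha]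
      simp [harr]
    · rw [max_eq_left hge] at hy
      simp [putCorner, e8, e9, harr, era, erc, hc10, hge.not_gt, ← hx, ← hy, mem_setM, r6]
      refine ⟨fun f a ha => ?_, by omega⟩
      rw [arr_setM_of_nonneg _ _ hdc0 _ ha, arr_setM_of_nonneg _ _ hda0 _ ha]
      simp [harr]
  rintro s₂ hs₂ - ⟨g6, g8, g9, g10, g11, g1, ga, gx, gy⟩
  refine Runs.seq (Runs.loop p (by simpa only [Cmd.static, Bool.and_eq_true] using st3)
    (fun s' => ∃ k : ℕ, k ≤ Q.card ∧ s'.reg 8 = c + k * h ∧ s'.reg 9 = q + k * h ∧ s'.reg 10 = x + k ∧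
      s'.reg 11 = y ∧ s'.reg 1 = k ∧ (∀ f a, 0 ≤ a → arr s' f a = arr s f a) ∧
      (∀ i : ℕ, i ≤ k → s'.mem (2 * i + da) = x + i ∧ s'.mem (2 * i + dc) = y) ∧
      ∀ i : ℕ, i < k → c + i * h ∈ Q ∧ q + i * h ∈ Q)
    (fun s' => Q.card - s'.reg 1) hs₂ ?_ ?_ ?_) ?_
  · refine ⟨0, by omega, by simpa using g8, by simpa using g9, by simpa using g10, g11, by simpa using g1, ga,
      fun i hi => ?_, by simp⟩
    obtain rfl : i = 0 := by omega
    simpa using ⟨gx, gy⟩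
  · rw [g1]; omega
  · rintro s₃ hs₃ hfr ⟨k, hk, k8, k9, k10, k11, k1, ka, km, kQ⟩ hgd
    have q6 := heh s₃ ((hfr.reg 6 rfl).trans g6)
    simp only [eval_hsub, eval_hadd, eval_rd, eval_reg, eval_lit, k8, k9] at hgd
    have ckn : 0 ≤ c + k * h := by have := (H.large _ cQ).1; positivity
    have qkn : 0 ≤ q + k * h := by have := (H.large _ qQ).1; positivity
    rw [ka _ _ ckn, ka _ _ qkn, H.guard ckn qkn] at hgd
    have hks : ∀ i : ℕ, i < k + 1 → c + i * h ∈ Q ∧ q + i * h ∈ Q := by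
      intro i hi
      rcases Nat.lt_succ_iff_lt_or_eq.1 hi with h' | rfl
      exacts [kQ i h', hgd]
    have hx' : ∀ i : ℕ, i < k + 1 → arr s fa (c + i * h) = arr s fa c + i := by
      intro i
      induction i with
      | zero => simp
      | succ i ih =>
        intro hi
        have h1 := hks _ hi
        have h2 := hks i (by omega)
        have := hstep (c + (i + 1 : ℕ) * h) h1.1 (by convert h2.1 using 1; push_cast; ring)
        rw [show c + (i + 1 : ℕ) * h - h = c + i * h by push_cast; ring, ih (by omega)] at this
        push_cast at this ⊢
        omega
    have bk := hal _ hgd.1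
    have bk' := abs_lt.1 (hb _ hgd.1).1
    rw [hx' k (by omega)] at bk bk'
    have hal0 := (hal c cQ).1
    have sm8 := (H.small _ hgd.1).1
    have sm9 := (H.small _ hgd.2).1
    have a1 : |c + k * h + h| ≤ D := abs_le.2 ⟨by omega, sm8⟩
    have a2 : |q + k * h + h| ≤ D := abs_le.2 ⟨by omega, sm9⟩
    have a3 : |x + k + 1| ≤ D := abs_le.2 ⟨by omega, by omega⟩
    have a4 : |(k : ℤ) + 1| ≤ D := abs_le.2 ⟨by omega, by omega⟩
    have q6' : ∀ z, eh.eval (setR s₃ 8 z) = h := fun z =>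
      heh _ (by simpa using (hfr.reg 6 rfl).trans g6)
    refine ⟨?_, ⟨k + 1, by omega, ?_⟩, ?_, ?_⟩
    · simp [emitBody, putCorner, k8, k9, k10, k11, k1, q6, q6', a1, a2, a3, a4, hyD]
    · simp [emitBody, putCorner, k8, k9, k10, k11, k1, q6, q6']
      refine ⟨by ring, by ring, by ring, fun f a ha => ?_, fun i hi => ?_, fun i hi =>
        hks i (Nat.lt_succ_of_le hi)⟩
      · rw [arr_setM_of_nonneg _ _ (by omega) _ ha, arr_setM_of_nonneg _ _ (by omega) _ ha]
        exact ka f a ha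
      · rcases Nat.lt_or_ge k i with h' | h'
        · obtain rfl : i = k + 1 := by omega
          have : 2 * ((k : ℤ) + 1) + da ≠ 2 * (k + 1) + dc := by omega
          simp [mem_setM, this]
          ring
        · have := km i h'
          simp only [mem_setM, mem_setR]
          rw [if_neg (by omega), if_neg (by omega), if_neg (by omega), if_neg (by omega)]
          exact this
    · simp only [k1]; omega
    · simp [emitBody, putCorner, k1]
  rintro s₃ hs₃ - ⟨⟨k, hk, k8, k9, k10, k11, k1, ka, km, kQ⟩, hgd⟩
  simp only [eval_hsub, eval_hadd, eval_rd, eval_reg, eval_lit, k8, k9] at hgd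
  have ckn : 0 ≤ c + k * h := by have := (H.large _ cQ).1; positivity
  have qkn : 0 ≤ q + k * h := by have := (H.large _ qQ).1; positivity
  rw [ka _ _ ckn, ka _ _ qkn, ← not_lt, H.guard ckn qkn] at hgd
  have hkD : |(k : ℤ) + 1| ≤ D := abs_le.2 ⟨by omega, by omega⟩
  refine Runs.of_run p hs₃ (by simp only [Cmd.static, Bool.and_eq_true]; exact st4)
    (by simp [k1, hkD]) ⟨m, k, ?_, kQ, hg, hgd, ?_⟩
  -- If the forward pass stopped at `n ≤ m`, it stopped at a pair of tiles that the backward pass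
  -- had found inside.
  · by_contra hlt
    apply hgd
    have := hm (m - k) (by omega)
    rw [Nat.cast_sub (by omega)] at this
    convert this using 2 <;> ring
  · have e1 : ((Cmd.setReg 0 (Expr.reg 1 + Expr.lit 1)).seq (Cmd.setReg 1 (Expr.lit 0))).run s₃ =
      setR (setR s₃ 0 (k + 1)) 1 0 := by simp [k1]
    rw [e1, output_eq]
    have e2 : ((setR (setR s₃ 0 (k + 1)) 1 0).reg 0).toNat = k + 1 := by simp
    rw [e2]
    refine List.map_congr_left fun i hi => ?_
    have := km i (by simpa [Nat.lt_succ_iff] using hi)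
    simp only [reg_setR, mem_setR]
    rcases hda with ⟨rfl, rfl⟩ | ⟨rfl, rfl⟩
    · simpa [Prod.ext_iff] using this
    · simpa [Prod.ext_iff] using this.symm

end RAM

/-! ### The winding number of walks in a simple polyomino -/

open Relation

theorem gridGraph_adj {p q : ℤ × ℤ} : gridGraph.Adj p q ↔
    q = (p.1 + 1, p.2) ∨ p = (q.1 + 1, q.2) ∨ q = (p.1, p.2 + 1) ∨ p = (q.1, q.2 + 1) := by
  obtain ⟨a, b⟩ := p
  obtain ⟨c, d⟩ := q
  simp only [gridGraph, Prod.mk.injEq]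
  rcases abs_cases (a - c) with h | h <;> rcases abs_cases (b - d) with h' | h' <;> omega

/-- The sum of the `1`-form `c` along a walk. -/
def flux {V : Type*} {G : SimpleGraph V} (c : V → V → ℤ) : ∀ {u v : V}, G.Walk u v → ℤ
  | _, _, .nil => 0
  | u, _, .cons (v := v) _ w => c u v + flux c w

/-- The signed passage of a step through the horizontal ray that starts right of the column `x` and
bounds the row `y` from below. -/
def upStep (x y : ℤ) (p q : ℤ × ℤ) : ℤ :=
  if x < p.1 ∧ p.1 = q.1 then
    (if p.2 = y - 1 ∧ q.2 = y then 1 else 0) - (if p.2 = y ∧ q.2 = y - 1 then 1 else 0)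
  else 0

theorem flux_upStep_up {S : Set (ℤ × ℤ)} {x y : ℤ} (hz : (x, y) ∉ S) {u v : ℤ × ℤ}
    (w : gridGraph.Walk u v) (hw : ∀ t ∈ w.support, t ∈ S) :
    flux (upStep x y) w - flux (upStep x (y + 1)) w =
      (if x < v.1 ∧ v.2 = y then 1 else 0) - (if x < u.1 ∧ u.2 = y then 1 else 0) := by
  induction w with
  | nil => simp [flux]
  | @cons u u' v h w ih =>
    have h1 : u ∈ S := hw u (by simp)
    have h2 : u' ∈ S := hw u' (by simp)
    have := ih fun t ht => hw t (by simp [ht])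
    have key : upStep x y u u' - upStep x (y + 1) u u' =
        (if x < u'.1 ∧ u'.2 = y then 1 else 0) - (if x < u.1 ∧ u.2 = y then 1 else 0) := by
      have e1 : ¬ (u.1 = x ∧ u.2 = y) := fun h => hz (by rwa [← h.1, ← h.2])
      have e2 : ¬ (u'.1 = x ∧ u'.2 = y) := fun h => hz (by rwa [← h.1, ← h.2])
      obtain ⟨a, b⟩ := u
      obtain ⟨c, d⟩ := u'
      rw [gridGraph_adj] at h
      simp only [upStep, Prod.mk.injEq] at h e1 e2 ⊢
      split_ifs <;> omega
    rw [flux, flux]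
    linarith

/-- The two rays differ in column `x + 1` only, where a crossing step would use the missing tile. -/
theorem flux_upStep_right {S : Set (ℤ × ℤ)} {x y : ℤ} (hz : (x + 1, y) ∉ S) {u v : ℤ × ℤ}
    (w : gridGraph.Walk u v) (hw : ∀ t ∈ w.support, t ∈ S) :
    flux (upStep x y) w = flux (upStep (x + 1) y) w := by
  induction w with
  | nil => simp [flux]
  | @cons u u' v h w ih =>
    have h1 : u ∈ S := hw u (by simp)
    have h2 : u' ∈ S := hw u' (by simp)
    have := ih fun t ht => hw t (by simp [ht])
    have key : upStep x y u u' = upStep (x + 1) y u u' := by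
      have e1 : ¬ (u.1 = x + 1 ∧ u.2 = y) := fun h => hz (by rwa [← h.1, ← h.2])
      have e2 : ¬ (u'.1 = x + 1 ∧ u'.2 = y) := fun h => hz (by rwa [← h.1, ← h.2])
      obtain ⟨a, b⟩ := u
      obtain ⟨c, d⟩ := u'
      rw [gridGraph_adj] at h
      simp only [upStep, Prod.mk.injEq] at h e1 e2 ⊢
      split_ifs <;> omega
    rw [flux, flux, this, key]

theorem flux_upStep_of_le {x y : ℤ} {u v : ℤ × ℤ} (w : gridGraph.Walk u v)
    (hw : ∀ t ∈ w.support, t.1 ≤ x) : flux (upStep x y) w = 0 := by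
  induction w with
  | nil => simp [flux]
  | @cons u u' v h w ih =>
    have h1 := hw u (by simp)
    rw [flux, ih fun t ht => hw t (by simp [ht]), upStep, if_neg (by omega), add_zero]

/-- A closed walk in a simple polyomino does not wind around any tile outside. -/
theorem flux_upStep_eq_zero {P : Finset (ℤ × ℤ)} (hP : IsHoleFree P) {z : ℤ × ℤ} (hz : z ∉ P)
    {u : ℤ × ℤ} (w : gridGraph.Walk u u) (hw : ∀ t ∈ w.support, t ∈ P) :
    flux (upStep z.1 z.2) w = 0 := by
  obtain ⟨x, hx⟩ : ∃ x : ℤ, ∀ t ∈ P, t.1 < x := by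
    obtain ⟨x, hx⟩ := (P.image Prod.fst).bddAbove
    refine ⟨x + 1, fun t ht => ?_⟩
    have := hx (by simpa using ⟨t.2, ht⟩ : t.1 ∈ (↑(P.image Prod.fst) : Set ℤ))
    omega
  have hx' : (x, 0) ∉ P := fun h => (hx _ h).ne rfl
  -- The starting point of the ray can be moved through the connected complement without changing
  -- the flux, finally to the right of all of `P`, where the flux is 0.
  have key : ∀ t t' : ((P : Set (ℤ × ℤ))ᶜ : Set _), (gridGraph.induce _).Reachable t t' →
      flux (upStep t.1.1 t.1.2) w = flux (upStep t'.1.1 t'.1.2) w := by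
    rintro t t' ⟨q⟩
    induction q with
    | nil => rfl
    | @cons t t' t'' h _ ih =>
      rw [← ih]
      have h1 : t.1 ∉ (P : Set (ℤ × ℤ)) := t.2
      have h2 : t'.1 ∉ (P : Set (ℤ × ℤ)) := t'.2
      have h : gridGraph.Adj t.1 t'.1 := h
      rw [gridGraph_adj] at h
      generalize t.1 = t at h h1 ⊢
      generalize t'.1 = t' at h h2 ⊢
      obtain ⟨a, b⟩ := t
      obtain ⟨c, d⟩ := t'
      simp only [Prod.mk.injEq] at h h1 h2 ⊢
      rcases h with ⟨rfl, rfl⟩ | ⟨rfl, rfl⟩ | ⟨rfl, rfl⟩ | ⟨rfl, rfl⟩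
      · exact flux_upStep_right h2 w hw
      · exact (flux_upStep_right h1 w hw).symm
      · have := flux_upStep_up h1 w hw
        linarith
      · have := flux_upStep_up h2 w hw
        linarith
  rw [key ⟨z, hz⟩ ⟨(x, 0), hx'⟩ (hP.preconnected _ _)]
  exact flux_upStep_of_le w fun t ht => (hx t (hw t ht)).le

/-! ### Subpolyominoes as sets of linked tiles -/

/-- Adjacency of tiles of `P` that the curve does not cut. -/
def Link (P : Finset (ℤ × ℤ)) (γ : List (ℤ × ℤ)) (p q : ℤ × ℤ) : Prop :=
  p ∈ P ∧ q ∈ P ∧ gridGraph.Adj p q ∧ ¬ Separates γ p q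

theorem Separates.symm {γ : List (ℤ × ℤ)} {p q : ℤ × ℤ} (h : Separates γ p q) : Separates γ q p :=
  let ⟨u, v, h0, h1, h2, h3, h4⟩ := h
  ⟨u, v, h0, h3, h4, h1, h2⟩

theorem Link.symm {P : Finset (ℤ × ℤ)} {γ : List (ℤ × ℤ)} {p q : ℤ × ℤ} (h : Link P γ p q) :
    Link P γ q p :=
  ⟨h.2.1, h.1, h.2.2.1.symm, fun h' => h.2.2.2 h'.symm⟩

/-- The subpolyomino that contains `t`. -/
def pieceOf (P : Finset (ℤ × ℤ)) (γ : List (ℤ × ℤ)) (t : ℤ × ℤ) : Set (ℤ × ℤ) :=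
  {t' | ReflTransGen (Link P γ) t t'}

theorem mem_pieceOf_self (P : Finset (ℤ × ℤ)) (γ : List (ℤ × ℤ)) (t : ℤ × ℤ) : t ∈ pieceOf P γ t :=
  .refl

theorem reflTransGen_link_symm {P : Finset (ℤ × ℤ)} {γ : List (ℤ × ℤ)} {p q : ℤ × ℤ}
    (h : ReflTransGen (Link P γ) p q) : ReflTransGen (Link P γ) q p := by
  induction h with
  | refl => exact .refl
  | tail _ h ih => exact .head h.symm ih

theorem pieceOf_eq_of_mem {P : Finset (ℤ × ℤ)} {γ : List (ℤ × ℤ)} {p q : ℤ × ℤ}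
    (h : q ∈ pieceOf P γ p) : pieceOf P γ q = pieceOf P γ p :=
  Set.ext fun _ => ⟨fun h' => ReflTransGen.trans h h',
    fun h' => (reflTransGen_link_symm h).trans h'⟩

theorem pieceOf_subset {P : Finset (ℤ × ℤ)} {γ : List (ℤ × ℤ)} {t : ℤ × ℤ} (ht : t ∈ P) :
    pieceOf P γ t ⊆ P := by
  intro t' h
  rcases ReflTransGen.cases_tail h with rfl | ⟨_, -, h⟩
  exacts [ht, h.2.1]

theorem reachable_induce_iff {V : Type*} {S : Set V} (G : SimpleGraph S) (r : V → V → Prop)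
    (hr : ∀ p q : V, r p q ↔ ∃ (hp : p ∈ S) (hq : q ∈ S), G.Adj ⟨p, hp⟩ ⟨q, hq⟩) (p q : S) :
    G.Reachable p q ↔ ReflTransGen r p q := by
  constructor
  · rintro ⟨w⟩
    induction w with
    | nil => exact .refl
    | cons h _ ih => exact .head ((hr _ _).2 ⟨Subtype.coe_prop _, Subtype.coe_prop _, h⟩) ih
  · suffices ∀ q', ReflTransGen r p q' → ∀ h : q' ∈ S, G.Reachable p ⟨q', h⟩ from
      fun h => this q h q.2
    intro q' h
    induction h with
    | refl => exact fun _ => .refl _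
    | tail _ h ih =>
      obtain ⟨h1, h2, h3⟩ := (hr _ _).1 h
      exact fun _ => (ih h1).trans h3.reachable

/-- As reachability classes of a relation on the whole plane, pieces of different curves can be
compared directly. -/
theorem pieces_eq (P : Finset (ℤ × ℤ)) (γ : List (ℤ × ℤ)) :
    pieces P γ = pieceOf P γ '' (P : Set (ℤ × ℤ)) := by
  have key : ∀ p : (P : Set (ℤ × ℤ)), Subtype.val ''
      ((cutGraph P γ).connectedComponentMk p).supp = pieceOf P γ p := by
    intro p
    ext q
    have hr := reachable_induce_iff (cutGraph P γ) (Link P γ) fun p q =>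
      ⟨fun h => ⟨h.1, h.2.1, h.2.2⟩, fun ⟨h1, h2, h3⟩ => ⟨h1, h2, h3.1, h3.2⟩⟩
    constructor
    · rintro ⟨q, hq, rfl⟩
      rw [SimpleGraph.ConnectedComponent.mem_supp_iff, SimpleGraph.ConnectedComponent.eq] at hq
      exact (hr p q).1 hq.symm
    · intro h
      refine ⟨⟨q, pieceOf_subset p.2 h⟩, ?_, rfl⟩
      rw [SimpleGraph.ConnectedComponent.mem_supp_iff, SimpleGraph.ConnectedComponent.eq]
      exact ((hr p ⟨q, pieceOf_subset p.2 h⟩).2 h).symm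
  ext A
  constructor
  · rintro ⟨c, rfl⟩
    induction c using SimpleGraph.ConnectedComponent.ind with
    | h p => exact ⟨p, p.2, (key p).symm⟩
  · rintro ⟨p, hp, rfl⟩
    exact ⟨(cutGraph P γ).connectedComponentMk ⟨p, hp⟩, key ⟨p, hp⟩⟩

theorem IsPolyomino.reflTransGen {P : Finset (ℤ × ℤ)} (h : IsPolyomino P) {p q : ℤ × ℤ}
    (hp : p ∈ P) (hq : q ∈ P) :
    ReflTransGen (fun p q => p ∈ P ∧ q ∈ P ∧ gridGraph.Adj p q) p q :=
  (reachable_induce_iff (gridGraph.induce (P : Set (ℤ × ℤ))) _ (fun _ _ =>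
    ⟨fun h => ⟨h.1, h.2.1, h.2.2⟩, fun ⟨h1, h2, h3⟩ => ⟨h1, h2, h3⟩⟩) ⟨p, hp⟩ ⟨q, hq⟩).1
    (h.preconnected _ _)

/-! ### Chords -/

open Relation

/-- The horizontal curve of `n` steps that starts at the corner `(a, j)`. -/
def chord (a j : ℤ) (n : ℕ) : List (ℤ × ℤ) := (List.range (n + 1)).map fun k : ℕ => (a + k, j)

theorem length_chord (a j : ℤ) (n : ℕ) : (chord a j n).length = n + 1 := by simp [chord]

theorem getElem?_chord (a j : ℤ) (n k : ℕ) :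
    (chord a j n)[k]? = if k ≤ n then some (a + (k : ℤ), j) else none := by
  simp only [chord, List.getElem?_map]
  split_ifs with h
  · rw [List.getElem?_range (by omega)]; rfl
  · rw [List.getElem?_eq_none (by simp; omega)]; rfl

theorem infix_pair_iff {α : Type*} {u v : α} {l : List α} :
    [u, v] <:+: l ↔ ∃ k, l[k]? = some u ∧ l[k + 1]? = some v := by
  rw [List.infix_iff_getElem?]
  constructor
  · rintro ⟨k, -, h⟩
    refine ⟨k, by simpa using h 0 (by simp), by simpa [add_comm] using h 1 (by simp)⟩
  · rintro ⟨k, h0, h1⟩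
    refine ⟨k, ?_, fun i hi => ?_⟩
    · have := (List.getElem?_eq_some_iff.1 h1).1
      simp only [List.length_cons, List.length_nil]
      omega
    · simp only [List.length_cons, List.length_nil] at hi
      obtain rfl | rfl : i = 0 ∨ i = 1 := by omega
      · simpa using h0
      · simpa [add_comm] using h1

theorem infix_triple_iff {α : Type*} {u v w : α} {l : List α} :
    [u, v, w] <:+: l ↔ ∃ k, l[k]? = some u ∧ l[k + 1]? = some v ∧ l[k + 2]? = some w := by
  rw [List.infix_iff_getElem?]
  constructor
  · rintro ⟨k, -, h⟩
    refine ⟨k, by simpa using h 0 (by simp), by simpa [add_comm] using h 1 (by simp),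
      by simpa [add_comm] using h 2 (by simp)⟩
  · rintro ⟨k, h0, h1, h2⟩
    refine ⟨k, ?_, fun i hi => ?_⟩
    · have := (List.getElem?_eq_some_iff.1 h2).1
      simp only [List.length_cons, List.length_nil]
      omega
    · simp only [List.length_cons, List.length_nil] at hi
      obtain rfl | rfl | rfl : i = 0 ∨ i = 1 ∨ i = 2 := by omega
      · simpa using h0
      · simpa [add_comm] using h1
      · simpa [add_comm] using h2

theorem infix_chord_iff {a j : ℤ} {n : ℕ} {u v : ℤ × ℤ} :
    [u, v] <:+: chord a j n ↔ ∃ k < n, u = (a + (k : ℤ), j) ∧ v = (a + k + 1, j) := by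
  simp only [infix_pair_iff, getElem?_chord]
  constructor
  · rintro ⟨k, h0, h1⟩
    split_ifs at h0 h1 with h h'
    refine ⟨k, by omega, by simpa using h0.symm, ?_⟩
    simpa [add_assoc] using (Option.some.inj h1).symm
  · rintro ⟨k, hk, rfl, rfl⟩
    refine ⟨k, by simp [hk.le], ?_⟩
    rw [if_pos (by omega)]
    simp [add_assoc]

/-- The tiles `p` and `q` are the ones above and below a step of the chord. -/
def Across (a j : ℤ) (n : ℕ) (p q : ℤ × ℤ) : Prop :=
  ∃ k < n, p = (a + (k : ℤ), j) ∧ q = (a + (k : ℤ), j - 1)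

theorem separates_chord_iff {a j : ℤ} {n : ℕ} {p q : ℤ × ℤ} (hpq : gridGraph.Adj p q) :
    Separates (chord a j n) p q ↔ Across a j n p q ∨ Across a j n q p := by
  obtain ⟨p1, p2⟩ := p
  obtain ⟨q1, q2⟩ := q
  rw [gridGraph_adj] at hpq
  simp only [Prod.mk.injEq] at hpq
  constructor
  · rintro ⟨u, v, h, h1, h2, h3, h4⟩
    obtain ⟨k, hk, rfl, rfl⟩ := infix_chord_iff.1 h
    simp only [IsTileCorner] at h1 h2 h3 h4
    by_cases hj : p2 = j
    · refine Or.inl ⟨k, hk, ?_, ?_⟩ <;> simp only [Prod.mk.injEq] <;> omega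
    · refine Or.inr ⟨k, hk, ?_, ?_⟩ <;> simp only [Prod.mk.injEq] <;> omega
  · rintro (⟨k, hk, h1, h2⟩ | ⟨k, hk, h1, h2⟩) <;> simp only [Prod.mk.injEq] at h1 h2 <;>
      refine ⟨_, _, infix_chord_iff.2 ⟨k, hk, rfl, rfl⟩, ?_⟩ <;>
      simp only [IsTileCorner] <;> omega

/-- A chord of `P`: a maximal horizontal curve inside `P`. -/
structure IsChord (P : Finset (ℤ × ℤ)) (a j : ℤ) (n : ℕ) : Prop where
  pos : 0 < n
  inside : ∀ k : ℕ, k < n → (a + k, j) ∈ P ∧ (a + k, j - 1) ∈ P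
  left : ¬ ((a - 1, j) ∈ P ∧ (a - 1, j - 1) ∈ P)
  right : ¬ ((a + n, j) ∈ P ∧ (a + n, j - 1) ∈ P)

/-- Extend the step in both directions up to the first failure, which exists because `P` is finite.
-/
theorem exists_isChord {P : Finset (ℤ × ℤ)} {i j : ℤ} (h1 : (i, j) ∈ P) (h2 : (i, j - 1) ∈ P) :
    ∃ (a : ℤ) (n k : ℕ), IsChord P a j n ∧ k < n ∧ i = a + k := by
  classical
  have hfin : ∀ f : ℕ → ℤ, Function.Injective f → ∃ m, ¬ ((f m, j) ∈ P ∧ (f m, j - 1) ∈ P) := by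
    intro f hf
    by_contra! h
    exact Set.infinite_of_injective_forall_mem (f := fun m => (f m, j))
      (fun x y hxy => hf (by simpa using hxy)) (fun m => (h m).1) P.finite_toSet
  have hl := hfin (fun m => i - 1 - m) fun x y hxy => by simpa using hxy
  have hr := hfin (fun m => i + 1 + m) fun x y hxy => by simpa using hxy
  refine ⟨i - Nat.find hl, Nat.find hl + Nat.find hr + 1, Nat.find hl,
    ⟨by omega, fun k hk => ?_, ?_, ?_⟩, by omega, by ring⟩
  · rcases lt_trichotomy k (Nat.find hl) with h | h | h
    · have := not_not.1 (Nat.find_min hl (m := Nat.find hl - 1 - k) (by omega))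
      rw [show i - 1 - ((Nat.find hl - 1 - k : ℕ) : ℤ) = i - Nat.find hl + k by omega] at this
      exact this
    · rw [h]; simpa using ⟨h1, h2⟩
    · have := not_not.1 (Nat.find_min hr (m := k - Nat.find hl - 1) (by omega))
      rw [show i + 1 + ((k - Nat.find hl - 1 : ℕ) : ℤ) = i - Nat.find hl + k by omega] at this
      exact this
  · have := Nat.find_spec hl
    rwa [show i - 1 - (Nat.find hl : ℤ) = i - Nat.find hl - 1 by ring] at this
  · have := Nat.find_spec hr
    rwa [show i + 1 + (Nat.find hr : ℤ) =
      i - Nat.find hl + (Nat.find hl + Nat.find hr + 1 : ℕ) by push_cast; ring] at this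

namespace IsChord

variable {P : Finset (ℤ × ℤ)} {a j : ℤ} {n : ℕ}

theorem isCut (h : IsChord P a j n) : IsCut P (chord a j n) := by
  refine ⟨?_, ?_, ?_⟩
  · rw [List.isChain_iff_getElem]
    intro i hi
    simp only [chord, List.getElem_map, List.getElem_range, gridGraph_adj]
    exact Or.inl (by push_cast; simp [add_assoc])
  · intro u hu hint
    rw [List.head?_eq_getElem?, getElem?_chord] at hu
    obtain rfl : (a, j) = u := by simpa using hu
    exact h.left ⟨hint _ (by simp [IsTileCorner]), hint _ (by simp [IsTileCorner])⟩
  · intro u hu hint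
    rw [List.getLast?_eq_getElem?, length_chord, getElem?_chord] at hu
    obtain rfl : (a + (n : ℤ), j) = u := by simpa using hu
    exact h.right ⟨hint _ (by simp [IsTileCorner]), hint _ (by simp [IsTileCorner])⟩

theorem isStraight : IsStraight P (chord a j n) := by
  intro u v w huvw _
  obtain ⟨k, h0, h1, h2⟩ := infix_triple_iff.1 huvw
  simp only [getElem?_chord] at h0 h1 h2
  split_ifs at h0 h1 h2
  simp only [Option.some.injEq] at h0 h1 h2
  subst h0 h1 h2
  ext <;> simp

/-- If the missing tile is the lower one, `flux_upStep_up` moves the ray up by a row, at no cost for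
a closed walk. -/
theorem flux_eq_zero (hP : IsHoleFree P) {x : ℤ} (hx : ¬ ((x, j) ∈ P ∧ (x, j - 1) ∈ P))
    {u : ℤ × ℤ} (w : gridGraph.Walk u u) (hw : ∀ t ∈ w.support, t ∈ P) :
    flux (upStep x j) w = 0 := by
  rcases not_and_or.1 hx with h | h
  · exact flux_upStep_eq_zero hP h w hw
  · have h1 := flux_upStep_up (S := P) h w hw
    have h2 := flux_upStep_eq_zero hP h w hw
    rw [sub_add_cancel] at h1
    simp only at h2
    linarith

/-- The two rays differ in the columns from `a` to `a + n`. All but the last are blocked by the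
chord, and in the last one a tile is missing. -/
theorem exists_walk (h : IsChord P a j n) {u v : ℤ × ℤ} (hv : v ∈ P)
    (huv : ReflTransGen (Link P (chord a j n)) u v) : ∃ w : gridGraph.Walk u v,
      (∀ t ∈ w.support, t ∈ P) ∧ flux (upStep (a - 1) j) w = flux (upStep (a + n) j) w := by
  induction huv using ReflTransGen.head_induction_on with
  | refl => exact ⟨.nil, by simpa using hv, rfl⟩
  | @head p q hpq _ ih =>
    obtain ⟨w, hw, hw'⟩ := ih
    refine ⟨.cons hpq.2.2.1 w, by simpa using ⟨hpq.1, fun _ _ => hw _⟩, ?_⟩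
    rw [flux, flux, hw']
    congr 1
    have h1 := hpq.2.2.2
    rw [separates_chord_iff hpq.2.2.1, not_or] at h1
    have h2 := h.right
    obtain ⟨hp, hq, -, -⟩ := hpq
    obtain ⟨p1, p2⟩ := p
    obtain ⟨q1, q2⟩ := q
    by_cases hr : a - 1 < p1 ∧ p1 ≤ a + n ∧ p1 = q1
    swap
    · have : (a - 1 < p1 ∧ p1 = q1) ↔ a + n < p1 ∧ p1 = q1 := by omega
      simp only [upStep, this]
    obtain ⟨hr1, hr2, rfl⟩ := hr
    have e1 : ¬ (p2 = j - 1 ∧ q2 = j) := by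
      rintro ⟨rfl, rfl⟩
      rcases hr2.lt_or_eq with hlt | rfl
      · exact h1.2 ⟨(p1 - a).toNat, by omega, by simp; omega, by simp; omega⟩
      · exact h2 ⟨hq, hp⟩
    have e2 : ¬ (p2 = j ∧ q2 = j - 1) := by
      rintro ⟨rfl, rfl⟩
      rcases hr2.lt_or_eq with hlt | rfl
      · exact h1.1 ⟨(p1 - a).toNat, by omega, by simp; omega, by simp; omega⟩
      · exact h2 ⟨hp, hq⟩
    simp [upStep, e1, e2]

/-- Suppose an uncut walk joined the two sides, and close it up by the step across the chord at `a`.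
That step contributes 1 to the flux through the ray starting at the left end and 0 at the right end,
where the walk itself contributes equally; but both fluxes of the closed walk are 0. -/
theorem notMem_pieceOf (h : IsChord P a j n) (hP : IsHoleFree P) :
    (a, j - 1) ∉ pieceOf P (chord a j n) (a, j) := by
  intro hmem
  have hin := h.inside 0 h.pos
  simp only [Nat.cast_zero, add_zero] at hin
  obtain ⟨w, hw, hw'⟩ := h.exists_walk hin.2 hmem
  have hadj : gridGraph.Adj (a, j - 1) (a, j) := gridGraph_adj.2 (by simp)
  have hsup : ∀ t ∈ (SimpleGraph.Walk.cons hadj w).support, t ∈ P := by simpa using ⟨hin.2, fun _ _ => hw _⟩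
  have h1 := flux_eq_zero hP h.left _ hsup
  have h2 := flux_eq_zero hP h.right _ hsup
  rw [flux] at h1 h2
  have e1 : upStep (a - 1) j (a, j - 1) (a, j) = 1 := by simp [upStep]
  have e2 : upStep (a + n) j (a, j - 1) (a, j) = 0 := by simp [upStep]
  omega

theorem mem_top (h : IsChord P a j n) : ∀ k : ℕ, k < n →
    (a + (k : ℤ), j) ∈ pieceOf P (chord a j n) (a, j) := by
  intro k
  induction k with
  | zero => intro _; simpa using mem_pieceOf_self _ _ _
  | succ k ih =>
    intro hk
    refine ReflTransGen.tail (ih (by omega)) ⟨(h.inside k (by omega)).1, (h.inside _ hk).1,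
      gridGraph_adj.2 (by push_cast; simp [add_assoc]), ?_⟩
    rw [separates_chord_iff (gridGraph_adj.2 (by push_cast; simp [add_assoc]))]
    rintro (⟨k', -, h1, h2⟩ | ⟨k', -, h1, h2⟩) <;> simp only [Prod.mk.injEq] at h1 h2 <;> omega

theorem mem_bot (h : IsChord P a j n) : ∀ k : ℕ, k < n →
    (a + (k : ℤ), j - 1) ∈ pieceOf P (chord a j n) (a, j - 1) := by
  intro k
  induction k with
  | zero => intro _; simpa using mem_pieceOf_self _ _ _
  | succ k ih =>
    intro hk
    refine ReflTransGen.tail (ih (by omega)) ⟨(h.inside k (by omega)).2, (h.inside _ hk).2,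
      gridGraph_adj.2 (by push_cast; simp [add_assoc]), ?_⟩
    rw [separates_chord_iff (gridGraph_adj.2 (by push_cast; simp [add_assoc]))]
    rintro (⟨k', -, h1, h2⟩ | ⟨k', -, h1, h2⟩) <;> simp only [Prod.mk.injEq] at h1 h2 <;> omega

theorem notMem_top (h : IsChord P a j n) (hP : IsHoleFree P) {t : ℤ × ℤ}
    (ht : t ∈ pieceOf P (chord a j n) (a, j - 1)) : t ∉ pieceOf P (chord a j n) (a, j) :=
  fun h' => h.notMem_pieceOf hP (ReflTransGen.trans h' (reflTransGen_link_symm ht))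

/-- Along a path in `P`, a cut adjacency leads to a tile of one of the two rows at the chord, and
each of these rows stays connected. -/
theorem mem_or_mem (h : IsChord P a j n) (hP : IsPolyomino P) {t : ℤ × ℤ} (ht : t ∈ P) :
    t ∈ pieceOf P (chord a j n) (a, j) ∨ t ∈ pieceOf P (chord a j n) (a, j - 1) := by
  have hin := (h.inside 0 h.pos).1
  simp only [Nat.cast_zero, add_zero] at hin
  have hr := hP.reflTransGen hin ht
  induction hr with
  | refl => exact Or.inl (mem_pieceOf_self _ _ _)
  | @tail p q _ hpq ih =>
    by_cases hs : Separates (chord a j n) p q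
    · rw [separates_chord_iff hpq.2.2] at hs
      rcases hs with ⟨k, hk, -, rfl⟩ | ⟨k, hk, rfl, -⟩
      exacts [Or.inr (h.mem_bot k hk), Or.inl (h.mem_top k hk)]
    · have hl : Link P (chord a j n) p q := ⟨hpq.1, hpq.2.1, hpq.2.2, hs⟩
      exact (ih hpq.1).imp (fun h => ReflTransGen.tail h hl) fun h => ReflTransGen.tail h hl

theorem pieces_eq_pair (h : IsChord P a j n) (hP : IsPolyomino P) :
    pieces P (chord a j n) =
      {pieceOf P (chord a j n) (a, j), pieceOf P (chord a j n) (a, j - 1)} := by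
  have hin := h.inside 0 h.pos
  simp only [Nat.cast_zero, add_zero] at hin
  rw [pieces_eq]
  ext A
  constructor
  · rintro ⟨t, ht, rfl⟩
    exact (h.mem_or_mem hP ht).imp pieceOf_eq_of_mem pieceOf_eq_of_mem
  · rintro (rfl | rfl)
    exacts [⟨_, hin.1, rfl⟩, ⟨_, hin.2, rfl⟩]

end IsChord

/-! ### Valid chords -/

open Relation

/-- No tile of `P` in direction `d` from a tile of `S` is outside `S`. -/
def ClosedIn (P : Finset (ℤ × ℤ)) (d : ℤ × ℤ) (S : Set (ℤ × ℤ)) : Prop :=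
  ∀ t ∈ S, ∀ k : ℕ, t + k • d ∈ P → t + k • d ∈ S

def directions : Set (ℤ × ℤ) := {(1, 0), (-1, 0), (0, 1), (0, -1)}

theorem neg_mem_directions {d : ℤ × ℤ} (hd : d ∈ directions) : -d ∈ directions := by
  rcases hd with rfl | rfl | rfl | rfl <;> simp [directions]

theorem canPullApart_comm {d : ℤ × ℤ} {A B : Set (ℤ × ℤ)} (h : CanPullApart d A B) :
    CanPullApart (-d) B A := by
  intro m n p hp q hq h'
  refine h n m q hq p hp ?_
  simp only [smul_neg, sub_neg_eq_add] at h'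
  rw [← h']
  abel

/-- Only the relative displacement `m + n` matters. -/
theorem canPullApart_of_closedIn {P : Finset (ℤ × ℤ)} {d : ℤ × ℤ} {A B : Set (ℤ × ℤ)}
    (hB : B ⊆ P) (hAB : ∀ t ∈ B, t ∉ A) (h : ClosedIn P d A) : CanPullApart d A B := by
  intro m n p hp q hq h'
  have e : p + (m + n) • d = q := by rw [add_smul, ← add_assoc, h']; abel
  exact hAB q hq (e ▸ h p hp (m + n) (e ▸ hB hq))

theorem closedIn_of_canPullApart {P : Finset (ℤ × ℤ)} {d : ℤ × ℤ} {A B : Set (ℤ × ℤ)}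
    (hAB : ∀ t ∈ P, t ∈ A ∨ t ∈ B) (h : CanPullApart d A B) : ClosedIn P d A := by
  intro t ht k hk
  refine (hAB _ hk).resolve_right fun hB => h k 0 t ht _ hB (by simp)

namespace IsChord

variable {P : Finset (ℤ × ℤ)} {a j : ℤ} {n : ℕ}

theorem inside_zero (h : IsChord P a j n) : (a, j) ∈ P ∧ (a, j - 1) ∈ P := by
  simpa using h.inside 0 h.pos

theorem isValidStraightTwoCut (h : IsChord P a j n) (hP : IsPolyomino P) (hP' : IsHoleFree P)
    {d : ℤ × ℤ} (hd : d ∈ directions)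
    (hc : ClosedIn P d (pieceOf P (chord a j n) (a, j)) ∨
      ClosedIn P d (pieceOf P (chord a j n) (a, j - 1))) :
    IsValidStraightTwoCut P (chord a j n) := by
  have hin := h.inside_zero
  refine ⟨⟨h.isCut, ?_⟩, isStraight, _, _, h.pieces_eq_pair hP, ?_⟩
  · rw [h.pieces_eq_pair hP]
    refine Set.ncard_pair fun heq => h.notMem_pieceOf hP' ?_
    rw [heq]
    exact mem_pieceOf_self _ _ _
  · rcases hc with hc | hc
    · exact ⟨d, hd, canPullApart_of_closedIn (pieceOf_subset hin.2) (fun t => h.notMem_top hP') hc⟩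
    · refine ⟨-d, neg_mem_directions hd, canPullApart_comm (canPullApart_of_closedIn
        (pieceOf_subset hin.1) (fun t ht ht' => h.notMem_top hP' ht' ht) hc)⟩

end IsChord

/-- One piece is closed in direction `d` and the other in direction `-d`. Hence testing the piece
without the root in all four directions misses nothing. -/
theorem IsValid.exists_closedIn {P : Finset (ℤ × ℤ)} {γ : List (ℤ × ℤ)} (hv : IsValid P γ) {t : ℤ × ℤ} (ht : t ∈ P) :
    ∃ d ∈ directions, ClosedIn P d (pieceOf P γ t) := by
  obtain ⟨A, B, hAB, d, hd, hc⟩ := hv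
  have hcov : ∀ u ∈ P, u ∈ A ∨ u ∈ B := by
    intro u hu
    have : pieceOf P γ u ∈ pieces P γ := by
      rw [pieces_eq]; exact ⟨u, hu, rfl⟩
    rw [hAB] at this
    rcases this with h | h <;> rw [← h]
    exacts [Or.inl (mem_pieceOf_self _ _ _), Or.inr (mem_pieceOf_self _ _ _)]
  have : pieceOf P γ t ∈ pieces P γ := by
    rw [pieces_eq]; exact ⟨t, ht, rfl⟩
  rw [hAB] at this
  rcases this with rfl | rfl
  · exact ⟨d, hd, closedIn_of_canPullApart hcov hc⟩
  · exact ⟨-d, neg_mem_directions hd, closedIn_of_canPullApart (fun u hu => (hcov u hu).symm)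
      (canPullApart_comm hc)⟩

/-- The curve runs along the step between `(i, j)` and `(i + 1, j)`. -/
def HasStep (γ : List (ℤ × ℤ)) (i j : ℤ) : Prop :=
  [(i, j), (i + 1, j)] <:+: γ ∨ [(i + 1, j), (i, j)] <:+: γ

theorem exists_next {P : Finset (ℤ × ℤ)} {γ : List (ℤ × ℤ)} (hc : IsCut P γ) (hs : IsStraight P γ)
    {u v : ℤ × ℤ} (huv : [u, v] <:+: γ) (hv : IsInteriorCorner P v) : [v, v + (v - u)] <:+: γ := by
  obtain ⟨k, h0, h1⟩ := infix_pair_iff.1 huv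
  have hk := (List.getElem?_eq_some_iff.1 h1).1
  have hlast : k + 2 < γ.length := by
    by_contra hlt
    apply hc.last_not_interior v _ hv
    rw [List.getLast?_eq_getElem?, show γ.length - 1 = k + 1 by omega]
    exact h1
  have h2 := List.getElem?_eq_getElem hlast
  have := hs u v _ (infix_triple_iff.2 ⟨k, h0, h1, h2⟩) hv
  refine infix_pair_iff.2 ⟨k + 1, h1, ?_⟩
  rw [← this]
  simp

theorem exists_prev {P : Finset (ℤ × ℤ)} {γ : List (ℤ × ℤ)} (hc : IsCut P γ) (hs : IsStraight P γ)
    {u v : ℤ × ℤ} (huv : [u, v] <:+: γ) (hu : IsInteriorCorner P u) : [u - (v - u), u] <:+: γ := by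
  obtain ⟨k, h0, h1⟩ := infix_pair_iff.1 huv
  have hk := (List.getElem?_eq_some_iff.1 h1).1
  rcases Nat.eq_zero_or_pos k with rfl | hpos
  · exact absurd hu (hc.head_not_interior u (by rwa [List.head?_eq_getElem?]))
  obtain ⟨k, rfl⟩ : ∃ m, k = m + 1 := ⟨k - 1, by omega⟩
  have h2 := List.getElem?_eq_getElem (show k < γ.length by omega)
  have := hs _ u v (infix_triple_iff.2 ⟨k, h2, h0, h1⟩) hu
  refine infix_pair_iff.2 ⟨k, ?_, h0⟩
  rw [this, h2]
  simp

theorem HasStep.right {P : Finset (ℤ × ℤ)} {γ : List (ℤ × ℤ)} (hc : IsCut P γ)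
    (hs : IsStraight P γ) {i j : ℤ} (h : HasStep γ i j) (hi : IsInteriorCorner P (i + 1, j)) :
    HasStep γ (i + 1) j := by
  rcases h with h | h
  · have := exists_next hc hs h hi
    exact Or.inl (by simpa using this)
  · have := exists_prev hc hs h hi
    exact Or.inr (by simpa using this)

theorem HasStep.left {P : Finset (ℤ × ℤ)} {γ : List (ℤ × ℤ)} (hc : IsCut P γ)
    (hs : IsStraight P γ) {i j : ℤ} (h : HasStep γ (i + 1) j) (hi : IsInteriorCorner P (i + 1, j)) :
    HasStep γ i j := by
  rcases h with h | h
  · have := exists_prev hc hs h hi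
    exact Or.inl (by simpa using this)
  · have := exists_next hc hs h hi
    exact Or.inr (by simpa using this)

theorem IsChord.isInteriorCorner {P : Finset (ℤ × ℤ)} {a j : ℤ} {n : ℕ} (h : IsChord P a j n)
    {k : ℕ} (hk : k + 1 < n) : IsInteriorCorner P (a + k + 1, j) := by
  rintro ⟨t1, t2⟩ ⟨h1, h2⟩
  have p1 := h.inside k (by omega)
  have p2 := h.inside (k + 1) hk
  push_cast at p2
  rw [← add_assoc] at p2
  simp only at h1 h2
  rcases h1 with h1 | h1 <;> rcases h2 with h2 | h2
  · subst h1 h2; exact p2.1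
  · obtain rfl : t2 = j - 1 := by omega
    subst h1; exact p2.2
  · obtain rfl : t1 = a + k := by omega
    subst h2; exact p1.1
  · obtain rfl : t2 = j - 1 := by omega
    obtain rfl : t1 = a + k := by omega
    exact p1.2

/-- A straight cut that enters a chord runs along all of it. -/
theorem IsChord.hasStep {P : Finset (ℤ × ℤ)} {a j : ℤ} {n : ℕ} (h : IsChord P a j n)
    {γ : List (ℤ × ℤ)} (hc : IsCut P γ) (hs : IsStraight P γ) {k : ℕ} (hk : k < n)
    (hk' : HasStep γ (a + k) j) : ∀ i : ℕ, i < n → HasStep γ (a + i) j := by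
  have up : ∀ m : ℕ, k + m < n → HasStep γ (a + (k + m : ℕ)) j := by
    intro m
    induction m with
    | zero => exact fun _ => hk'
    | succ m ih =>
      intro hm
      have := (ih (by omega)).right hc hs (h.isInteriorCorner (by omega))
      rwa [add_assoc] at this
  have down : ∀ m : ℕ, m ≤ k → HasStep γ (a + (k - m : ℕ)) j := by
    intro m
    induction m with
    | zero => exact fun _ => hk'
    | succ m ih =>
      intro hm
      refine HasStep.left hc hs ?_ (h.isInteriorCorner (k := k - (m + 1)) (by omega))
      have := ih (by omega)
      rwa [show a + ((k - m : ℕ) : ℤ) = a + ((k - (m + 1) : ℕ) : ℤ) + 1 by omega] at this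
  intro i hi
  rcases Nat.le_total k i with h' | h'
  · have := up (i - k) (by omega)
    rwa [Nat.add_sub_cancel' h'] at this
  · have := down (k - i) (by omega)
    rwa [Nat.sub_sub_self h'] at this

theorem HasStep.separates {γ : List (ℤ × ℤ)} {i j : ℤ} (h : HasStep γ i j) :
    Separates γ (i, j) (i, j - 1) := by
  rcases h with h | h <;> exact ⟨_, _, h, by simp [IsTileCorner]⟩

theorem exists_separates {P : Finset (ℤ × ℤ)} (hP : IsPolyomino P) {γ : List (ℤ × ℤ)}
    (h : 1 < (pieces P γ).ncard) : ∃ p ∈ P, ∃ q ∈ P, gridGraph.Adj p q ∧ Separates γ p q := by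
  by_contra! hsep
  obtain ⟨A, hA, B, hB, hAB⟩ := (Set.one_lt_ncard (Set.finite_of_ncard_ne_zero (by omega))).1 h
  rw [pieces_eq] at hA hB
  obtain ⟨p, hp, rfl⟩ := hA
  obtain ⟨q, hq, rfl⟩ := hB
  refine hAB (pieceOf_eq_of_mem ?_).symm
  exact ReflTransGen.mono (fun x y hxy => ⟨hxy.1, hxy.2.1, hxy.2.2,
    hsep x hxy.1 y hxy.2.1 hxy.2.2⟩) _ _ (hP.reflTransGen hp hq)

/-- The curve cuts everything that the chord cuts, so its pieces refine those of the chord. Both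
have two pieces, hence the same ones, and validity depends on the pieces alone. -/
theorem HasStep.exists_isChord {P : Finset (ℤ × ℤ)} (hP : IsPolyomino P) (hP' : IsHoleFree P)
    {γ : List (ℤ × ℤ)} (hγ : IsValidStraightTwoCut P γ) {i j : ℤ} (h : HasStep γ i j)
    (h1 : (i, j) ∈ P) (h2 : (i, j - 1) ∈ P) :
    ∃ (a : ℤ) (n : ℕ), IsChord P a j n ∧ IsValid P (chord a j n) := by
  obtain ⟨⟨hc, h2c⟩, hs, hv⟩ := hγ
  obtain ⟨a, n, k, ha, hk, rfl⟩ := _root_.exists_isChord h1 h2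
  have hall := ha.hasStep hc hs hk h
  refine ⟨a, n, ha, ?_⟩
  have hle : ∀ t, pieceOf P γ t ⊆ pieceOf P (chord a j n) t := by
    refine fun t u hu => ReflTransGen.mono ?_ _ _ hu
    rintro p q ⟨hp, hq, hpq, hsep⟩
    refine ⟨hp, hq, hpq, fun h' => hsep ?_⟩
    rw [separates_chord_iff hpq] at h'
    rcases h' with ⟨k, hk, rfl, rfl⟩ | ⟨k, hk, rfl, rfl⟩
    exacts [(hall k hk).separates, (hall k hk).separates.symm]
  suffices h : pieces P (chord a j n) = pieces P γ by
    unfold IsValid at hv ⊢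
    rwa [h]
  have hin := ha.inside_zero
  have hne : pieceOf P γ (a, j) ≠ pieceOf P γ (a, j - 1) := fun heq =>
    ha.notMem_pieceOf hP' (hle _ (heq ▸ mem_pieceOf_self _ _ _))
  have hpair : pieces P γ = {pieceOf P γ (a, j), pieceOf P γ (a, j - 1)} := by
    refine (Set.eq_of_subset_of_ncard_le ?_ ?_ (Set.finite_of_ncard_ne_zero (by omega))).symm
    · rintro _ (rfl | rfl) <;> rw [pieces_eq]
      exacts [⟨_, hin.1, rfl⟩, ⟨_, hin.2, rfl⟩]
    · rw [h2c, Set.ncard_pair hne]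
  have hcov : ∀ t ∈ P, t ∈ pieceOf P γ (a, j) ∨ t ∈ pieceOf P γ (a, j - 1) := by
    intro t ht
    have : pieceOf P γ t ∈ pieces P γ := by rw [pieces_eq]; exact ⟨t, ht, rfl⟩
    rw [hpair] at this
    rcases this with h | h
    exacts [Or.inl (h ▸ mem_pieceOf_self _ _ _), Or.inr (h ▸ mem_pieceOf_self _ _ _)]
  rw [ha.pieces_eq_pair hP, hpair]
  congr 1
  · refine (hle _).antisymm' fun t ht => ?_
    exact (hcov t (pieceOf_subset hin.1 ht)).resolve_right fun h =>
      ha.notMem_top hP' (hle _ h) ht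
  · congr 1
    refine (hle _).antisymm' fun t ht => ?_
    exact (hcov t (pieceOf_subset hin.2 ht)).resolve_left fun h =>
      ha.notMem_top hP' ht (hle _ h)

/-! ### Tiles and codes -/

open Relation

namespace RAM

/-- The map `code` numbers the tiles of `P` such that neighbors in a row differ by `h` and
neighbors in a column differ by `v`. -/
structure Coding (P : Finset (ℤ × ℤ)) (code : ℤ × ℤ → ℤ) (h v : ℤ) : Prop where
  h_step : ∀ x y, code (x + 1, y) = code (x, y) + h
  v_step : ∀ x y, code (x, y + 1) = code (x, y) + v
  inj : ∀ t ∈ P, ∀ u ∈ P, code t = code u → t = u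
  of_h : ∀ t ∈ P, ∀ u ∈ P, code u = code t + h → u = (t.1 + 1, t.2)
  of_v : ∀ t ∈ P, ∀ u ∈ P, code u = code t + v → u = (t.1, t.2 + 1)

namespace Coding

variable {P : Finset (ℤ × ℤ)} {code : ℤ × ℤ → ℤ} {h v : ℤ}

theorem strideAdj_h_iff (C : Coding P code h v) {t u : ℤ × ℤ} (ht : t ∈ P) (hu : u ∈ P) :
    StrideAdj h (code t) (code u) ↔ u = (t.1 + 1, t.2) ∨ t = (u.1 + 1, u.2) := by
  constructor
  · rintro (h' | h')
    · exact Or.inl (C.of_h t ht u hu h')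
    · exact Or.inr (C.of_h u hu t ht (by omega))
  · rintro (h' | h')
    · exact Or.inl (by rw [h', C.h_step])
    · exact Or.inr (by rw [h', C.h_step]; simp)

theorem strideAdj_v_iff (C : Coding P code h v) {t u : ℤ × ℤ} (ht : t ∈ P) (hu : u ∈ P) :
    StrideAdj v (code t) (code u) ↔ u = (t.1, t.2 + 1) ∨ t = (u.1, u.2 + 1) := by
  constructor
  · rintro (h' | h')
    · exact Or.inl (C.of_v t ht u hu h')
    · exact Or.inr (C.of_v u hu t ht (by omega))
  · rintro (h' | h')
    · exact Or.inl (by rw [h', C.v_step])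
    · exact Or.inr (by rw [h', C.v_step]; simp)

theorem adj_iff (C : Coding P code h v) {t u : ℤ × ℤ} (ht : t ∈ P) (hu : u ∈ P) :
    gridGraph.Adj t u ↔ StrideAdj h (code t) (code u) ∨ StrideAdj v (code t) (code u) := by
  rw [C.strideAdj_h_iff ht hu, C.strideAdj_v_iff ht hu, gridGraph_adj, or_assoc]

theorem codeConn (C : Coding P code h v) (hP : IsPolyomino P) {t : ℤ × ℤ} (ht : t ∈ P) :
    CodeConn (P.image code) h v (code t) := by
  intro a ha
  obtain ⟨u, hu, rfl⟩ := Finset.mem_image.1 ha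
  refine ReflTransGen.lift code ?_ _ _ (hP.reflTransGen ht hu)
  rintro p q ⟨hp, hq, hpq⟩
  exact ⟨Finset.mem_image_of_mem _ hp, Finset.mem_image_of_mem _ hq, (C.adj_iff hp hq).1 hpq⟩

theorem image_iff (C : Coding P code h v) {S : Set (ℤ × ℤ)} (hS : S ⊆ P) {t : ℤ × ℤ} (ht : t ∈ P) :
    code t ∈ code '' S ↔ t ∈ S := by
  refine ⟨?_, fun h => ⟨t, h, rfl⟩⟩
  rintro ⟨u, hu, h⟩
  exact C.inj u (hS hu) t ht h ▸ hu

theorem runReach (C : Coding P code h v) {a r : ℤ} {n : ℕ} (hin : ∀ k : ℕ, k < n → (a + (k : ℤ), r) ∈ P)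
    {k k' : ℕ} (hk : k < n) (hk' : k' < n) :
    RunReach (P.image code) h (code (a + (k : ℤ), r)) (code (a + (k' : ℤ), r)) := by
  have step : ∀ i : ℕ, i + 1 < n → StrideAdj h (code (a + (i : ℤ), r)) (code (a + (i + 1 : ℕ), r)) := by
    intro i hi
    rw [C.strideAdj_h_iff (hin i (by omega)) (hin _ hi)]
    exact Or.inl (by simp [add_assoc])
  have main : ∀ i : ℕ, i < n → RunReach (P.image code) h (code (a, r)) (code (a + (i : ℤ), r)) ∧
      RunReach (P.image code) h (code (a + (i : ℤ), r)) (code (a, r)) := by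
    intro i
    induction i with
    | zero => intro _; simp only [Nat.cast_zero, add_zero]; exact ⟨.refl, .refl⟩
    | succ i ih =>
      intro hi
      have h1 := Finset.mem_image_of_mem code (hin i (by omega))
      have h2 := Finset.mem_image_of_mem code (hin _ hi)
      exact ⟨.tail (ih (by omega)).1 ⟨h1, h2, step i hi⟩,
        .head ⟨h2, h1, (step i hi).symm⟩ (ih (by omega)).2⟩
  exact (main k hk).2.trans (main k' hk').1

theorem isSide_of_rows (C : Coding P code h v) {S : Set (ℤ × ℤ)} (hsub : S ⊆ P) {a r r' : ℤ} {n : ℕ}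
    (hr : ∀ k : ℕ, k < n → (a + (k : ℤ), r) ∈ P) (hr' : ∀ k : ℕ, k < n → (a + (k : ℤ), r') ∈ P)
    (key : ∀ x ∈ S, ∀ y ∈ P, y ∉ S → gridGraph.Adj x y →
      ∃ k < n, x = (a + (k : ℤ), r) ∧ y = (a + (k : ℤ), r')) :
    IsSide (P.image code) h v (code '' S) := by
  refine ⟨?_, ?_, ?_, ?_⟩
  · rintro _ ⟨x, hx, rfl⟩
    exact Finset.mem_image_of_mem _ (hsub hx)
  · rintro _ ⟨x, hx, rfl⟩ _ hy₀ hyS hadj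
    obtain ⟨y, hy, rfl⟩ := Finset.mem_image.1 hy₀
    rw [C.image_iff hsub hy] at hyS
    obtain ⟨k, -, rfl, rfl⟩ := key x hx y hy hyS ((C.adj_iff (hsub hx) hy).2 (Or.inl hadj))
    rw [C.strideAdj_h_iff (hsub hx) hy] at hadj
    simp at hadj
  all_goals
    rintro _ ⟨x, hx, rfl⟩ _ hy₀ hyS hadj _ ⟨x', hx', rfl⟩ _ hy₀' hyS' hadj'
    obtain ⟨y, hy, rfl⟩ := Finset.mem_image.1 hy₀
    obtain ⟨y', hy', rfl⟩ := Finset.mem_image.1 hy₀'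
    rw [C.image_iff hsub hy] at hyS
    rw [C.image_iff hsub hy'] at hyS'
    obtain ⟨k, hk, rfl, rfl⟩ := key x hx y hy hyS ((C.adj_iff (hsub hx) hy).2 (Or.inr hadj))
    obtain ⟨k', hk', rfl, rfl⟩ :=
      key x' hx' y' hy' hyS' ((C.adj_iff (hsub hx') hy').2 (Or.inr hadj'))
  · exact C.runReach hr hk hk'
  · exact C.runReach hr' hk hk'

/-- An adjacency that leaves the piece must be cut by the chord, so it joins the two rows along it,
and each of these is a run. -/
theorem isSide_top (C : Coding P code h v) (hP : IsHoleFree P) {a j : ℤ} {n : ℕ}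
    (hc : IsChord P a j n) :
    IsSide (P.image code) h v (code '' pieceOf P (chord a j n) (a, j)) := by
  have hsub : pieceOf P (chord a j n) (a, j) ⊆ P := pieceOf_subset hc.inside_zero.1
  refine C.isSide_of_rows hsub (fun i hi => (hc.inside i hi).1) (fun i hi => (hc.inside i hi).2)
    fun x hx y hy hyS hxy => ?_
  have hs : Separates (chord a j n) x y := by
    by_contra hs
    exact hyS (ReflTransGen.tail hx ⟨hsub hx, hy, hxy, hs⟩)
  refine ((separates_chord_iff hxy).1 hs).resolve_right ?_
  rintro ⟨k, hk, -, rfl⟩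
  exact hc.notMem_top hP (hc.mem_bot k hk) hx

theorem isSide_bot (C : Coding P code h v) (hP : IsHoleFree P) {a j : ℤ} {n : ℕ}
    (hc : IsChord P a j n) :
    IsSide (P.image code) h v (code '' pieceOf P (chord a j n) (a, j - 1)) := by
  have hsub : pieceOf P (chord a j n) (a, j - 1) ⊆ P := pieceOf_subset hc.inside_zero.2
  refine C.isSide_of_rows hsub (fun i hi => (hc.inside i hi).2) (fun i hi => (hc.inside i hi).1)
    fun x hx y hy hyS hxy => ?_
  have hs : Separates (chord a j n) x y := by
    by_contra hs
    exact hyS (ReflTransGen.tail hx ⟨hsub hx, hy, hxy, hs⟩)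
  obtain ⟨k, hk, hy, hx⟩ := ((separates_chord_iff hxy).1 hs).resolve_left (by
    rintro ⟨k, hk, rfl, -⟩
    exact hc.notMem_top hP hx (hc.mem_top k hk))
  exact ⟨k, hk, hx, hy⟩

theorem code_add (C : Coding P code h v) (x y : ℤ) (k : ℕ) :
    code (x + k, y) = code (x, y) + k * h := by
  induction k with
  | zero => simp
  | succ k ih => push_cast; rw [← add_assoc, C.h_step, ih]; ring

theorem mem_of_code (C : Coding P code h v) {x y : ℤ} (hxy : (x, y) ∈ P) {n : ℕ}
    (hn : ∀ k : ℕ, k < n → code (x, y) + k * h ∈ P.image code) : ∀ k : ℕ, k < n → (x + k, y) ∈ P := by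
  intro k
  induction k with
  | zero => intro _; simpa using hxy
  | succ k ih =>
    intro hk
    obtain ⟨u, hu, hcu⟩ := Finset.mem_image.1 (hn _ hk)
    have h1 := ih (by omega)
    have := C.of_h _ h1 u hu (by rw [hcu, C.code_add]; push_cast; ring)
    rw [this] at hu
    push_cast
    rwa [← add_assoc]

/-- The maximal pair of parallel runs found on the codes is a chord. -/
theorem exists_isChord (C : Coding P code h v) {c q : ℤ} {n : ℕ} (hn : 0 < n)
    (hcq : StrideAdj v q c)
    (hin : ∀ i : ℕ, i < n → c + i * h ∈ P.image code ∧ q + i * h ∈ P.image code)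
    (hl : ¬ (c - h ∈ P.image code ∧ q - h ∈ P.image code))
    (hr : ¬ (c + n * h ∈ P.image code ∧ q + n * h ∈ P.image code)) :
    ∃ a j, IsChord P a j n ∧
      (c = code (a, j) ∧ q = code (a, j - 1) ∨ q = code (a, j) ∧ c = code (a, j - 1)) := by
  have key : ∀ (a j : ℤ), (a, j) ∈ P → (a, j - 1) ∈ P →
      (∀ i : ℕ, i < n → code (a, j) + i * h ∈ P.image code ∧ code (a, j - 1) + i * h ∈ P.image code) →
      ¬ (code (a, j) - h ∈ P.image code ∧ code (a, j - 1) - h ∈ P.image code) →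
      ¬ (code (a, j) + n * h ∈ P.image code ∧ code (a, j - 1) + n * h ∈ P.image code) →
      IsChord P a j n := by
    intro a j h1 h2 hin hl hr
    refine ⟨hn, fun k hk => ⟨C.mem_of_code h1 (fun i hi => (hin i hi).1) k hk,
      C.mem_of_code h2 (fun i hi => (hin i hi).2) k hk⟩, fun h' => hl ?_, fun h' => hr ?_⟩
    · have e : ∀ y, code (a, y) - h = code (a - 1, y) := fun y => by
        have := C.h_step (a - 1) y
        rw [sub_add_cancel] at this
        omega
      rw [e, e]
      exact ⟨Finset.mem_image_of_mem _ h'.1, Finset.mem_image_of_mem _ h'.2⟩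
    · rw [← C.code_add, ← C.code_add]
      exact ⟨Finset.mem_image_of_mem _ h'.1, Finset.mem_image_of_mem _ h'.2⟩
  have h0 := hin 0 hn
  simp only [Nat.cast_zero, zero_mul, add_zero] at h0
  obtain ⟨⟨x, y⟩, ht, rfl⟩ := Finset.mem_image.1 h0.1
  obtain ⟨⟨x', y'⟩, hu, rfl⟩ := Finset.mem_image.1 h0.2
  rw [C.strideAdj_v_iff hu ht] at hcq
  simp only [Prod.mk.injEq] at hcq
  rcases hcq with ⟨rfl, rfl⟩ | ⟨rfl, rfl⟩
  · refine ⟨x, y' + 1, key _ _ ht (by simpa using hu) (by simpa using hin) (by simpa using hl)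
      (by simpa using hr), by simp⟩
  · refine ⟨x', y + 1, key _ _ hu (by simpa using ht) (fun i hi => by simpa using (hin i hi).symm)
      (fun h' => hl (by simpa using h'.symm)) (fun h' => hr (by simpa using h'.symm)), by simp⟩

end Coding

/-- The maps `nx` describe the four directions. -/
structure NextMaps (P : Finset (ℤ × ℤ)) (code : ℤ × ℤ → ℤ) (nx : Fin 32 → ℤ → ℤ) : Prop where
  closed : ∀ d ∈ directions, ∃ f ∈ dirs, ∀ S : Set (ℤ × ℤ), S ⊆ P → ClosedIn P d S →
    ∀ x ∈ code '' S, nx f x ∈ code '' S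
  closedIn : ∀ f ∈ dirs, ∃ d ∈ directions, ∀ S : Set (ℤ × ℤ), S ⊆ P →
    (∀ x ∈ code '' S, nx f x ∈ code '' S) → ClosedIn P d S

/-- If the chord were valid, both pieces would be closed in some direction, so by `hres` both would
contain the root; but they are disjoint. -/
theorem not_isValid_chord {P : Finset (ℤ × ℤ)} {code : ℤ × ℤ → ℤ} {h v ρ : ℤ} {nx : Fin 32 → ℤ → ℤ}
    (C : Coding P code h v) (hP : IsHoleFree P) (hN : NextMaps P code nx)
    (hres : ∀ S, IsSide (P.image code) h v S → S.Nonempty → ρ ∉ S → ∀ f ∈ dirs,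
      ¬ ∀ x ∈ S, nx f x ∈ S) {a j : ℤ} {n : ℕ} (hc : IsChord P a j n) :
    ¬ IsValid P (chord a j n) := by
  intro hv
  have hin := hc.inside_zero
  have key : ∀ t ∈ P, IsSide (P.image code) h v (code '' pieceOf P (chord a j n) t) →
      ρ ∈ code '' pieceOf P (chord a j n) t := by
    intro t ht hS
    by_contra hρ
    obtain ⟨d, hd, hcl⟩ := hv.exists_closedIn ht
    obtain ⟨f, hf, hcl'⟩ := hN.closed d hd
    exact hres _ hS ⟨_, t, mem_pieceOf_self _ _ _, rfl⟩ hρ f hf (hcl' _ (pieceOf_subset ht) hcl)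
  obtain ⟨t, ht, h1⟩ := key _ hin.1 (C.isSide_top hP hc)
  have h2 := key _ hin.2 (C.isSide_bot hP hc)
  rw [← h1, C.image_iff (pieceOf_subset hin.2) (pieceOf_subset hin.1 ht)] at h2
  exact hc.notMem_top hP h2 ht

theorem isValidStraightTwoCut_chord {P : Finset (ℤ × ℤ)} {code : ℤ × ℤ → ℤ} {h v : ℤ}
    {nx : Fin 32 → ℤ → ℤ} (C : Coding P code h v) (hP : IsPolyomino P) (hP' : IsHoleFree P)
    (hN : NextMaps P code nx) {c q : ℤ} {f : Fin 32} (hf : f ∈ dirs)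
    (hres : ∀ S, IsSide (P.image code) h v S → c ∈ S → q ∉ S → ∀ x ∈ S, nx f x ∈ S)
    {a j : ℤ} {n k : ℕ} (hc : IsChord P a j n) (hk : k < n)
    (hcq : c = code (a + k, j) ∧ q = code (a + k, j - 1) ∨
      q = code (a + k, j) ∧ c = code (a + k, j - 1)) :
    IsValidStraightTwoCut P (chord a j n) := by
  have hin := hc.inside_zero
  have hk' := hc.inside k hk
  obtain ⟨d, hd, hcl⟩ := hN.closedIn f hf
  refine hc.isValidStraightTwoCut hP hP' hd ?_
  have hn := hc.notMem_top hP' (hc.mem_bot k hk)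
  rcases hcq with ⟨rfl, rfl⟩ | ⟨rfl, rfl⟩
  · refine Or.inl (hcl _ (pieceOf_subset hin.1) (hres _ (C.isSide_top hP' hc)
      ⟨_, hc.mem_top k hk, rfl⟩ ?_))
    rwa [C.image_iff (pieceOf_subset hin.1) hk'.2]
  · refine Or.inr (hcl _ (pieceOf_subset hin.2) (hres _ (C.isSide_bot hP' hc)
      ⟨_, hc.mem_bot k hk, rfl⟩ ?_))
    rw [C.image_iff (pieceOf_subset hin.2) hk'.1]
    exact fun h => hc.notMem_top hP' h (hc.mem_top k hk)

end RAM

/-! ### Extent -/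

open Relation

/-- A function that rises by at most 1 per step takes all intermediate values on a connected set.
For the coordinates this puts `P` into an N by N box, which bounds the codes. -/
theorem IsPolyomino.lt_add_card {P : Finset (ℤ × ℤ)} (hP : IsPolyomino P) {f : ℤ × ℤ → ℤ}
    (hf : ∀ p q, gridGraph.Adj p q → f q ≤ f p + 1) {p q : ℤ × ℤ} (hp : p ∈ P) (hq : q ∈ P) :
    f q < f p + P.card := by
  have key : ∀ c, f p ≤ c → ∀ q, ReflTransGen (fun p q => p ∈ P ∧ q ∈ P ∧ gridGraph.Adj p q) p q →
      f q ≤ c ∨ ∃ u ∈ P, f u = c := by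
    intro c hc q hq
    induction hq with
    | refl => exact Or.inl hc
    | @tail u u' _ hu ih =>
      rcases ih with h | h
      · have := hf u u' hu.2.2
        rcases lt_or_ge c (f u') with h' | h'
        · exact Or.inr ⟨u, hu.1, by omega⟩
        · exact Or.inl h'
      · exact Or.inr h
  have hsub : Finset.Icc (f p) (f q) ⊆ P.image f := by
    intro c hc
    rw [Finset.mem_Icc] at hc
    rcases key c hc.1 q (hP.reflTransGen hp hq) with h | ⟨u, hu, rfl⟩
    · obtain rfl : f q = c := by omega
      exact Finset.mem_image_of_mem _ hq
    · exact Finset.mem_image_of_mem _ hu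
  have := (Finset.card_le_card hsub).trans Finset.card_image_le
  rw [Int.card_Icc] at this
  omega

/-! ### Transposition -/

def transpose (P : Finset (ℤ × ℤ)) : Finset (ℤ × ℤ) := P.image Prod.swap

theorem mem_transpose {P : Finset (ℤ × ℤ)} {t : ℤ × ℤ} : t ∈ transpose P ↔ t.swap ∈ P := by
  simp only [transpose, Finset.mem_image]
  constructor
  · rintro ⟨u, hu, rfl⟩; simpa using hu
  · exact fun h => ⟨_, h, Prod.swap_swap t⟩

theorem transpose_transpose (P : Finset (ℤ × ℤ)) : transpose (transpose P) = P := by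
  ext t; simp [mem_transpose]

theorem gridGraph_adj_swap {p q : ℤ × ℤ} : gridGraph.Adj p.swap q.swap ↔ gridGraph.Adj p q := by
  simp only [gridGraph, Prod.fst_swap, Prod.snd_swap, add_comm]

theorem connected_induce_swap {S S' : Set (ℤ × ℤ)} (h : ∀ t, t ∈ S' ↔ t.swap ∈ S)
    (hS : (gridGraph.induce S).Connected) : (gridGraph.induce S').Connected := by
  let i : gridGraph.induce S ≃g gridGraph.induce S' :=
    { (Equiv.prodComm ℤ ℤ).subtypeEquiv (fun t => by rw [h]; simp) with
      map_rel_iff' := gridGraph_adj_swap }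
  exact (SimpleGraph.Iso.connected_iff i).1 hS

theorem IsPolyomino.transpose {P : Finset (ℤ × ℤ)} (h : IsPolyomino P) : IsPolyomino (transpose P) :=
  connected_induce_swap (fun _ => mem_transpose) h

theorem IsHoleFree.transpose {P : Finset (ℤ × ℤ)} (h : IsHoleFree P) : IsHoleFree (transpose P) :=
  connected_induce_swap (S := (P : Set (ℤ × ℤ))ᶜ) (fun _ => mem_transpose.not) h

theorem isTileCorner_swap {u t : ℤ × ℤ} : IsTileCorner u.swap t.swap ↔ IsTileCorner u t :=
  and_comm

theorem isInteriorCorner_transpose {P : Finset (ℤ × ℤ)} {u : ℤ × ℤ} :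
    IsInteriorCorner (transpose P) u.swap ↔ IsInteriorCorner P u := by
  constructor
  · intro h t ht
    simpa using mem_transpose.1 (h t.swap (isTileCorner_swap.2 ht))
  · intro h t ht
    exact mem_transpose.2 (h t.swap (by rwa [← isTileCorner_swap, Prod.swap_swap]))

theorem Separates.swap {γ : List (ℤ × ℤ)} {p q : ℤ × ℤ} (h : Separates γ p q) :
    Separates (γ.map Prod.swap) p.swap q.swap := by
  obtain ⟨u, v, h0, h1, h2, h3, h4⟩ := h
  exact ⟨u.swap, v.swap, h0.map _, isTileCorner_swap.2 h1, isTileCorner_swap.2 h2,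
    isTileCorner_swap.2 h3, isTileCorner_swap.2 h4⟩

theorem map_swap_map_swap (γ : List (ℤ × ℤ)) : (γ.map Prod.swap).map Prod.swap = γ := by
  simp

theorem Link.swap {P : Finset (ℤ × ℤ)} {γ : List (ℤ × ℤ)} {p q : ℤ × ℤ} (h : Link P γ p q) :
    Link (transpose P) (γ.map Prod.swap) p.swap q.swap := by
  refine ⟨mem_transpose.2 (by simpa using h.1), mem_transpose.2 (by simpa using h.2.1),
    gridGraph_adj_swap.2 h.2.2.1, fun h' => h.2.2.2 ?_⟩
  simpa using h'.swap

theorem image_swap_pieceOf (P : Finset (ℤ × ℤ)) (γ : List (ℤ × ℤ)) (t : ℤ × ℤ) :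
    Prod.swap '' pieceOf P γ t = pieceOf (transpose P) (γ.map Prod.swap) t.swap := by
  ext u
  constructor
  · rintro ⟨u, hu, rfl⟩
    exact ReflTransGen.lift Prod.swap (fun _ _ => Link.swap) _ _ hu
  · intro hu
    have := ReflTransGen.lift Prod.swap (fun _ _ => Link.swap) _ _ hu
    rw [transpose_transpose, map_swap_map_swap, Function.onFun, Prod.swap_swap] at this
    exact ⟨_, this, Prod.swap_swap u⟩

theorem pieces_transpose (P : Finset (ℤ × ℤ)) (γ : List (ℤ × ℤ)) :
    pieces (transpose P) (γ.map Prod.swap) = (fun A => Prod.swap '' A) '' pieces P γ := by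
  rw [pieces_eq, pieces_eq, Set.image_image]
  ext A
  constructor
  · rintro ⟨t, ht, rfl⟩
    exact ⟨t.swap, mem_transpose.1 ht, by simp only [image_swap_pieceOf, Prod.swap_swap]⟩
  · rintro ⟨t, ht, rfl⟩
    exact ⟨t.swap, mem_transpose.2 (by simpa using ht), by simp only [image_swap_pieceOf]⟩

theorem swap_mem_directions {d : ℤ × ℤ} (hd : d ∈ directions) : d.swap ∈ directions := by
  rcases hd with rfl | rfl | rfl | rfl <;> simp [directions]

theorem IsValidStraightTwoCut.transpose {P : Finset (ℤ × ℤ)} {γ : List (ℤ × ℤ)}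
    (h : IsValidStraightTwoCut P γ) : IsValidStraightTwoCut (transpose P) (γ.map Prod.swap) := by
  obtain ⟨⟨⟨h1, h2, h3⟩, h4⟩, h5, A, B, hAB, d, hd, hc⟩ := h
  refine ⟨⟨⟨?_, ?_, ?_⟩, ?_⟩, ?_, Prod.swap '' A, Prod.swap '' B, ?_, d.swap,
    swap_mem_directions hd, ?_⟩
  · rw [List.isChain_map]
    exact h1.imp fun _ _ => gridGraph_adj_swap.2
  · intro u hu
    rw [List.head?_map] at hu
    obtain ⟨w, hw, rfl⟩ := Option.mem_map.1 hu
    rw [isInteriorCorner_transpose]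
    exact h2 w hw
  · intro u hu
    rw [List.getLast?_map] at hu
    obtain ⟨w, hw, rfl⟩ := Option.mem_map.1 hu
    rw [isInteriorCorner_transpose]
    exact h3 w hw
  · rw [pieces_transpose, Set.ncard_image_of_injective _ Prod.swap_injective.image_injective, h4]
  · intro u v w huvw hv
    have := huvw.map Prod.swap
    rw [map_swap_map_swap] at this
    have := h5 u.swap v.swap w.swap this (isInteriorCorner_transpose.1 (by simpa using hv))
    simpa [Prod.ext_iff, and_comm] using this
  · rw [pieces_transpose, hAB, Set.image_pair]
  · rintro m n _ ⟨p, hp, rfl⟩ _ ⟨q, hq, rfl⟩ heq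
    apply hc m n p hp q hq
    simpa [Prod.ext_iff, and_comm] using heq

/-- A polyomino with a valid straight cut has a valid chord, possibly after transposition. -/
theorem IsValidStraightTwoCut.exists_isChord {P : Finset (ℤ × ℤ)} (hP : IsPolyomino P)
    (hP' : IsHoleFree P) {γ : List (ℤ × ℤ)} (hγ : IsValidStraightTwoCut P γ) :
    (∃ a j n, IsChord P a j n ∧ IsValid P (chord a j n)) ∨
      ∃ a j n, IsChord (_root_.transpose P) a j n ∧ IsValid (_root_.transpose P) (chord a j n) := by
  have key : ∀ {P : Finset (ℤ × ℤ)} {γ : List (ℤ × ℤ)}, IsPolyomino P → IsHoleFree P →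
      IsValidStraightTwoCut P γ → ∀ {i j}, (i, j) ∈ P → (i, j + 1) ∈ P →
      Separates γ (i, j) (i, j + 1) → ∃ a j n, IsChord P a j n ∧ IsValid P (chord a j n) := by
    intro P γ hP hP' hγ i j h1 h2 hs
    obtain ⟨⟨u1, u2⟩, ⟨v1, v2⟩, huv, h3, h4, h5, h6⟩ := hs
    have hadj : gridGraph.Adj (u1, u2) (v1, v2) := by
      have := hγ.1.1.chain.infix huv
      simpa using this
    rw [gridGraph_adj] at hadj
    simp only [IsTileCorner, Prod.mk.injEq] at h3 h4 h5 h6 hadj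
    -- The only two corners shared by vertically adjacent tiles are the ends of their common
    -- horizontal side.
    have hst : HasStep γ i (j + 1) := by
      obtain rfl : u2 = j + 1 := by omega
      obtain rfl : v2 = j + 1 := by omega
      rcases hadj with h | h | h | h
      · obtain rfl : u1 = i := by omega
        obtain rfl : v1 = u1 + 1 := by omega
        exact Or.inl huv
      · obtain rfl : v1 = i := by omega
        obtain rfl : u1 = v1 + 1 := by omega
        exact Or.inr huv
      · omega
      · omega
    obtain ⟨a, n, h⟩ := hst.exists_isChord hP hP' hγ h2 (by simpa using h1)
    exact ⟨a, _, n, h⟩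
  obtain ⟨⟨i, j⟩, hp, ⟨i', j'⟩, hq, hadj, hs⟩ := exists_separates hP (by rw [hγ.1.2]; norm_num)
  rw [gridGraph_adj] at hadj
  simp only [Prod.mk.injEq] at hadj
  rcases hadj with ⟨rfl, rfl⟩ | ⟨rfl, rfl⟩ | ⟨rfl, rfl⟩ | ⟨rfl, rfl⟩
  · exact Or.inr (key hP.transpose hP'.transpose hγ.transpose (mem_transpose.2 hp)
      (mem_transpose.2 hq) hs.swap)
  · exact Or.inr (key hP.transpose hP'.transpose hγ.transpose (mem_transpose.2 hq)
      (mem_transpose.2 hp) hs.symm.swap)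
  · exact Or.inl (key hP hP' hγ hp hq hs)
  · exact Or.inl (key hP hP' hγ hq hp hs.symm)

namespace RAM

/-! ### The tables of the program -/

theorem Coding.transpose {P : Finset (ℤ × ℤ)} {code : ℤ × ℤ → ℤ} {h v : ℤ} (C : Coding P code h v) :
    Coding (_root_.transpose P) (fun t => code t.swap) v h where
  h_step x y := C.v_step y x
  v_step x y := C.h_step y x
  inj t ht u hu h := Prod.swap_injective (C.inj _ (mem_transpose.1 ht) _ (mem_transpose.1 hu) h)
  of_h t ht u hu h := by
    have := C.of_v _ (mem_transpose.1 ht) _ (mem_transpose.1 hu) h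
    simpa [Prod.ext_iff, and_comm] using this
  of_v t ht u hu h := by
    have := C.of_h _ (mem_transpose.1 ht) _ (mem_transpose.1 hu) h
    simpa [Prod.ext_iff, and_comm] using this

theorem image_transpose (P : Finset (ℤ × ℤ)) (code : ℤ × ℤ → ℤ) :
    (transpose P).image (fun t => code t.swap) = P.image code := by
  ext a
  simp only [Finset.mem_image, mem_transpose]
  constructor
  · rintro ⟨t, ht, rfl⟩; exact ⟨_, ht, rfl⟩
  · rintro ⟨t, ht, rfl⟩; exact ⟨t.swap, by simpa using ht, by simp⟩

theorem ClosedIn.swap {P : Finset (ℤ × ℤ)} {d : ℤ × ℤ} {S : Set (ℤ × ℤ)} (h : ClosedIn P d S) :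
    ClosedIn (transpose P) d.swap (Prod.swap '' S) := by
  rintro _ ⟨t, ht, rfl⟩ k hk
  have e : t.swap + k • d.swap = (t + k • d).swap := Prod.ext (by simp) (by simp)
  rw [e] at hk ⊢
  exact ⟨_, h t ht k (by simpa using mem_transpose.1 hk), rfl⟩

theorem NextMaps.transpose {P : Finset (ℤ × ℤ)} {code : ℤ × ℤ → ℤ} {nx : Fin 32 → ℤ → ℤ}
    (h : NextMaps P code nx) : NextMaps (_root_.transpose P) (fun t => code t.swap) nx := by
  have him : ∀ S : Set (ℤ × ℤ), (fun t : ℤ × ℤ => code t.swap) '' S = code '' (Prod.swap '' S) :=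
    fun S => (Set.image_image code Prod.swap S).symm
  have hsub : ∀ S : Set (ℤ × ℤ), S ⊆ _root_.transpose P → Prod.swap '' S ⊆ P := by
    rintro S hS _ ⟨t, ht, rfl⟩
    exact mem_transpose.1 (hS ht)
  constructor
  · intro d hd
    obtain ⟨f, hf, H⟩ := h.closed _ (swap_mem_directions hd)
    refine ⟨f, hf, fun S hS hcl => ?_⟩
    rw [him]
    refine H _ (hsub S hS) ?_
    have := ClosedIn.swap hcl
    rwa [transpose_transpose] at this
  · intro f hf
    obtain ⟨d, hd, H⟩ := h.closedIn f hf
    refine ⟨d.swap, swap_mem_directions hd, fun S hS hcl => ?_⟩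
    rw [him] at hcl
    have := ClosedIn.swap (H _ (hsub S hS) hcl)
    rwa [Set.image_image, show (fun t : ℤ × ℤ => t.swap.swap) '' S = S by simp] at this

theorem closedIn_iff_of_isNext {P : Finset (ℤ × ℤ)} {code cross key : ℤ × ℤ → ℤ} {nx : ℤ → ℤ}
    {d : ℤ × ℤ} (inj : ∀ t ∈ P, ∀ u ∈ P, code t = code u → t = u)
    (hck : ∀ t ∈ P, ∀ u ∈ P, cross t = cross u → key t = key u → t = u)
    (hd : ∀ t u, cross u = cross t ∧ key u < key t ↔ ∃ k : ℕ, 0 < k ∧ u = t + k • d)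
    (hnx : ∀ t ∈ P, ∃ u, IsNext cross key P t u ∧ nx (code t) = code u) {S : Set (ℤ × ℤ)}
    (hS : S ⊆ P) : ClosedIn P d S ↔ ∀ x ∈ code '' S, nx x ∈ code '' S := by
  choose! g hg using hnx
  have h1 := closed_next_iff (S := S) (fun t ht => hS ht) hck fun t ht => (hg t ht).1
  have h2 : (∀ x ∈ code '' S, nx x ∈ code '' S) ↔ ∀ t ∈ S, g t ∈ S := by
    rw [Set.forall_mem_image]
    refine forall₂_congr fun t ht => ?_
    rw [(hg t (hS ht)).2]
    refine ⟨?_, fun h => ⟨_, h, rfl⟩⟩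
    rintro ⟨u, hu, h⟩
    exact inj u (hS hu) _ (hg t (hS ht)).1.1 h ▸ hu
  rw [h2, h1]
  constructor
  · intro h t ht u hu h3 h4
    obtain ⟨k, -, rfl⟩ := (hd t u).1 ⟨h3, h4⟩
    exact h t ht k hu
  · intro h t ht k hk
    rcases Nat.eq_zero_or_pos k with rfl | hpos
    · simpa using ht
    · obtain ⟨h3, h4⟩ := (hd t _).2 ⟨k, hpos, rfl⟩
      exact h t ht _ hk h3 h4

theorem nextMaps_of_isNext {P : Finset (ℤ × ℤ)} {code : ℤ × ℤ → ℤ} {nx : Fin 32 → ℤ → ℤ}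
    {xm ym : ℤ} (inj : ∀ t ∈ P, ∀ u ∈ P, code t = code u → t = u)
    (h1 : ∀ t ∈ P, (∃ u, IsNext (fun t => t.1 - xm + 1) (fun t => t.2 - ym + 1) P t u ∧
        nx 9 (code t) = code u) ∧
      ∃ u, IsNext (fun t => t.1 - xm + 1) (fun t => -(t.2 - ym + 1)) P t u ∧ nx 10 (code t) = code u)
    (h2 : ∀ t ∈ P, (∃ u, IsNext (fun t => t.2 - ym + 1) (fun t => t.1 - xm + 1) P t u ∧
        nx 11 (code t) = code u) ∧
      ∃ u, IsNext (fun t => t.2 - ym + 1) (fun t => -(t.1 - xm + 1)) P t u ∧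
        nx 12 (code t) = code u) :
    NextMaps P code nx := by
  have e9 : ∀ {S : Set (ℤ × ℤ)}, S ⊆ P → (ClosedIn P (0, -1) S ↔ _) :=
    closedIn_iff_of_isNext inj (fun t _ u _ h h' => Prod.ext (by omega) (by omega)) (fun t u =>
      ⟨fun h => ⟨(t.2 - u.2).toNat, by omega, Prod.ext (by simp; omega) (by simp; omega)⟩,
        fun ⟨k, hk, h⟩ => by subst h; simp; omega⟩) fun t ht => (h1 t ht).1
  have e10 : ∀ {S : Set (ℤ × ℤ)}, S ⊆ P → (ClosedIn P (0, 1) S ↔ _) :=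
    closedIn_iff_of_isNext inj (fun t _ u _ h h' => Prod.ext (by omega) (by omega)) (fun t u =>
      ⟨fun h => ⟨(u.2 - t.2).toNat, by omega, Prod.ext (by simp; omega) (by simp; omega)⟩,
        fun ⟨k, hk, h⟩ => by subst h; simp; omega⟩) fun t ht => (h1 t ht).2
  have e11 : ∀ {S : Set (ℤ × ℤ)}, S ⊆ P → (ClosedIn P (-1, 0) S ↔ _) :=
    closedIn_iff_of_isNext inj (fun t _ u _ h h' => Prod.ext (by omega) (by omega)) (fun t u =>
      ⟨fun h => ⟨(t.1 - u.1).toNat, by omega, Prod.ext (by simp; omega) (by simp; omega)⟩,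
        fun ⟨k, hk, h⟩ => by subst h; simp; omega⟩) fun t ht => (h2 t ht).1
  have e12 : ∀ {S : Set (ℤ × ℤ)}, S ⊆ P → (ClosedIn P (1, 0) S ↔ _) :=
    closedIn_iff_of_isNext inj (fun t _ u _ h h' => Prod.ext (by omega) (by omega)) (fun t u =>
      ⟨fun h => ⟨(u.1 - t.1).toNat, by omega, Prod.ext (by simp; omega) (by simp; omega)⟩,
        fun ⟨k, hk, h⟩ => by subst h; simp; omega⟩) fun t ht => (h2 t ht).2
  constructor
  · rintro d (rfl | rfl | rfl | rfl)
    exacts [⟨12, by decide, fun S hS => (e12 hS).1⟩, ⟨11, by decide, fun S hS => (e11 hS).1⟩,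
      ⟨10, by decide, fun S hS => (e10 hS).1⟩, ⟨9, by decide, fun S hS => (e9 hS).1⟩]
  · intro f hf
    simp only [dirs, Finset.mem_insert, Finset.mem_singleton] at hf
    rcases hf with rfl | rfl | rfl | rfl
    exacts [⟨(0, -1), by simp [directions], fun S hS => (e9 hS).2⟩,
      ⟨(0, 1), by simp [directions], fun S hS => (e10 hS).2⟩,
      ⟨(-1, 0), by simp [directions], fun S hS => (e11 hS).2⟩,
      ⟨(1, 0), by simp [directions], fun S hS => (e12 hS).2⟩]

theorem coding_tileCode {P : Finset (ℤ × ℤ)} {xm ym N : ℤ}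
    (hbox : ∀ t ∈ P, ym ≤ t.2 ∧ t.2 < ym + N) :
    Coding P (tileCode xm ym (N + 2)) (N + 2) 1 := by
  have hs : ∀ x y, tileCode xm ym (N + 2) (x + 1, y) = tileCode xm ym (N + 2) (x, y) + (N + 2) ∧
      tileCode xm ym (N + 2) (x, y + 1) = tileCode xm ym (N + 2) (x, y) + 1 := by
    intro x y
    simp only [tileCode]
    constructor <;> ring
  refine ⟨fun x y => (hs x y).1, fun x y => (hs x y).2, fun t ht u hu h => ?_,
    fun t ht u hu h => ?_, fun t ht u hu h => ?_⟩ <;> have h1 := hbox t ht <;> have h2 := hbox u hu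
  · exact tileCode_inj ⟨by omega, by omega⟩ ⟨by omega, by omega⟩ h
  · rw [← (hs t.1 t.2).1] at h
    exact tileCode_inj ⟨by omega, by omega⟩ ⟨by simp only; omega, by simp only; omega⟩ h
  · rw [← (hs t.1 t.2).2] at h
    exact tileCode_inj ⟨by omega, by omega⟩ ⟨by simp only; omega, by simp only; omega⟩ h

/-- The state after the preparations. -/
structure Prepared (P : Finset (ℤ × ℤ)) (xm ym : ℤ) (s : State) : Prop where
  reg_card : s.reg 0 = P.card
  reg_fst : s.reg 2 = xm
  reg_snd : s.reg 3 = ym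
  reg_height : s.reg 6 = P.card + 2
  reg_root : s.reg 7 ∈ P.image (tileCode xm ym (P.card + 2))
  mem : ∀ a, 0 ≤ a → arr s 0 a = if a ∈ P.image (tileCode xm ym (P.card + 2)) then 1 else 0
  fst : ∀ t ∈ P, arr s 1 (tileCode xm ym (P.card + 2) t) = t.1 - xm + 1
  snd : ∀ t ∈ P, arr s 2 (tileCode xm ym (P.card + 2) t) = t.2 - ym + 1
  next : NextMaps P (tileCode xm ym (P.card + 2)) (arr s)
  next_mem : ∀ f ∈ dirs, ∀ x ∈ P.image (tileCode xm ym (P.card + 2)),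
    arr s f x ∈ P.image (tileCode xm ym (P.card + 2))

theorem prepare_runs {W D : ℕ} {L : List (ℤ × ℤ)} (p : Params W D L.length) (hL : L.Nodup)
    {P : Finset (ℤ × ℤ)} (hLP : L.toFinset = P) (hP : IsPolyomino P) (hb : Bounded D (input L))
    (hD : (L.length + 2) * (L.length + 2) ≤ D) :
    Runs W D L.length prepare (input L) fun s => s.reg 8 = 0 ∧
      (∀ a, 0 ≤ a → arr s 21 a = 0 ∧ arr s 22 a = 0) ∧ ∃ xm ym, Prepared P xm ym s ∧
      ∀ t ∈ P, xm ≤ t.1 ∧ t.1 < xm + P.card ∧ ym ≤ t.2 ∧ t.2 < ym + P.card := by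
  have hcard : L.length = P.card := by rw [← hLP, List.toFinset_card_of_nodup hL]
  have hmem : ∀ t, t ∈ P ↔ t ∈ L := fun t => by rw [← hLP, List.mem_toFinset]
  refine Runs.seq (scan_runs p hb) ?_
  rintro s₁ hs₁ hf₁ ⟨hm₁, hr₁, hlow, ⟨t₁, ht₁, hx₁⟩, t₂, ht₂, hy₂⟩
  have hbox : ∀ t ∈ L, s₁.reg 2 ≤ t.1 ∧ t.1 < s₁.reg 2 + L.length ∧
      s₁.reg 3 ≤ t.2 ∧ t.2 < s₁.reg 3 + L.length := by
    intro t ht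
    have h1 := hlow t ht
    have h2 := hP.lt_add_card (f := Prod.fst) (fun p q h => by
      rw [gridGraph_adj] at h; simp only [Prod.ext_iff] at h; omega) ((hmem t₁).2 ht₁) ((hmem t).2 ht)
    have h3 := hP.lt_add_card (f := Prod.snd) (fun p q h => by
      rw [gridGraph_adj] at h; simp only [Prod.ext_iff] at h; omega) ((hmem t₂).2 ht₂) ((hmem t).2 ht)
    rw [hcard]
    exact ⟨h1.1, by omega, h1.2, by omega⟩
  have z₁ : ∀ f a, 0 ≤ a → arr s₁ f a = 0 := fun f a ha => by
    rw [← arr_input L f ha, arr, arr, hm₁]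
  refine Runs.seq (fill_runs p hL hs₁ hm₁ hr₁ hbox hD) ?_
  rintro s₂ hs₂ hf₂ ⟨h6, F⟩
  rw [hLP, hcard] at F
  rw [hcard] at h6 p hbox ⊢
  have hbox' : ∀ t ∈ P, s₁.reg 2 ≤ t.1 ∧ t.1 < s₁.reg 2 + P.card ∧
      s₁.reg 3 ≤ t.2 ∧ t.2 < s₁.reg 3 + P.card := fun t ht => hbox t ((hmem t).1 ht)
  have C : Coding P (tileCode (s₁.reg 2) (s₁.reg 3) (P.card + 2)) (P.card + 2) 1 :=
    coding_tileCode fun t ht => (hbox' t ht).2.2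
  have hpos : ∀ t ∈ P, 0 < tileCode (s₁.reg 2) (s₁.reg 3) (P.card + 2) t := fun t ht => by
    have := hbox' t ht
    have h1 : 0 ≤ (t.1 - s₁.reg 2 + 1) * ((P.card : ℤ) + 2) := mul_nonneg (by omega) (by omega)
    unfold tileCode
    omega
  have r0 : s₂.reg 0 = P.card := by rw [hf₂.reg 0 rfl, hr₁, hcard]
  refine Runs.seq (link_runs (cross := fun t => t.1 - s₁.reg 2 + 1)
    (key := fun t => t.2 - s₁.reg 3 + 1) p hs₂ (Or.inl rfl) r0 C.inj hpos
    (fun t ht => by have := hbox' t ht; omega) (fun t ht => by have := hbox' t ht; omega)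
    (fun t _ u _ h h' => Prod.ext (by omega) (by omega)) F.fst F.rows
    (fun a ha => by rw [hf₂.arr 7 rfl]; exact z₁ 7 a ha)
    (fun t ht => ⟨F.self 9 (by decide) t ht, F.self 10 (by decide) t ht⟩)) ?_
  intro s₃ hs₃ hf₃ hl₁
  have F5 := F.cols
  rw [← hf₃.arr 5 rfl, ← hf₃.arr 6 rfl] at F5
  refine Runs.seq (link_runs (code := tileCode (s₁.reg 2) (s₁.reg 3) (P.card + 2))
    (cross := fun t => t.2 - s₁.reg 3 + 1)
    (key := fun t => t.1 - s₁.reg 2 + 1) p hs₃ (Or.inr rfl) ((hf₃.reg 0 rfl).trans r0) C.inj hpos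
    (fun t ht => by have := hbox' t ht; omega) (fun t ht => by have := hbox' t ht; omega)
    (fun t _ u _ h h' => Prod.ext (by omega) (by omega))
    (fun t ht => by rw [hf₃.arr 2 rfl]; exact F.snd t ht) F5
    (fun a ha => by rw [hf₃.arr 8 rfl, hf₂.arr 8 rfl]; exact z₁ 8 a ha)
    (fun t ht => by
      rw [hf₃.arr 11 rfl, hf₃.arr 12 rfl]
      exact ⟨F.self 11 (by decide) t ht, F.self 12 (by decide) t ht⟩)) ?_
  intro s₄ hs₄ hf₄ hl₂
  rw [← hf₄.arr 9 rfl, ← hf₄.arr 10 rfl] at hl₁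
  have ha : ∀ f, arr ((Cmd.setReg 8 (Expr.lit 0)).run s₄) f = arr s₄ f := fun f => rfl
  have hreg : ∀ i, i ≠ 8 → ((Cmd.setReg 8 (Expr.lit 0)).run s₄).reg i = s₄.reg i :=
    fun i hi => by simp [hi]
  refine Runs.of_run p hs₄ rfl (by simp) ⟨by simp, fun a h => ?_, s₁.reg 2, s₁.reg 3, ?_, hbox'⟩
  · rw [ha, ha, hf₄.arr 21 rfl, hf₄.arr 22 rfl, hf₃.arr 21 rfl, hf₃.arr 22 rfl, hf₂.arr 21 rfl,
      hf₂.arr 22 rfl]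
    exact ⟨z₁ 21 a h, z₁ 22 a h⟩
  · constructor
    · rw [hreg 0 (by decide), hf₄.reg 0 rfl, hf₃.reg 0 rfl, r0]
    · rw [hreg 2 (by decide), hf₄.reg 2 rfl, hf₃.reg 2 rfl, hf₂.reg 2 rfl]
    · rw [hreg 3 (by decide), hf₄.reg 3 rfl, hf₃.reg 3 rfl, hf₂.reg 3 rfl]
    · rw [hreg 6 (by decide), hf₄.reg 6 rfl, hf₃.reg 6 rfl, h6]
    · rw [hreg 7 (by decide), hf₄.reg 7 rfl, hf₃.reg 7 rfl]
      exact F.root ⟨t₁, (hmem t₁).2 ht₁⟩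
    · rw [ha, hf₄.arr 0 rfl, hf₃.arr 0 rfl]
      exact F.mem
    · rw [ha, hf₄.arr 1 rfl, hf₃.arr 1 rfl]
      exact F.fst
    · rw [ha, hf₄.arr 2 rfl, hf₃.arr 2 rfl]
      exact F.snd
    · exact nextMaps_of_isNext C.inj hl₁ hl₂
    · intro f hf x hx
      obtain ⟨t, ht, rfl⟩ := Finset.mem_image.1 hx
      simp only [dirs, Finset.mem_insert, Finset.mem_singleton] at hf
      obtain ⟨⟨u9, h9, e9⟩, u10, h10, e10⟩ := hl₁ t ht
      obtain ⟨⟨u11, h11, e11⟩, u12, h12, e12⟩ := hl₂ t ht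
      rcases hf with rfl | rfl | rfl | rfl <;> rw [ha]
      exacts [e9 ▸ Finset.mem_image_of_mem _ h9.1, e10 ▸ Finset.mem_image_of_mem _ h10.1,
        e11 ▸ Finset.mem_image_of_mem _ h11.1, e12 ▸ Finset.mem_image_of_mem _ h12.1]

end RAM

namespace RAM

/-! ### Correctness of the program -/

theorem emit_valid {W D : ℕ} {P : Finset (ℤ × ℤ)} {code : ℤ × ℤ → ℤ} {h v : ℤ} {N : ℕ}
    (hN : (P.image code).card = N)
    (p : Params W D N) (C : Coding P code h v) (hP : IsPolyomino P)
    (hP' : IsHoleFree P) {s : State} {nx : Fin 32 → ℤ → ℤ} (hnx : NextMaps P code nx)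
    {eh : Expr} {B : ℤ} (hs : Bounded D s)
    (H : Holds D (P.image code) h v s) (hB : s.reg 6 = B)
    (heh : ∀ s' : State, s'.reg 6 = B → eh.eval s' = h)
    {fa fc : Fin 32} {ra rc : ℕ} {da dc : ℤ}
    (hf : (fa, fc, ra, rc, da, dc) = (1, 2, 2, 3, 0, 1) ∨ (fa, fc, ra, rc, da, dc) = (2, 1, 3, 2, 1, 0))
    (hst : (emit fa fc ra rc da dc eh).static = true)
    (hX : ∀ t ∈ P, arr s fa (code t) + s.reg ra - 1 = t.1)
    (hY : ∀ t ∈ P, arr s fc (code t) + s.reg rc - 1 = t.2)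
    (hbox : ∀ t ∈ P, 1 ≤ arr s fa (code t) ∧ arr s fa (code t) ≤ N)
    (hb : ∀ t ∈ P, |t.1 + 1| < D ∧ |t.2 + 1| < D)
    (h8 : s.reg 8 ∈ P.image code) (h9 : s.reg 9 ∈ P.image code)
    (h89 : StrideAdj v (s.reg 9) (s.reg 8)) {f : Fin 32} (hfd : f ∈ dirs)
    (hres : ∀ S, IsSide (P.image code) h v S → s.reg 8 ∈ S → s.reg 9 ∉ S → ∀ x ∈ S, nx f x ∈ S) :
    Runs W D N (emit fa fc ra rc da dc eh) s fun s' => ∃ γ,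
      IsValidStraightTwoCut P γ ∧ output s' = if da = 0 then γ else γ.map Prod.swap := by
  subst hN
  refine Runs.mono (emit_runs p hs H hB heh hf hst h8 h9 ?_ ?_ ?_) ?_
  · intro a ha
    obtain ⟨t, ht, rfl⟩ := Finset.mem_image.1 ha
    exact hbox t ht
  · intro a ha hah
    obtain ⟨t, ht, rfl⟩ := Finset.mem_image.1 ha
    obtain ⟨u, hu, he⟩ := Finset.mem_image.1 hah
    have h1 := hX t ht
    have h2 := hX u hu
    rw [C.of_h u hu t ht (by omega)] at h1 ⊢
    rw [C.h_step, add_sub_cancel_right]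
    rw [C.h_step] at h1
    simp only at h1
    change arr s fa (code u) = _
    omega
  · intro a ha
    obtain ⟨t, ht, rfl⟩ := Finset.mem_image.1 ha
    rw [show arr s fa (code t) + s.reg ra = t.1 + 1 by linarith [hX t ht],
      show arr s fc (code t) + s.reg rc = t.2 + 1 by linarith [hY t ht]]
    exact hb t ht
  · rintro s' - - ⟨m, n, hmn, hin, hl, hr, hout⟩
    obtain ⟨a, j, hc, hcq⟩ := C.exists_isChord (by omega)
      (show StrideAdj v (s.reg 9 - m * h) (s.reg 8 - m * h) by
        unfold StrideAdj at h89 ⊢; omega) hin hl hr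
    have htop := hc.inside_zero.1
    have hbot := hc.inside_zero.2
    refine ⟨chord a j n, isValidStraightTwoCut_chord C hP hP' hnx hfd hres hc hmn ?_, ?_⟩
    · rw [C.code_add, C.code_add]
      refine hcq.imp (fun h' => ?_) fun h' => ?_ <;> rw [← h'.1, ← h'.2] <;> constructor <;> ring
    · have key : arr s fa (s.reg 8 - m * h) + s.reg ra - 1 = a ∧
          max (arr s fc (s.reg 8 - m * h)) (arr s fc (s.reg 9 - m * h)) + s.reg rc - 1 = j := by
        have x1 := hX _ htop
        have x2 := hX _ hbot
        have y1 := hY _ htop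
        have y2 := hY _ hbot
        rcases hcq with ⟨h1, h2⟩ | ⟨h1, h2⟩ <;> rw [h1, h2] <;> simp only at x1 x2 y1 y2
        · exact ⟨x1, by omega⟩
        · exact ⟨x2, by omega⟩
      rw [hout, key.1, key.2]
      split_ifs with hda
      · rfl
      · simp [chord, Function.comp_def]

/-- The transposed polyomino has the same set of codes with the strides exchanged, so the second
stage is the first one applied to the transpose, on the same tables. A cut it finds is swapped back
in the output. -/
theorem cutFinder_runs {W D : ℕ} {L : List (ℤ × ℤ)} (p : Params W D L.length) (hL : L.Nodup)
    {P : Finset (ℤ × ℤ)} (hLP : L.toFinset = P) (hP : IsPolyomino P) (hP' : IsHoleFree P)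
    (hb : Bounded D (input L)) (hD : (L.length + 2) * (L.length + 2) ≤ D)
    (hM : ∀ t ∈ P, |t.1 + 1| < D ∧ |t.2 + 1| < D) :
    Runs W D L.length cutFinder (input L) fun s =>
      ((∃ γ, IsValidStraightTwoCut P γ) → IsValidStraightTwoCut P (output s)) ∧
      ((¬ ∃ γ, IsValidStraightTwoCut P γ) → output s = []) := by
  have hcard : L.length = P.card := by rw [← hLP, List.toFinset_card_of_nodup hL]
  refine Runs.seq (prepare_runs p hL hLP hP hb hD) ?_
  rintro s₁ hs₁ - ⟨h8, hz, xm, ym, T, hbox⟩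
  rw [hcard] at p hD ⊢
  have C : Coding P (tileCode xm ym (P.card + 2)) (P.card + 2) 1 :=
    coding_tileCode fun t ht => (hbox t ht).2.2
  have hQ : (P.image (tileCode xm ym (P.card + 2))).card = P.card :=
    Finset.card_image_of_injOn fun t ht u hu h => C.inj t ht u hu h
  have CT := C.transpose
  have hQT := image_transpose P (tileCode xm ym (P.card + 2))
  set code := tileCode xm ym (P.card + 2) with hcode
  set Q := P.image code with hQdef
  have hrange : ∀ a ∈ Q, (P.card : ℤ) + 2 < a ∧ a + (P.card + 2) ≤ D := by
    intro a ha
    obtain ⟨t, ht, rfl⟩ := Finset.mem_image.1 ha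
    have h1 := hbox t ht
    have h2 : 1 * ((P.card : ℤ) + 2) ≤ (t.1 - xm + 1) * ((P.card : ℤ) + 2) :=
      mul_le_mul_of_nonneg_right (by omega) (by omega)
    have h3 : (t.1 - xm + 1) * ((P.card : ℤ) + 2) ≤ P.card * ((P.card : ℤ) + 2) :=
      mul_le_mul_of_nonneg_right (by omega) (by omega)
    have h4 : ((P.card : ℤ) + 2) * (P.card + 2) ≤ D := by exact_mod_cast hD
    rw [hcode]
    unfold tileCode
    constructor <;> nlinarith
  have hholds : ∀ {s : State}, arr s 0 = arr s₁ 0 → s.reg 0 = s₁.reg 0 →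
      Holds D Q (P.card + 2) 1 s := by
    intro s h0 h1
    refine ⟨by rw [h1, T.reg_card, hQ], by rw [h0]; exact T.mem, fun a ha => ?_, fun a ha => ?_,
      by omega, by omega⟩ <;> have := hrange a ha <;> omega
  have hholds' : ∀ {s : State}, arr s 0 = arr s₁ 0 → s.reg 0 = s₁.reg 0 →
      Holds D Q 1 (P.card + 2) s := fun h0 h1 =>
    have h := hholds h0 h1
    ⟨h.card, h.mem, fun a ha => ⟨(h.large a ha).1, (h.large a ha).2.2, (h.large a ha).2.1⟩,
      fun a ha => (h.small a ha).symm, h.v_pos, h.h_pos⟩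
  obtain ⟨t₀, ht₀, hroot⟩ := Finset.mem_image.1 T.reg_root
  have hconn : CodeConn Q (P.card + 2) 1 (s₁.reg 7) := hroot ▸ C.codeConn hP ht₀
  have hconn' : CodeConn Q 1 (P.card + 2) (s₁.reg 7) := by
    intro a ha
    refine Relation.ReflTransGen.mono ?_ _ _ (hconn a ha)
    exact fun x y h => ⟨h.1, h.2.1, h.2.2.symm⟩
  have pQ : Params W D Q.card := hQ.symm ▸ p
  have H₁ := stage_runs (vis := 21) (eh := .reg 6) (ev := .lit 1) pQ hs₁ (Or.inl rfl) rfl T.reg_root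
    (hholds rfl rfl) T.reg_height (fun _ h => h) (fun _ _ => rfl) hconn (fun a ha => (hz a ha).1)
    T.next_mem h8
  rw [hQ] at H₁
  refine Runs.seq H₁ ?_
  rintro s₂ hs₂ hf₂ R₁
  have r6 : s₂.reg 6 = P.card + 2 := (hf₂.reg 6 rfl).trans T.reg_height
  have r2 : s₂.reg 2 = xm := (hf₂.reg 2 rfl).trans T.reg_fst
  have r3 : s₂.reg 3 = ym := (hf₂.reg 3 rfl).trans T.reg_snd
  refine Runs.ite p hs₂ rfl (fun hpos => ?_) fun hneg => ?_
  · rw [eval_reg] at hpos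
    obtain ⟨h8, h9, h89, f, hf, hres⟩ := R₁.resolve_left fun h => hpos.ne' h.1
    have hX : ∀ t ∈ P, arr s₂ 1 (code t) = t.1 - xm + 1 := fun t ht => by
      rw [hf₂.arr 1 rfl]; exact T.fst t ht
    have hY : ∀ t ∈ P, arr s₂ 2 (code t) = t.2 - ym + 1 := fun t ht => by
      rw [hf₂.arr 2 rfl]; exact T.snd t ht
    refine Runs.mono (emit_valid (eh := .reg 6) hQ p C hP hP' T.next hs₂ (hholds (hf₂.arr 0 rfl) (hf₂.reg 0 rfl)) r6
      (fun _ h => h) (Or.inl rfl) rfl (fun t ht => by rw [hX t ht, r2]; ring)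
      (fun t ht => by rw [hY t ht, r3]; ring)
      (fun t ht => by have := hbox t ht; rw [hX t ht]; omega) hM h8 h9 h89 hf hres) ?_
    rintro s' - - ⟨γ, hγ, ho⟩
    rw [if_pos rfl] at ho
    exact ⟨fun _ => ho ▸ hγ, fun h => absurd ⟨γ, hγ⟩ h⟩
  rw [eval_reg] at hneg
  obtain ⟨h8', hno⟩ := R₁.resolve_right fun h => by
    have := hrange _ h.1
    omega
  have H₂ := stage_runs (vis := 22) (eh := .lit 1) (ev := .reg 6) pQ hs₂ (Or.inr rfl) rfl
    (by rw [hf₂.reg 7 rfl]; exact T.reg_root)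
    (hholds' (hf₂.arr 0 rfl) (hf₂.reg 0 rfl)) r6 (fun _ _ => rfl) (fun _ h => h)
    (by rw [hf₂.reg 7 rfl]; exact hconn')
    (fun a ha => by rw [hf₂.arr 22 rfl]; exact (hz a ha).2)
    (fun f hf => by
      have : arr s₂ f = arr s₁ f := hf₂.arr f (by revert f; decide)
      rw [this]; exact T.next_mem f hf) h8'
  rw [hQ] at H₂
  refine Runs.seq H₂ ?_
  rintro s₃ hs₃ hf₃ R₂
  have hnx : NextMaps P code (arr s₂) := by
    have : ∀ f ∈ dirs, arr s₂ f = arr s₁ f := fun f hf => hf₂.arr f (by revert f; decide)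
    refine ⟨fun d hd => ?_, fun f hf => ?_⟩
    · obtain ⟨f, hf, h⟩ := T.next.closed d hd
      exact ⟨f, hf, this f hf ▸ h⟩
    · obtain ⟨d, hd, h⟩ := T.next.closedIn f hf
      exact ⟨d, hd, this f hf ▸ h⟩
  rw [← hQT] at R₂
  refine Runs.ite p hs₃ rfl (fun hpos => ?_) fun hneg => ?_
  · rw [eval_reg] at hpos
    obtain ⟨h8, h9, h89, f, hf, hres⟩ := R₂.resolve_left fun h => hpos.ne' h.1
    have hX : ∀ t ∈ P, arr s₃ 1 (code t) = t.1 - xm + 1 := fun t ht => by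
      rw [hf₃.arr 1 rfl, hf₂.arr 1 rfl]; exact T.fst t ht
    have hY : ∀ t ∈ P, arr s₃ 2 (code t) = t.2 - ym + 1 := fun t ht => by
      rw [hf₃.arr 2 rfl, hf₂.arr 2 rfl]; exact T.snd t ht
    refine Runs.mono (emit_valid (eh := .lit 1) (hQT ▸ hQ) p CT hP.transpose hP'.transpose hnx.transpose hs₃
      (by rw [hQT]; exact hholds' ((hf₃.arr 0 rfl).trans (hf₂.arr 0 rfl))
            ((hf₃.reg 0 rfl).trans (hf₂.reg 0 rfl)))
      ((hf₃.reg 6 rfl).trans r6) (fun _ _ => rfl) (Or.inr rfl) rfl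
      (fun t ht => by rw [hY _ (mem_transpose.1 ht), hf₃.reg 3 rfl, r3, Prod.snd_swap]; ring)
      (fun t ht => by rw [hX _ (mem_transpose.1 ht), hf₃.reg 2 rfl, r2, Prod.fst_swap]; ring)
      (fun t ht => by
        have := hbox _ (mem_transpose.1 ht)
        rw [hY _ (mem_transpose.1 ht)]
        omega) (fun t ht => (hM _ (mem_transpose.1 ht)).symm) h8 h9 h89 hf hres) ?_
    rintro s' - - ⟨γ, hγ, ho⟩
    rw [if_neg (by decide)] at ho
    have hγ' := hγ.transpose
    rw [transpose_transpose, ← ho] at hγ'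
    exact ⟨fun _ => hγ', fun h => absurd ⟨_, hγ'⟩ h⟩
  · rw [eval_reg] at hneg
    obtain ⟨-, hno'⟩ := R₂.resolve_right fun h => by
      have := hrange _ (hQT ▸ h.1)
      omega
    refine Runs.of_run p hs₃ rfl (by simp) ⟨?_, fun _ => by simp [output_eq]⟩
    rintro ⟨γ, hγ⟩
    rcases hγ.exists_isChord hP hP' with ⟨a, j, n, hc, hv⟩ | ⟨a, j, n, hc, hv⟩
    · exact absurd hv (not_isValid_chord C hP' T.next hno hc)
    · exact absurd hv (not_isValid_chord CT hP'.transpose hnx.transpose hno' hc)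

end RAM

/-! ### Choice of the constants. -/

namespace RAM

theorem bounded_input {L : List (ℤ × ℤ)} {D M : ℕ} (hD : L.length ≤ D) (hM : M ≤ D)
    (h : ∀ t ∈ L, |t.1| ≤ (M : ℤ) ∧ |t.2| ≤ (M : ℤ)) : Bounded D (input L) := by
  have hget : ∀ k, |(L.getD k (0, 0)).1| ≤ (D : ℤ) ∧ |(L.getD k (0, 0)).2| ≤ (D : ℤ) := by
    intro k
    by_cases hk : k < L.length
    · have := h _ (List.getElem_mem hk)
      simp only [List.getD_eq_getElem _ _ hk]
      omega
    · simp [hk]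
  constructor
  · intro i
    simp only [input]
    split_ifs
    · rw [abs_of_nonneg (by omega)]; omega
    · simp
  · intro z
    simp only [input]
    split_ifs
    exacts [by simp, (hget _).1, (hget _).2]

/-- The value bound must be quadratic because codes reach about N². Then `1000 * D ^ 2` is 400000
times a fourth power, so a single large `K` serves as factor and as exponent. -/
theorem params_of_card {N M K : ℕ} (hN : 1 ≤ N) (hK : 400000 ≤ K) :
    Params (K * (N + M) ^ K) (20 * (N + M) ^ 2) N := by
  have h1 : 1 ≤ N + M := by omega
  have h2 : N + M ≤ (N + M) ^ 2 := Nat.le_self_pow (by norm_num) _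
  refine ⟨by omega, ?_, hN, by omega⟩
  calc 1000 * (20 * (N + M) ^ 2) ^ 2 = 400000 * (N + M) ^ 4 := by ring
    _ ≤ K * (N + M) ^ K := Nat.mul_le_mul hK (Nat.pow_le_pow_right h1 (by omega))

theorem cutFinder_correct {K : ℕ} (hK : 400000 ≤ K) {P : Finset (ℤ × ℤ)} (hP : IsPolyomino P)
    (hP' : IsHoleFree P) {L : List (ℤ × ℤ)} (hL : L.Nodup) (hLP : L.toFinset = P) {M : ℕ}
    (hM : ∀ t ∈ P, |t.1| ≤ (M : ℤ) ∧ |t.2| ≤ (M : ℤ)) :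
    ∃ (s : State) (T : ℕ), Exec (K * (P.card + M) ^ K) cutFinder (input L) s T ∧
      T ≤ 7 * P.card * cutFinder.bound ∧
      ((∃ γ, IsValidStraightTwoCut P γ) → IsValidStraightTwoCut P (output s)) ∧
      ((¬ ∃ γ, IsValidStraightTwoCut P γ) → output s = []) := by
  have hcard : L.length = P.card := by rw [← hLP, List.toFinset_card_of_nodup hL]
  have hN : 1 ≤ P.card := by
    obtain ⟨t⟩ := hP.nonempty
    exact Finset.card_pos.2 ⟨t.1, t.2⟩
  have hsq : P.card + M ≤ (P.card + M) ^ 2 := Nat.le_self_pow (by norm_num) _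
  have hML : ∀ t ∈ L, |t.1| ≤ (M : ℤ) ∧ |t.2| ≤ (M : ℤ) := fun t ht =>
    hM t (by rw [← hLP]; exact List.mem_toFinset.2 ht)
  have p : Params (K * (P.card + M) ^ K) (20 * (P.card + M) ^ 2) L.length := by
    rw [hcard]; exact params_of_card hN hK
  obtain ⟨s, T, h1, h2, -, -, h3⟩ := cutFinder_runs p hL hLP hP hP'
    (bounded_input (by omega) (by omega) hML) (by rw [hcard]; nlinarith)
    (fun t ht => by
      have h := hM t ht
      have : (P.card : ℤ) + M ≤ ((P.card + M) ^ 2 : ℕ) := by exact_mod_cast hsq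
      constructor <;> rw [abs_lt] <;> rw [abs_le, abs_le] at h <;> push_cast at this ⊢ <;> omega)
  exact ⟨s, T, h1, hcard ▸ h2, h3⟩

end RAM

theorem mainTheorem6 :
    ∃ (prog : RAM.Cmd) (C K : ℕ),
      ∀ P : Finset (ℤ × ℤ), IsPolyomino P → IsHoleFree P →
      ∀ L : List (ℤ × ℤ), L.Nodup → L.toFinset = P →
      ∀ M : ℕ, (∀ t ∈ P, |t.1| ≤ (M : ℤ) ∧ |t.2| ≤ (M : ℤ)) →
        ∃ (s : RAM.State) (T : ℕ),
          RAM.Exec (K * (P.card + M) ^ K) prog (RAM.input L) s T ∧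
          (T : ℝ) ≤ C * ((P.card : ℝ) + (reflexCount P : ℝ) ^ 2 * Real.log (reflexCount P)) ∧
          ((∃ γ, IsValidStraightTwoCut P γ) → IsValidStraightTwoCut P (RAM.output s)) ∧
          ((¬ ∃ γ, IsValidStraightTwoCut P γ) → RAM.output s = []) := by
  -- `K` is kept opaque, so that no power with this exponent is ever evaluated.
  obtain ⟨K, hK⟩ : ∃ K : ℕ, 400000 ≤ K := ⟨_, le_rfl⟩
  refine ⟨RAM.cutFinder, 7 * RAM.cutFinder.bound, K, fun P hP hP' L hL hLP M hM => ?_⟩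
  obtain ⟨s, T, h1, h2, h3⟩ := RAM.cutFinder_correct hK hP hP' hL hLP hM
  refine ⟨s, T, h1, ?_, h3⟩
  -- The linear bound already suffices; for no reflex tiles the term is 0, since `Real.log 0 = 0`.
  have hlog : 0 ≤ (reflexCount P : ℝ) ^ 2 * Real.log (reflexCount P) :=
    mul_nonneg (sq_nonneg _) (Real.log_natCast_nonneg _)
  calc (T : ℝ) ≤ (7 * P.card * RAM.cutFinder.bound : ℕ) := by exact_mod_cast h2
    _ = (7 * RAM.cutFinder.bound : ℕ) * (P.card : ℝ) := by push_cast; ring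
    _ ≤ _ := mul_le_mul_of_nonneg_left (by linarith) (Nat.cast_nonneg _)
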